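/- Let $p$ be a prime and $K$ a number field with $r_1$ real and $r_2$ complex places. Put $\mathcal{O}_{K,p}^\times = (\mathcal{O}_K\otimes\mathbb{Z}_p)^\times = \prod_{v\mid p}\mathcal{O}_{K,v}^\times$, and let $K_\infty^\circ$ be the identity component of $(K\otimes\mathbb{R})^\times$. Let $U$ be any open compact subgroup of $(\mathbb{A}_K^{p,\infty})^\times$, the group of units of the ring of finite adeles of $K$ away from $p$. Define $$H(U)=\mathbb{A}_K^\times/\overline{K^\times\cdot U\cdot K_\infty^\circ},\qquad \Gamma(U)=K^\times\cap(U\cdot\mathcal{O}_{K,p}^\times\cdot K_\infty^\circ),\qquad Q(U)=\mathcal{O}_{K,p}^\times/\overline{\Gamma(U)},$$ where the last closure is that of the image of $\Gamma(U)$ in $\mathcal{O}_{K,p}^\times$. For a compact abelian $p$-adic analytic group $G$ let $\mathbb{Z}_p[[G]]=\varprojlim_N\mathbb{Z}_p[G/N]$ ($N$ running over the open subgroups) be its Iwasawa algebra, and $\widehat G=\mathrm{Spf}\,\mathbb{Z}_p[[G]]$. Let $\mathcal{W}=\widehat{\mathcal{O}_{K,p}^\times}$, $\mathcal{W}(U)=\widehat{Q(U)}$,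 and let $\mathcal{E}(U)=\widehat{H(U)}$ be the eigenvariety for $\mathrm{GL}_1/K$ of tame level $U$. Let $\delta$ be the Leopoldt defect of $K$ at $p$, i.e. $r_1+r_2-1$ minus the $\mathbb{Z}_p$-rank (the dimension as a $p$-adic analytic group) of the closure of $\mathcal{O}_K^\times$ in $\mathcal{O}_{K,p}^\times$. The irreducible components of $\mathrm{Spf}\,A$, for $A$ one of these Iwasawa algebras, are the $\mathrm{Spf}(A/\mathfrak{P})$ with $\mathfrak{P}$ a minimal prime of $A$; the dimension of such a component is its dimension relative to $\mathbb{Z}_p$, that is, the Krull dimension of its generic fibre $(A/\mathfrak{P})[1/p]$ (so that $\mathrm{Spf}\,\mathbb{Z}_p[[T_1,\dots,T_n]]$ has dimension $n$). Then: 1. Every irreducible component $\mathrm{Spf}(A/\mathfrak{P})$ of $\mathcal{E}(U)$, where $A=\mathbb{Z}_p[[H(U)]]$, has dimension $1+r_2+\delta$; moreover the ring $A/\mathfrak{P}$ has Krull dimension $1+r_2+\delta+1$. 2. For every such $\mathfrak{P}$, the contraction $\mathfrak{p}$ of $\mathfrak{P}$ to $B=\mathbb{Z}_p[[Q(U)]]$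 is a minimal prime of $B$, and the morphism $\mathcal{E}(U)\to\mathcal{W}(U)$ maps the component $\mathrm{Spf}(A/\mathfrak{P})$ surjectively onto the component $\mathrm{Spf}(B/\mathfrak{p})$ of $\mathcal{W}(U)$: the maps on prime spectra, on points of the formal schemes (open primes) and on rig-points (maximal ideals after inverting $p$) are all surjective. 3. The morphism $\mathcal{E}(U)\to\mathcal{W}$ induced by $\mathcal{O}_{K,p}^\times\to H(U)$ is the composite of the morphism $\mathcal{E}(U)\to\mathcal{W}(U)$ induced by $Q(U)\to H(U)$, which is finite, flat and surjective (in all three senses above), and the morphism $\mathcal{W}(U)\to\mathcal{W}$ induced by $\mathcal{O}_{K,p}^\times\to Q(U)$, which is a closed immersion. -/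

import Mathlib

open NumberField IsDedekindDomain

noncomputable section

/-! ### Iwasawa algebras and character spaces -/

section IwasawaAlgebra

variable (p : ℕ) [Fact p.Prime]

/-- The transition map `ℤ_p[G/N] → ℤ_p[G/N']` for open subgroups `N ≤ N'` of `G`. -/
def iwasawaTransition {G : Type*} [CommGroup G] [TopologicalSpace G] {N N' : OpenSubgroup G}
    (h : N ≤ N') :
    MonoidAlgebra ℤ_[p] (G ⧸ (N : Subgroup G)) →+* MonoidAlgebra ℤ_[p] (G ⧸ (N' : Subgroup G)) :=
  MonoidAlgebra.mapDomainRingHom ℤ_[p]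
    (QuotientGroup.map (N : Subgroup G) (N' : Subgroup G) (MonoidHom.id G) h)

/-- The inverse limit of the group rings `ℤ_p[G/N]`, `N` running over the open subgroups of `G`,
as a subring of their product. -/
def iwasawaSubring (G : Type*) [CommGroup G] [TopologicalSpace G] :
    Subring ((N : OpenSubgroup G) → MonoidAlgebra ℤ_[p] (G ⧸ (N : Subgroup G))) where
  carrier := {a | ∀ (N N' : OpenSubgroup G) (h : N ≤ N'), iwasawaTransition p h (a N) = a N'}
  mul_mem' ha hb N N' h := by
    rw [Pi.mul_apply, Pi.mul_apply, map_mul, ha N N' h, hb N N' h]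
  one_mem' N N' h := by rw [Pi.one_apply, Pi.one_apply, map_one]
  add_mem' ha hb N N' h := by
    rw [Pi.add_apply, Pi.add_apply, map_add, ha N N' h, hb N N' h]
  zero_mem' N N' h := by rw [Pi.zero_apply, Pi.zero_apply, map_zero]
  neg_mem' ha N N' h := by rw [Pi.neg_apply, Pi.neg_apply, map_neg, ha N N' h]

/-- The Iwasawa algebra `ℤ_p⟦G⟧ = lim ℤ_p[G/N]` of a (compact) abelian topological group. The
character space `Ĝ` is the affine formal scheme `Spf ℤ_p⟦G⟧`. -/
abbrev IwasawaAlgebra (G : Type*) [CommGroup G] [TopologicalSpace G] : Type _ :=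
  iwasawaSubring p G

/-- The inverse limit topology on `ℤ_p⟦G⟧`: the coarsest one for which every coefficient of every
finite level component is continuous, as a function with values in `ℤ_p`. -/
instance iwasawaTopology (G : Type*) [CommGroup G] [TopologicalSpace G] :
    TopologicalSpace (IwasawaAlgebra p G) :=
  TopologicalSpace.induced
    (fun a (i : Σ N : OpenSubgroup G, G ⧸ (N : Subgroup G)) => (a.1 i.1).coeff i.2)
    inferInstance

/-- The ring homomorphism `ℤ_p⟦G⟧ → ℤ_p⟦G'⟧` induced by a continuous homomorphism `f : G → G'`.
Its component at `N'` is induced by `G/f⁻¹(N') → G'/N'`. On formal schemes it is the morphism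
`Ĝ' → Ĝ`, restriction of characters along `f`. -/
def iwasawaMap {G G' : Type*} [CommGroup G] [TopologicalSpace G]
    [CommGroup G'] [TopologicalSpace G'] (f : G →* G') (hf : Continuous f) :
    IwasawaAlgebra p G →+* IwasawaAlgebra p G' where
  toFun a := ⟨fun N' => MonoidAlgebra.mapDomainRingHom ℤ_[p]
      (QuotientGroup.map ((N'.comap f hf : OpenSubgroup G) : Subgroup G)
        (N' : Subgroup G') f le_rfl) (a.1 (N'.comap f hf)), by
    intro N' M' h
    have h' : N'.comap f hf ≤ M'.comap f hf := fun x hx => h hx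
    have key : (iwasawaTransition p h).comp (MonoidAlgebra.mapDomainRingHom ℤ_[p]
          (QuotientGroup.map ((N'.comap f hf : OpenSubgroup G) : Subgroup G)
            (N' : Subgroup G') f le_rfl)) =
        (MonoidAlgebra.mapDomainRingHom ℤ_[p]
          (QuotientGroup.map ((M'.comap f hf : OpenSubgroup G) : Subgroup G)
            (M' : Subgroup G') f le_rfl)).comp (iwasawaTransition p h') := by
      unfold iwasawaTransition
      rw [← MonoidAlgebra.mapDomainRingHom_comp, ← MonoidAlgebra.mapDomainRingHom_comp]
      congr 1
      ext x
      rfl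
    have h2 := congrArg (fun g => g (a.1 (N'.comap f hf))) key
    simp only [RingHom.comp_apply, a.2 _ _ h'] at h2
    exact h2⟩
  map_one' := Subtype.ext (funext fun N' => map_one _)
  map_mul' a b := Subtype.ext (funext fun N' => map_mul _ _ _)
  map_zero' := Subtype.ext (funext fun N' => map_zero _)
  map_add' a b := Subtype.ext (funext fun N' => map_add _ _ _)

end IwasawaAlgebra

/-! ### Affine formal schemes over `ℤ_p`

The affine formal scheme `Spf A` is handled through the topological ring `A`; a morphism
`Spf A → Spf B` is a continuous ring homomorphism `B → A`. The irreducible components of `Spf A`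
are the `Spf (A/𝔓)` with `𝔓` a minimal prime of `A`. -/

/-- The points of the underlying space of `Spf A`: the open prime ideals of `A`. -/
def spfPoints (A : Type*) [CommRing A] [TopologicalSpace A] : Set (PrimeSpectrum A) :=
  {q | IsOpen (q.asIdeal : Set A)}

/-- The rig-points of `Spf A`, i.e. the maximal ideals of `A[1/p]`, described as ideals of `A`:
the prime ideals that are maximal among those not containing `p`. -/
def rigPoints (p : ℕ) (A : Type*) [CommRing A] : Set (PrimeSpectrum A) :=
  {q | Maximal (fun q' : PrimeSpectrum A => (p : A) ∉ q'.asIdeal) q}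

/-- The dimension of `Spf A` relative to `ℤ_p`, that is, the dimension of the generic fibre
`Spec A[1/p]`. It is normalised so that `Spf ℤ_p⟦T₁, …, Tₙ⟧` has dimension `n`. -/
def formalDim (p : ℕ) (A : Type*) [CommRing A] : WithBot ℕ∞ :=
  ringKrullDim (Localization.Away (p : A))

/-- The morphism `Spf A → Spf B` given by `φ : B → A` maps the closed formal subscheme
`Spf (A/I)` onto `Spf (B/J)`: surjectivity holds for prime spectra, for the points of the
formal schemes, and for the rig-points. -/
def MapsOnto (p : ℕ) {B A : Type*} [CommRing B] [TopologicalSpace B] [CommRing A]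
    [TopologicalSpace A] (φ : B →+* A) (I : Ideal A) (J : Ideal B) : Prop :=
  PrimeSpectrum.comap φ '' PrimeSpectrum.zeroLocus (I : Set A)
      = PrimeSpectrum.zeroLocus (J : Set B) ∧
  PrimeSpectrum.comap φ '' (PrimeSpectrum.zeroLocus (I : Set A) ∩ spfPoints A)
      = PrimeSpectrum.zeroLocus (J : Set B) ∩ spfPoints B ∧
  PrimeSpectrum.comap φ '' (PrimeSpectrum.zeroLocus (I : Set A) ∩ rigPoints p A)
      = PrimeSpectrum.zeroLocus (J : Set B) ∩ rigPoints p B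

/-- The morphism `Spf A → Spf B` given by `φ : B → A` is finite, flat and surjective. -/
structure IsFiniteFlatSurjective (p : ℕ) {B A : Type*} [CommRing B] [TopologicalSpace B]
    [CommRing A] [TopologicalSpace A] (φ : B →+* A) : Prop where
  continuous : Continuous φ
  finite : φ.Finite
  flat : φ.Flat
  surjective : MapsOnto p φ ⊥ ⊥

/-- The morphism `Spf A → Spf B` given by `φ : B → A` is a closed immersion: `φ` identifies the
topological ring `A` with a quotient of `B`. -/
def IsFormalClosedImmersion {B A : Type*} [CommRing B] [TopologicalSpace B]
    [CommRing A] [TopologicalSpace A] (φ : B →+* A) : Prop :=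
  IsOpenQuotientMap φ

/-! ### Adelic objects -/

section Adelic

variable (p : ℕ) (K : Type*) [Field K] [NumberField K]

/-- The places of `K` above `p`. -/
abbrev PlacesAbove : Type _ := {v : HeightOneSpectrum (𝓞 K) // (p : 𝓞 K) ∈ v.asIdeal}

/-- The finite places of `K` away from `p`. -/
abbrev PlacesAway : Type _ := {v : HeightOneSpectrum (𝓞 K) // (p : 𝓞 K) ∉ v.asIdeal}

/-- `𝓞_{K,p} = 𝓞_K ⊗ ℤ_p = ∏_{v ∣ p} 𝓞_{K,v}`. -/
abbrev IntegersAt : Type _ := (v : PlacesAbove p K) → v.1.adicCompletionIntegers K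

open scoped RestrictedProduct in
/-- The ring `𝔸_K^{p,∞}` of finite adeles away from `p`. -/
abbrev TameAdeleRing : Type _ :=
  Πʳ v : PlacesAway p K, [v.1.adicCompletion K, v.1.adicCompletionIntegers K]

/-- The projection `𝔸_K → K ⊗ ℝ`. -/
def adeleToInfinite : AdeleRing (𝓞 K) K →+* InfiniteAdeleRing K :=
  RingHom.fst (InfiniteAdeleRing K) (FiniteAdeleRing (𝓞 K) K)

/-- The projection `𝔸_K → 𝔸_K^{p,∞}`. -/
def adeleToTame : AdeleRing (𝓞 K) K →+* TameAdeleRing p K where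
  toFun x := ⟨fun v => x.2 v.1, Subtype.val_injective.tendsto_cofinite.eventually x.2.2⟩
  map_one' := rfl
  map_mul' _ _ := rfl
  map_zero' := rfl
  map_add' _ _ := rfl

open scoped Classical in
/-- Extension of an element of `𝓞_{K,p}` by `1` to a family of local integers at all finite
places. -/
def extendByOne (x : IntegersAt p K) (v : HeightOneSpectrum (𝓞 K)) :
    v.adicCompletionIntegers K :=
  if h : (p : 𝓞 K) ∈ v.asIdeal then x ⟨v, h⟩ else 1

/-- The multiplicative map `𝓞_{K,p} → 𝔸_K` extending by `1` at all places not above `p`. -/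
def integersAtToAdele : IntegersAt p K →* AdeleRing (𝓞 K) K where
  toFun x := ((1 : InfiniteAdeleRing K),
    (RestrictedProduct.structureMap _ _ _ (extendByOne p K x) : FiniteAdeleRing (𝓞 K) K))
  map_one' := by
    refine Prod.ext rfl (FiniteAdeleRing.ext K fun v => ?_)
    change ((extendByOne p K 1 v : v.adicCompletionIntegers K) : v.adicCompletion K) = 1
    unfold extendByOne
    split_ifs <;> rfl
  map_mul' x y := by
    refine Prod.ext (mul_one _).symm (FiniteAdeleRing.ext K fun v => ?_)
    change ((extendByOne p K (x * y) v : v.adicCompletionIntegers K) : v.adicCompletion K) =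
      (extendByOne p K x v : v.adicCompletion K) * (extendByOne p K y v : v.adicCompletion K)
    unfold extendByOne
    split_ifs
    · rfl
    · simp

theorem continuous_integersAtToAdele : Continuous (integersAtToAdele p K) := by
  have h1 : Continuous (extendByOne p K) := by
    refine continuous_pi fun v => ?_
    unfold extendByOne
    split_ifs with h
    · exact continuous_apply _
    · exact continuous_const
  have h2 : Continuous fun x => (RestrictedProduct.structureMap _ _ _ (extendByOne p K x) :
      FiniteAdeleRing (𝓞 K) K) := RestrictedProduct.isEmbedding_structureMap.continuous.comp h1
  exact (continuous_const (y := (1 : InfiniteAdeleRing K))).prodMk h2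

/-- The inclusion `𝓞_{K,p}ˣ → 𝔸_Kˣ`. -/
def unitsAtToIdele : (IntegersAt p K)ˣ →* (AdeleRing (𝓞 K) K)ˣ :=
  Units.map (integersAtToAdele p K)

theorem continuous_unitsAtToIdele : Continuous (unitsAtToIdele p K) :=
  Continuous.units_map _ (continuous_integersAtToAdele p K)

/-- The diagonal embedding `Kˣ → 𝔸_Kˣ`. -/
def principalIdele : Kˣ →* (AdeleRing (𝓞 K) K)ˣ :=
  Units.map (algebraMap K (AdeleRing (𝓞 K) K) : K →* AdeleRing (𝓞 K) K)

/-- `K_∞°`, the identity component of `(K ⊗ ℝ)ˣ`, as a subgroup of `𝔸_Kˣ` (trivial components at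
the finite places). -/
def infiniteComponent : Subgroup (AdeleRing (𝓞 K) K)ˣ where
  carrier := {x | Units.map (adeleToInfinite K : AdeleRing (𝓞 K) K →* InfiniteAdeleRing K) x ∈
      Subgroup.connectedComponentOfOne (InfiniteAdeleRing K)ˣ ∧
    ∀ v : HeightOneSpectrum (𝓞 K), x.1.2 v = 1}
  mul_mem' := by
    rintro x y ⟨hx, hx'⟩ ⟨hy, hy'⟩
    refine ⟨?_, fun v => ?_⟩
    · rw [map_mul]; exact mul_mem hx hy
    · change x.1.2 v * y.1.2 v = 1
      rw [hx', hy', one_mul]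
  one_mem' := ⟨by rw [map_one]; exact one_mem _, fun v => rfl⟩
  inv_mem' := by
    rintro x ⟨hx, hx'⟩
    refine ⟨?_, fun v => ?_⟩
    · rw [map_inv]; exact inv_mem hx
    · have h : x.1.2 v * (x⁻¹).1.2 v = 1 :=
        congrArg (fun z : AdeleRing (𝓞 K) K => z.2 v) x.mul_inv
      rwa [hx', one_mul] at h

variable {p K}

/-- A subgroup `U` of `(𝔸_K^{p,∞})ˣ`, regarded as a subgroup of `𝔸_Kˣ` (trivial components at the
infinite places and at the places above `p`). -/
def tameSubgroup (U : Subgroup (TameAdeleRing p K)ˣ) : Subgroup (AdeleRing (𝓞 K) K)ˣ where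
  carrier := {x | Units.map (adeleToTame p K : AdeleRing (𝓞 K) K →* TameAdeleRing p K) x ∈ U ∧
    x.1.1 = 1 ∧ ∀ v : PlacesAbove p K, x.1.2 v.1 = 1}
  mul_mem' := by
    rintro x y ⟨hx, hx', hx''⟩ ⟨hy, hy', hy''⟩
    refine ⟨?_, ?_, fun v => ?_⟩
    · rw [map_mul]; exact mul_mem hx hy
    · change x.1.1 * y.1.1 = 1
      rw [hx', hy', one_mul]
    · change x.1.2 v.1 * y.1.2 v.1 = 1
      rw [hx'', hy'', one_mul]
  one_mem' := ⟨by rw [map_one]; exact one_mem _, rfl, fun v => rfl⟩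
  inv_mem' := by
    rintro x ⟨hx, hx', hx''⟩
    refine ⟨?_, ?_, fun v => ?_⟩
    · rw [map_inv]; exact inv_mem hx
    · have h : x.1.1 * (x⁻¹).1.1 = 1 :=
        congrArg (fun z : AdeleRing (𝓞 K) K => z.1) x.mul_inv
      rwa [hx', one_mul] at h
    · have h : x.1.2 v.1 * (x⁻¹).1.2 v.1 = 1 :=
        congrArg (fun z : AdeleRing (𝓞 K) K => z.2 v.1) x.mul_inv
      rwa [hx'', one_mul] at h

variable (U : Subgroup (TameAdeleRing p K)ˣ)

/-- The subgroup `Kˣ · U · K_∞°` of `𝔸_Kˣ`. -/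
def levelSubgroup : Subgroup (AdeleRing (𝓞 K) K)ˣ :=
  (principalIdele K).range ⊔ tameSubgroup U ⊔ infiniteComponent K

/-- `H(U)`, the quotient of `𝔸_Kˣ` by the closure of `Kˣ · U · K_∞°`. -/
abbrev HGroup : Type _ := (AdeleRing (𝓞 K) K)ˣ ⧸ (levelSubgroup U).topologicalClosure

/-- `Γ(U) = Kˣ ∩ (U · 𝓞_{K,p}ˣ · K_∞°)`, as a subgroup of `Kˣ`. -/
def globalUnits : Subgroup Kˣ :=
  (tameSubgroup U ⊔ (unitsAtToIdele p K).range ⊔ infiniteComponent K).comap (principalIdele K)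

/-- The image of `Γ(U)` in `𝓞_{K,p}ˣ`: the elements all of whose components are equal to one and
the same element of `Γ(U)`. -/
def globalUnitsAt : Subgroup (IntegersAt p K)ˣ where
  carrier := {x | ∃ k ∈ globalUnits U, ∀ v : PlacesAbove p K,
    ((x.1 v : v.1.adicCompletionIntegers K) : v.1.adicCompletion K) =
      (((k : K) : v.1.adicCompletion K))}
  mul_mem' := by
    rintro x y ⟨k, hk, hkx⟩ ⟨l, hl, hly⟩
    refine ⟨k * l, mul_mem hk hl, fun v => ?_⟩
    rw [Units.val_mul k l, HeightOneSpectrum.adicCompletion.coe_mul, ← hkx, ← hly]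
    rfl
  one_mem' := ⟨1, one_mem _, fun v => (HeightOneSpectrum.adicCompletion.coe_one ..).symm⟩
  inv_mem' := by
    rintro x ⟨k, hk, hkx⟩
    refine ⟨k⁻¹, inv_mem hk, fun v => ?_⟩
    have h1 : ((x.1 v : v.1.adicCompletionIntegers K) : v.1.adicCompletion K) *
        (((x⁻¹).1 v : v.1.adicCompletionIntegers K) : v.1.adicCompletion K) = 1 :=
      congrArg (fun z : IntegersAt p K => (z v : v.1.adicCompletion K)) x.mul_inv
    have h2 : ((k : K) : v.1.adicCompletion K) * (((k⁻¹ : Kˣ) : K) : v.1.adicCompletion K) = 1 := by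
      rw [← HeightOneSpectrum.adicCompletion.coe_mul, Units.mul_inv]
      exact HeightOneSpectrum.adicCompletion.coe_one ..
    rw [← hkx] at h2
    exact mul_left_cancel₀ (left_ne_zero_of_mul_eq_one h1) (h1.trans h2.symm)

/-- `Q(U)`, the quotient of `𝓞_{K,p}ˣ` by the closure of `Γ(U)`. -/
abbrev QGroup : Type _ := (IntegersAt p K)ˣ ⧸ (globalUnitsAt U).topologicalClosure

/-- The map `𝓞_{K,p}ˣ → H(U)`. -/
def unitsToH : (IntegersAt p K)ˣ →* HGroup U :=
  (QuotientGroup.mk' (levelSubgroup U).topologicalClosure).comp (unitsAtToIdele p K)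

theorem continuous_unitsToH : Continuous (unitsToH U) :=
  QuotientGroup.continuous_mk.comp (continuous_unitsAtToIdele p K)

/-- The projection `𝓞_{K,p}ˣ → Q(U)`. -/
def unitsToQ : (IntegersAt p K)ˣ →* QGroup U :=
  QuotientGroup.mk' (globalUnitsAt U).topologicalClosure

theorem continuous_unitsToQ : Continuous (unitsToQ U) := QuotientGroup.continuous_mk

theorem globalUnitsAt_closure_le : (globalUnitsAt U).topologicalClosure ≤ (unitsToH U).ker := by
  refine Subgroup.topologicalClosure_minimal _ ?_ ?_
  · rintro x ⟨k, hk, hkx⟩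
    obtain ⟨a, ha, z, hz, haz⟩ := Subgroup.mem_sup.1 (Subgroup.mem_comap.1 hk)
    obtain ⟨u, hu, _, ⟨y, rfl⟩, rfl⟩ := Subgroup.mem_sup.1 ha
    have hxy : x = y := by
      refine Units.ext (funext fun v => Subtype.ext ?_)
      rw [hkx v]
      have h : u.1.2 v.1 * (unitsAtToIdele p K y).1.2 v.1 * z.1.2 v.1 =
          ((k : K) : v.1.adicCompletion K) :=
        congrArg (fun w : (AdeleRing (𝓞 K) K)ˣ => w.1.2 v.1) haz
      rw [hu.2.2 v, hz.2 v.1, one_mul, mul_one] at h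
      rw [← h]
      change ((extendByOne p K y.1 v.1 : v.1.adicCompletionIntegers K) : v.1.adicCompletion K) = _
      rw [extendByOne, dif_pos v.2]
    subst hxy
    refine (QuotientGroup.eq_one_iff _).2 (Subgroup.le_topologicalClosure _ ?_)
    have h : unitsAtToIdele p K x = principalIdele K k * u⁻¹ * z⁻¹ := by
      rw [← haz, mul_comm u, mul_assoc, mul_assoc, mul_comm z, mul_assoc, mul_assoc]
      simp
    rw [h]
    refine mul_mem (mul_mem ?_ (inv_mem ?_)) (inv_mem ?_)
    · exact Subgroup.mem_sup_left (Subgroup.mem_sup_left ⟨k, rfl⟩)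
    · exact Subgroup.mem_sup_left (Subgroup.mem_sup_right hu)
    · exact Subgroup.mem_sup_right hz
  · have h : ((unitsToH U).ker : Set (IntegersAt p K)ˣ) =
        unitsAtToIdele p K ⁻¹' ((levelSubgroup U).topologicalClosure : Set _) :=
      Set.ext fun x => QuotientGroup.eq_one_iff _
    rw [h]
    exact (Subgroup.isClosed_topologicalClosure _).preimage (continuous_unitsAtToIdele p K)

/-- The map `Q(U) → H(U)` induced by `𝓞_{K,p}ˣ → H(U)`. -/
def qToH : QGroup U →* HGroup U :=
  QuotientGroup.lift (globalUnitsAt U).topologicalClosure (unitsToH U)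
    fun _ hx => globalUnitsAt_closure_le U hx

theorem continuous_qToH : Continuous (qToH U) :=
  continuous_quot_lift _ (continuous_unitsToH U)

variable [Fact p.Prime]

/-- `ℤ_p⟦𝓞_{K,p}ˣ⟧ → ℤ_p⟦H(U)⟧`: the morphism from the eigenvariety `ℰ(U)` to `𝒲`. -/
def weightMap : IwasawaAlgebra p (IntegersAt p K)ˣ →+* IwasawaAlgebra p (HGroup U) :=
  iwasawaMap p (unitsToH U) (continuous_unitsToH U)

/-- `ℤ_p⟦Q(U)⟧ → ℤ_p⟦H(U)⟧`: the morphism from the eigenvariety `ℰ(U)` to `𝒲(U)`. -/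
def weightMapOnto : IwasawaAlgebra p (QGroup U) →+* IwasawaAlgebra p (HGroup U) :=
  iwasawaMap p (qToH U) (continuous_qToH U)

/-- `ℤ_p⟦𝓞_{K,p}ˣ⟧ → ℤ_p⟦Q(U)⟧`: the inclusion of `𝒲(U)` in `𝒲`. -/
def weightInclusion : IwasawaAlgebra p (IntegersAt p K)ˣ →+* IwasawaAlgebra p (QGroup U) :=
  iwasawaMap p (unitsToQ U) (continuous_unitsToQ U)

end Adelic

/-! ### The Leopoldt defect -/

section Leopoldt

variable (p : ℕ) [Fact p.Prime]

/-- The dimension of an abelian `p`-adic analytic group `G`: the `r` for which `G` has an open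
subgroup isomorphic to `ℤ_p^r` as a topological group. -/
def padicAnalyticDim (G : Type*) [CommGroup G] [TopologicalSpace G] : ℕ :=
  sInf {r : ℕ | ∃ N : OpenSubgroup G,
    Nonempty ((N : Subgroup G) ≃ₜ* Multiplicative (Fin r → ℤ_[p]))}

variable (K : Type*) [Field K] [NumberField K]

/-- The embedding `𝓞_Kˣ → 𝓞_{K,p}ˣ`. -/
def globalToUnitsAt : (𝓞 K)ˣ →* (IntegersAt p K)ˣ :=
  Units.map (RingHom.pi fun v : PlacesAbove p K =>
    algebraMap (𝓞 K) (v.1.adicCompletionIntegers K) : 𝓞 K →* IntegersAt p K)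

/-- The Leopoldt defect `δ`: the difference between `r₁ + r₂ - 1`, the rank of `𝓞_Kˣ`, and the
`ℤ_p`-rank of the closure of `𝓞_Kˣ` in `𝓞_{K,p}ˣ` (which is at most `r₁ + r₂ - 1`). -/
def leopoldtDefect : ℕ :=
  NumberField.Units.rank K -
    padicAnalyticDim p ((globalToUnitsAt p K).range.topologicalClosure)

end Leopoldt

end

/-!
The group `H(U)` contains `Q(U)` as an open subgroup of finite index, and everything is deduced
from the structure of the Iwasawa algebras of these two groups.

*The groups.* The map `Q(U) → H(U)` is injective because `U · 𝓞_{K,p}ˣ · K_∞°` is open in the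
ideles (`mem_closure_globalUnitsAt`). Its image has finite index by the finiteness of the class
number (`index_principalIdele_sup_unitIdeles_ne_zero`) and because `U · 𝓞_{K,p}ˣ · K_∞°` has
finite index in the ideles that are units at all finite places
(`relIndex_levelUnits_unitIdeles_ne_zero`), the group `(K ⊗ ℝ)ˣ` having finitely many components.
The group `𝓞_{K,p}ˣ` contains `ℤ_p^{[K : ℚ]}` as an open subgroup, namely the principal units
modulo `p²` (`exists_chart_units_integersAt`). The group `Γ(U)` consists of units of `𝓞_K` and
contains a power of each of them, as `U` is compact and open (`globalUnitsAt_le_range`,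
`exists_pow_globalToUnitsAt_mem`), so its closure has the rank `r₁ + r₂ - 1 - δ` of the closure of
`𝓞_Kˣ`. Since `[K : ℚ] = r₁ + 2 r₂`, the quotient `Q(U)` contains `ℤ_p^{1 + r₂ + δ}` as an open
subgroup (`exists_padic_to_QGroup`), and so does `H(U)`.

*Morphisms.* If `G` is an open subgroup of the compact group `G'`, then `ℤ_p⟦G'⟧` is free over
`ℤ_p⟦G⟧` on a system of coset representatives (`IwasawaAlgebra.basis`). Hence `ℤ_p⟦G⟧ → ℤ_p⟦G'⟧`
is finite and flat. By integrality it maps closed formal subschemes onto their images, on primes,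
on open primes and on rig-points (`mapsOnto_comap_of_isIntegral`), and by going down it contracts
minimal primes to minimal primes (`comap_mem_minimalPrimes_of_flat`). A surjection of compact
groups induces a quotient map of Iwasawa algebras, as these are compact and the group elements are
dense (`IwasawaAlgebra.isOpenQuotientMap_iwasawaMap`).

*Dimensions.* The ring `ℤ_p⟦G × ℤ_p⟧` is the power series ring over `ℤ_p⟦G⟧` in the variable
`[γ] - 1`, where `γ` is a topological generator of `ℤ_p`
(`IwasawaAlgebra.nonempty_prod_ringEquiv_powerSeries`). So `ℤ_p⟦ℤ_p^d⟧` is `ℤ_p⟦T₁, …, T_d⟧`, a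
domain of dimension `d + 1` whose generic fibre has dimension `d`. A component of a finite flat
algebra over it is an integral extension of it, hence has the same dimensions
(`IsFormallySmoothLike.dim_quotient_minimalPrime`).
-/

noncomputable section

/-! ### The topology of the Iwasawa algebra -/

section IwasawaTopology

variable (p : ℕ) [Fact p.Prime]

namespace PadicInt

/-- A `p`-adic integer divisible by every power of `p` vanishes. -/
theorem eq_zero_of_forall_pow_dvd {x : ℤ_[p]} (h : ∀ k : ℕ, (p : ℤ_[p]) ^ k ∣ x) : x = 0 := by
  by_contra hx
  have := h (x.valuation + 1)
  rw [← Ideal.mem_span_singleton, ← PadicInt.norm_le_pow_iff_mem_span_pow,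
    PadicInt.norm_le_pow_iff_le_valuation x hx] at this
  omega

theorem exists_pow_dvd_subset_of_mem_nhds {x : ℤ_[p]} {s : Set ℤ_[p]} (hs : s ∈ nhds x) :
    ∃ k : ℕ, ∀ y, (p : ℤ_[p]) ^ k ∣ y - x → y ∈ s := by
  obtain ⟨ε, hε, h⟩ := Metric.mem_nhds_iff.1 hs
  obtain ⟨k, hk⟩ := PadicInt.exists_pow_neg_lt p hε
  refine ⟨k, fun y hy => h ?_⟩
  rw [← Ideal.mem_span_singleton, ← PadicInt.norm_le_pow_iff_mem_span_pow] at hy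
  rw [Metric.mem_ball, dist_eq_norm]
  exact hy.trans_lt hk

end PadicInt

namespace MonoidAlgebra

theorem coeff_mapDomainRingHom {R M N : Type*} [Semiring R] [Monoid M] [Monoid N] [Fintype M]
    [DecidableEq N] (f : M →* N) (x : MonoidAlgebra R M) (y : N) :
    (MonoidAlgebra.mapDomainRingHom R f x).coeff y = ∑ m with f m = y, x.coeff m := by
  rw [MonoidAlgebra.mapDomainRingHom_apply]
  change (Finsupp.mapDomain f x.coeff) y = _
  rw [Finsupp.mapDomain, Finsupp.sum_fintype _ _ (by simp), Finsupp.finsetSum_apply,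
    Finset.sum_filter]
  exact Finset.sum_congr rfl fun m _ => by simp [Finsupp.single_apply]

theorem coeff_mul_fintype {R M : Type*} [Semiring R] [Mul M] [Fintype M] [DecidableEq M]
    (x y : MonoidAlgebra R M) (m : M) :
    (x * y).coeff m = ∑ a, ∑ b, if a * b = m then x.coeff a * y.coeff b else 0 := by
  rw [MonoidAlgebra.coeff_mul, Finsupp.sum_fintype _ _ (by simp)]
  exact Finset.sum_congr rfl fun a _ => Finsupp.sum_fintype _ _ (by simp)

/-- Divisibility by a natural number in a monoid algebra is tested on coefficients. -/
theorem natCast_dvd_iff {R M : Type*} [CommRing R] [CommMonoid M] [Finite M]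
    (n : ℕ) (x : MonoidAlgebra R M) :
    (n : MonoidAlgebra R M) ∣ x ↔ ∀ m, (n : R) ∣ x.coeff m := by
  constructor
  · rintro ⟨y, rfl⟩ m
    rw [MonoidAlgebra.natCast_def, MonoidAlgebra.coeff_single_one_mul]
    exact dvd_mul_right _ _
  · intro h
    choose c hc using h
    refine ⟨.ofCoeff (Finsupp.equivFunOnFinite.symm c), MonoidAlgebra.coeff_injective ?_⟩
    ext m
    rw [MonoidAlgebra.natCast_def, MonoidAlgebra.coeff_single_one_mul, hc]
    rfl

end MonoidAlgebra

namespace IwasawaAlgebra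

variable {p}
variable {G : Type*} [CommGroup G] [TopologicalSpace G]

@[ext]
theorem ext {a b : IwasawaAlgebra p G} (h : ∀ (N : OpenSubgroup G) (x : G ⧸ (N : Subgroup G)),
    (a.1 N).coeff x = (b.1 N).coeff x) : a = b :=
  Subtype.ext (funext fun N => MonoidAlgebra.coeff_injective (Finsupp.ext fun x => h N x))

variable (p G) in
/-- All coefficients of all finite level components of an element of the Iwasawa algebra. -/
def coeffs (a : IwasawaAlgebra p G) (i : Σ N : OpenSubgroup G, G ⧸ (N : Subgroup G)) : ℤ_[p] :=
  (a.1 i.1).coeff i.2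

theorem isEmbedding_coeffs : Topology.IsEmbedding (coeffs p G) :=
  ⟨⟨rfl⟩, fun _ _ h => ext fun N x => congrFun h ⟨N, x⟩⟩

theorem continuous_coeff (N : OpenSubgroup G) (x : G ⧸ (N : Subgroup G)) :
    Continuous fun a : IwasawaAlgebra p G => (a.1 N).coeff x :=
  (continuous_apply (⟨N, x⟩ : Σ N : OpenSubgroup G, G ⧸ (N : Subgroup G))).comp
    isEmbedding_coeffs.continuous

theorem continuous_iff {X : Type*} [TopologicalSpace X] {f : X → IwasawaAlgebra p G} :
    Continuous f ↔ ∀ (N : OpenSubgroup G) (x : G ⧸ (N : Subgroup G)),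
      Continuous fun y => ((f y).1 N).coeff x := by
  rw [isEmbedding_coeffs.continuous_iff, continuous_pi_iff]
  exact ⟨fun h N x => h ⟨N, x⟩, fun h i => h i.1 i.2⟩

instance : T2Space (IwasawaAlgebra p G) := isEmbedding_coeffs.t2Space

variable [IsTopologicalGroup G] [CompactSpace G]

instance (N : OpenSubgroup G) : Finite (G ⧸ (N : Subgroup G)) :=
  Subgroup.quotient_finite_of_isOpen _ N.isOpen

instance : IsTopologicalRing (IwasawaAlgebra p G) where
  continuous_add := continuous_iff.2 fun N x =>
    ((continuous_coeff N x).comp continuous_fst).add ((continuous_coeff N x).comp continuous_snd)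
  continuous_neg := continuous_iff.2 fun N x => (continuous_coeff N x).neg
  continuous_mul := continuous_iff.2 fun N x => by
    classical
    have := Fintype.ofFinite (G ⧸ (N : Subgroup G))
    have h : ∀ a b : IwasawaAlgebra p G, ((a * b).1 N).coeff x = ∑ y, ∑ z,
        if y * z = x then (a.1 N).coeff y * (b.1 N).coeff z else 0 := fun a b =>
      MonoidAlgebra.coeff_mul_fintype _ _ _
    simp only [h]
    refine continuous_finsetSum _ fun y _ => continuous_finsetSum _ fun z _ => ?_
    split_ifs
    · exact ((continuous_coeff N y).comp continuous_fst).mul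
        ((continuous_coeff N z).comp continuous_snd)
    · exact continuous_const

/-- Compatibility of the finite level components is a closed condition on the coefficients. Hence
the Iwasawa algebra of a compact group is compact, being closed in a product of copies of `ℤ_p`. -/
theorem isClosed_range_coeffs : IsClosed (Set.range (coeffs p G)) := by
  classical
  have hfin : ∀ N : OpenSubgroup G, Fintype (G ⧸ (N : Subgroup G)) := fun N => Fintype.ofFinite _
  have h : Set.range (coeffs p G) = {f | ∀ (N N' : OpenSubgroup G) (h : N ≤ N')
      (y : G ⧸ (N' : Subgroup G)), ∑ x with QuotientGroup.map (N : Subgroup G) (N' : Subgroup G)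
        (MonoidHom.id G) h x = y, f ⟨N, x⟩ = f ⟨N', y⟩} := by
    ext f
    constructor
    · rintro ⟨a, rfl⟩ N N' h y
      exact (MonoidAlgebra.coeff_mapDomainRingHom (R := ℤ_[p])
        (QuotientGroup.map (N : Subgroup G) (N' : Subgroup G) (MonoidHom.id G) h)
        (a.1 N) y).symm.trans (congrArg (fun z => z.coeff y) (a.2 N N' h))
    · intro hf
      refine ⟨⟨fun N => .ofCoeff (Finsupp.equivFunOnFinite.symm fun x => f ⟨N, x⟩), ?_⟩, rfl⟩
      intro N N' h
      refine MonoidAlgebra.coeff_injective (Finsupp.ext fun y => ?_)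
      exact (MonoidAlgebra.coeff_mapDomainRingHom _ _ y).trans (hf N N' h y)
  rw [h]
  simp only [Set.ofPred_forall]
  exact isClosed_iInter fun N => isClosed_iInter fun N' => isClosed_iInter fun h =>
    isClosed_iInter fun y => isClosed_eq (continuous_finsetSum _ fun x _ => continuous_apply _)
      (continuous_apply _)

instance : CompactSpace (IwasawaAlgebra p G) :=
  Topology.IsClosedEmbedding.compactSpace (f := coeffs p G)
    ⟨isEmbedding_coeffs, isClosed_range_coeffs⟩

omit [IsTopologicalGroup G] [CompactSpace G] in
/-- The value of a distribution on a coset of `N'` is the sum of its values on the cosets of `N` it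
consists of. -/
theorem coeff_eq_sum (a : IwasawaAlgebra p G) {N N' : OpenSubgroup G} (h : N ≤ N')
    [Fintype (G ⧸ (N : Subgroup G))] [DecidableEq (G ⧸ (N' : Subgroup G))]
    (y : G ⧸ (N' : Subgroup G)) :
    (a.1 N').coeff y = ∑ x with QuotientGroup.map (N : Subgroup G) (N' : Subgroup G)
        (MonoidHom.id G) h x = y, (a.1 N).coeff x := by
  rw [← a.2 N N' h]
  exact MonoidAlgebra.coeff_mapDomainRingHom _ _ y

/-- The neighbourhoods of an element of the Iwasawa algebra are controlled by congruences modulo a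
power of `p` at a single finite level. -/
theorem exists_level_of_mem_nhds {a : IwasawaAlgebra p G} {s : Set (IwasawaAlgebra p G)}
    (hs : s ∈ nhds a) : ∃ (N : OpenSubgroup G) (k : ℕ), ∀ b : IwasawaAlgebra p G,
      ((p ^ k : ℕ) : MonoidAlgebra ℤ_[p] (G ⧸ (N : Subgroup G))) ∣ b.1 N - a.1 N → b ∈ s := by
  classical
  rw [isEmbedding_coeffs.nhds_eq_comap, Filter.mem_comap] at hs
  obtain ⟨t, ht, hts⟩ := hs
  rw [nhds_pi, Filter.mem_pi] at ht
  obtain ⟨I, hI, u, hu, hut⟩ := ht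
  choose k hk using fun i => PadicInt.exists_pow_dvd_subset_of_mem_nhds p (hu i)
  lift I to Finset (Σ N : OpenSubgroup G, G ⧸ (N : Subgroup G)) using hI
  refine ⟨I.inf fun i => i.1, I.sup k, fun b hb => hts (hut fun i hi => hk i _ ?_)⟩
  have hle : I.inf (fun i => i.1) ≤ i.1 := Finset.inf_le hi
  have h1 : ((p ^ I.sup k : ℕ) : MonoidAlgebra ℤ_[p] (G ⧸ (i.1 : Subgroup G))) ∣
      b.1 i.1 - a.1 i.1 := by
    rw [← b.2 _ _ hle, ← a.2 _ _ hle, ← map_sub]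
    have := map_dvd (iwasawaTransition p hle) hb
    rwa [map_natCast] at this
  have h2 := (MonoidAlgebra.natCast_dvd_iff _ _).1 h1 i.2
  refine dvd_trans ?_ h2
  push_cast
  exact pow_dvd_pow _ (Finset.le_sup hi)

/-- An element all of whose finite level components are divisible by all powers of `p` is zero. -/
theorem eq_zero_of_forall_pow_dvd {a : IwasawaAlgebra p G}
    (h : ∀ (N : OpenSubgroup G) (k : ℕ),
      ((p ^ k : ℕ) : MonoidAlgebra ℤ_[p] (G ⧸ (N : Subgroup G))) ∣ a.1 N) : a = 0 :=
  ext fun N x => PadicInt.eq_zero_of_forall_pow_dvd p fun k => by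
    have := (MonoidAlgebra.natCast_dvd_iff _ _).1 (h N k) x
    rwa [Nat.cast_pow] at this

/-! ### Group elements and density -/

omit [IsTopologicalGroup G] [CompactSpace G] in
variable (p) in
/-- The group element `[g]` of the Iwasawa algebra. -/
def of : G →* IwasawaAlgebra p G where
  toFun g := ⟨fun N => MonoidAlgebra.of ℤ_[p] _ (g : G ⧸ (N : Subgroup G)), fun _ _ _ =>
    MonoidAlgebra.mapDomain_single⟩
  map_one' := Subtype.ext (funext fun N => map_one (MonoidAlgebra.of ℤ_[p] (G ⧸ (N : Subgroup G))))
  map_mul' g h := Subtype.ext (funext fun N =>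
    map_mul (MonoidAlgebra.of ℤ_[p] (G ⧸ (N : Subgroup G))) (g : G ⧸ (N : Subgroup G)) h)

omit [IsTopologicalGroup G] [CompactSpace G] in
theorem of_val (g : G) (N : OpenSubgroup G) :
    (of p g).1 N = MonoidAlgebra.single (g : G ⧸ (N : Subgroup G)) 1 := rfl

/-- The projection to level `N`, as a ring homomorphism. -/
def level (N : OpenSubgroup G) :
    IwasawaAlgebra p G →+* MonoidAlgebra ℤ_[p] (G ⧸ (N : Subgroup G)) :=
  (Pi.evalRingHom _ N).comp (iwasawaSubring p G).subtype

/-- Integral combinations of the elements of a dense subset of `G` are dense in the Iwasawa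
algebra. -/
theorem dense_closure_of {D : Set G} (hD : Dense D) :
    Dense (AddSubgroup.closure (of p '' D) : Set (IwasawaAlgebra p G)) := by
  classical
  intro a
  rw [mem_closure_iff_nhds]
  intro s hs
  obtain ⟨N, k, h⟩ := exists_level_of_mem_nhds hs
  have := Fintype.ofFinite (G ⧸ (N : Subgroup G))
  have hrep : ∀ x : G ⧸ (N : Subgroup G), ∃ g ∈ D, (g : G ⧸ (N : Subgroup G)) = x := by
    intro x
    have hx : IsOpen ((QuotientGroup.mk : G → G ⧸ (N : Subgroup G)) ⁻¹' {x}) := by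
      have := QuotientGroup.discreteTopology (N := (N : Subgroup G)) N.isOpen
      exact (isOpen_discrete _).preimage QuotientGroup.continuous_mk
    obtain ⟨g, hg⟩ := QuotientGroup.mk_surjective x
    obtain ⟨g', hg', hg''⟩ := hD.exists_mem_open hx ⟨g, hg⟩
    exact ⟨g', hg', hg''⟩
  choose g hgD hg using hrep
  let n : G ⧸ (N : Subgroup G) → ℕ := fun x => ((a.1 N).coeff x).appr k
  refine ⟨∑ x, n x • of p (g x), h _ ?_, AddSubgroup.sum_mem _ fun x _ =>
    AddSubgroup.nsmul_mem _ (AddSubgroup.subset_closure (Set.mem_image_of_mem _ (hgD x))) _⟩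
  rw [MonoidAlgebra.natCast_dvd_iff]
  intro y
  have h1 : ((∑ x, n x • of p (g x) : IwasawaAlgebra p G).1 N).coeff y = n y := by
    change ((level N (∑ x, n x • of p (g x))).coeff y) = _
    rw [map_sum, MonoidAlgebra.coeff_sum, Finsupp.finsetSum_apply, Finset.sum_eq_single y]
    · rw [map_nsmul]
      change ((n y • (of p (g y)).1 N).coeff y) = _
      rw [of_val, hg, MonoidAlgebra.coeff_smul_apply, MonoidAlgebra.coeff_single,
        Finsupp.single_eq_same]
      simp
    · intro x _ hxy
      rw [map_nsmul]
      change ((n x • (of p (g x)).1 N).coeff y) = _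
      rw [of_val, hg, MonoidAlgebra.coeff_smul_apply, MonoidAlgebra.coeff_single,
        Finsupp.single_eq_of_ne (Ne.symm hxy)]
      simp
    · simp
  have h2 := PadicInt.appr_spec k ((a.1 N).coeff y)
  rw [Ideal.mem_span_singleton, ← dvd_neg, neg_sub] at h2
  rw [MonoidAlgebra.coeff_sub, Finsupp.sub_apply, h1]
  exact_mod_cast h2

/-- The density principle: an additive closed condition that holds for the group elements `[g]`,
`g` in a dense subset, holds on the whole Iwasawa algebra. -/
theorem eq_top_of_isClosed {D : Set G} (hD : Dense D) {S : AddSubgroup (IwasawaAlgebra p G)}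
    (hS : IsClosed (S : Set (IwasawaAlgebra p G))) (h : ∀ g ∈ D, of p g ∈ S) : S = ⊤ := by
  refine SetLike.coe_injective (Set.univ_subset_iff.1 ?_)
  rw [← (dense_closure_of (p := p) hD).closure_eq]
  refine hS.closure_subset_iff.2 ?_
  rw [SetLike.coe_subset_coe, AddSubgroup.closure_le]
  rintro _ ⟨g, hg, rfl⟩
  exact h g hg

/-! ### Functoriality -/

variable {G' : Type*} [CommGroup G'] [TopologicalSpace G']
variable {G'' : Type*} [CommGroup G''] [TopologicalSpace G'']

omit [IsTopologicalGroup G] [CompactSpace G] in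
theorem iwasawaMap_val (f : G →* G') (hf : Continuous f) (a : IwasawaAlgebra p G)
    (N' : OpenSubgroup G') : (iwasawaMap p f hf a).1 N' = MonoidAlgebra.mapDomainRingHom ℤ_[p]
      (QuotientGroup.map ((N'.comap f hf : OpenSubgroup G) : Subgroup G)
        (N' : Subgroup G') f le_rfl) (a.1 (N'.comap f hf)) := rfl

omit [IsTopologicalGroup G] [CompactSpace G] in
theorem iwasawaMap_of (f : G →* G') (hf : Continuous f) (g : G) :
    iwasawaMap p f hf (of p g) = of p (f g) := by
  refine Subtype.ext (funext fun N' => ?_)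
  rw [iwasawaMap_val, of_val, of_val]
  exact MonoidAlgebra.mapDomain_single

omit [IsTopologicalGroup G] [CompactSpace G] in
theorem iwasawaMap_comp (f : G →* G') (hf : Continuous f) (g : G' →* G'') (hg : Continuous g) :
    iwasawaMap p (g.comp f) (hg.comp hf) = (iwasawaMap p g hg).comp (iwasawaMap p f hf) := by
  refine RingHom.ext fun a => Subtype.ext (funext fun N => ?_)
  rw [RingHom.comp_apply, iwasawaMap_val, iwasawaMap_val, iwasawaMap_val, ← RingHom.comp_apply,
    ← MonoidAlgebra.mapDomainRingHom_comp]
  congr 2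
  ext x
  rfl

omit [IsTopologicalGroup G] [CompactSpace G] in
theorem iwasawaMap_id : iwasawaMap p (MonoidHom.id G) continuous_id = RingHom.id _ := by
  refine RingHom.ext fun a => Subtype.ext (funext fun N => ?_)
  rw [iwasawaMap_val]
  exact a.2 _ _ le_rfl

omit [IsTopologicalGroup G] [CompactSpace G] in
theorem iwasawaMap_congr {f f' : G →* G'} (h : f = f') (hf : Continuous f) (hf' : Continuous f') :
    iwasawaMap p f hf = iwasawaMap p f' hf' := by
  subst h; rfl

theorem continuous_iwasawaMap (f : G →* G') (hf : Continuous f) :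
    Continuous (iwasawaMap p f hf) := by
  classical
  refine continuous_iff.2 fun N y => ?_
  have := Fintype.ofFinite (G ⧸ ((N.comap f hf : OpenSubgroup G) : Subgroup G))
  simp only [iwasawaMap_val, MonoidAlgebra.coeff_mapDomainRingHom]
  exact continuous_finsetSum _ fun x _ => continuous_coeff _ _

omit [IsTopologicalGroup G] [CompactSpace G] in
variable (p) in
/-- The isomorphism of Iwasawa algebras induced by an isomorphism of topological groups. -/
def congr (e : G ≃ₜ* G') : IwasawaAlgebra p G ≃+* IwasawaAlgebra p G' :=
  have he : Continuous (e : G →* G') := e.continuous_toFun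
  have he' : Continuous (e.symm : G' →* G) := e.symm.continuous_toFun
  RingEquiv.ofRingHom (iwasawaMap p (e : G →* G') he) (iwasawaMap p (e.symm : G' →* G) he')
    (by
      rw [← iwasawaMap_comp, ← iwasawaMap_id]
      exact iwasawaMap_congr (MonoidHom.ext fun x => e.apply_symm_apply x) _ _)
    (by
      rw [← iwasawaMap_comp, ← iwasawaMap_id]
      exact iwasawaMap_congr (MonoidHom.ext fun x => e.symm_apply_apply x) _ _)

/-- A surjective continuous homomorphism of compact groups presents the Iwasawa algebra of the
target as a topological quotient. -/
theorem isOpenQuotientMap_iwasawaMap [IsTopologicalGroup G'] [CompactSpace G'] (f : G →* G')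
    (hf : Continuous f) (hsurj : Function.Surjective f) :
    IsOpenQuotientMap (iwasawaMap p f hf) := by
  have hcont := continuous_iwasawaMap (p := p) f hf
  have hclosed := hcont.isClosedMap
  have htop : (iwasawaMap p f hf).toAddMonoidHom.range = ⊤ := by
    refine eq_top_of_isClosed (D := Set.univ) dense_univ hclosed.isClosed_range ?_
    intro g' _
    obtain ⟨g, rfl⟩ := hsurj g'
    exact ⟨of p g, iwasawaMap_of f hf g⟩
  have hs : Function.Surjective (iwasawaMap p f hf) := AddMonoidHom.range_eq_top.1 htop
  exact AddMonoidHom.isOpenQuotientMap_of_isQuotientMap (hclosed.isQuotientMap hcont hs)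

end IwasawaAlgebra

end IwasawaTopology

/-! ### Open subgroups of finite index -/

section IwasawaFree

variable {p : ℕ} [Fact p.Prime]
variable {G : Type*} [CommGroup G] [TopologicalSpace G]
variable {G' : Type*} [CommGroup G'] [TopologicalSpace G']

namespace IwasawaAlgebra

/-- The image of an open subgroup under an open homomorphism. -/
def mapOpen (f : G →* G') (hopen : IsOpenMap f) (N : OpenSubgroup G) : OpenSubgroup G' :=
  ⟨(N : Subgroup G).map f, hopen _ N.isOpen⟩

theorem mapOpen_mono (f : G →* G') (hopen : IsOpenMap f) {N M : OpenSubgroup G} (h : N ≤ M) :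
    mapOpen f hopen N ≤ mapOpen f hopen M := Subgroup.map_mono (f := f) h

/-- The embedding `G/N → G'/f(N)`, `x ↦ s f(x)`. -/
def cosetEmb (f : G →* G') (hopen : IsOpenMap f) (s : G') (N : OpenSubgroup G)
    (x : G ⧸ (N : Subgroup G)) : G' ⧸ (mapOpen f hopen N : Subgroup G') :=
  (s : G' ⧸ (mapOpen f hopen N : Subgroup G')) *
    QuotientGroup.map (N : Subgroup G) (mapOpen f hopen N : Subgroup G') f
      (Subgroup.le_comap_map _ _) x

theorem cosetEmb_mk (f : G →* G') (hopen : IsOpenMap f) (s : G') (N : OpenSubgroup G) (g : G) :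
    cosetEmb f hopen s N (g : G ⧸ (N : Subgroup G)) =
      ((s * f g : G') : G' ⧸ (mapOpen f hopen N : Subgroup G')) := rfl

theorem cosetEmb_injective (f : G →* G') (hinj : Function.Injective f) (hopen : IsOpenMap f)
    (s : G') (N : OpenSubgroup G) : Function.Injective (cosetEmb f hopen s N) := by
  intro x y
  induction x using QuotientGroup.induction_on
  induction y using QuotientGroup.induction_on
  rename_i a b
  rw [cosetEmb_mk, cosetEmb_mk, QuotientGroup.eq, QuotientGroup.eq]
  rintro ⟨n, hn, h⟩
  rw [mul_inv_rev, mul_assoc, inv_mul_cancel_left, ← map_inv, ← map_mul] at h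
  rwa [← hinj h]

section coord

variable [IsTopologicalGroup G] [CompactSpace G]

/-- The part of an element of the Iwasawa algebra of `G'` supported on the coset `s f(G)` of the
open subgroup `f(G)`, translated back to `G`. -/
def coord (f : G →* G') (hinj : Function.Injective f) (hopen : IsOpenMap f) (s : G') :
    IwasawaAlgebra p G' →+ IwasawaAlgebra p G where
  toFun a := ⟨fun N => .ofCoeff (Finsupp.equivFunOnFinite.symm fun x =>
      (a.1 (mapOpen f hopen N)).coeff (cosetEmb f hopen s N x)), by
    classical
    intro N M h
    have := Fintype.ofFinite (G ⧸ (N : Subgroup G))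
    refine MonoidAlgebra.coeff_injective (Finsupp.ext fun y => ?_)
    refine (MonoidAlgebra.coeff_mapDomainRingHom _ _ y).trans ?_
    change ∑ x with _, (a.1 (mapOpen f hopen N)).coeff (cosetEmb f hopen s N x) =
      (a.1 (mapOpen f hopen M)).coeff (cosetEmb f hopen s M y)
    rw [← a.2 _ _ (mapOpen_mono f hopen h), iwasawaTransition,
      MonoidAlgebra.mapDomainRingHom_apply]
    change _ = (Finsupp.mapDomain _ (a.1 (mapOpen f hopen N)).coeff) _
    rw [Finsupp.mapDomain, Finsupp.sum, Finsupp.finsetSum_apply]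
    simp only [Finsupp.single_apply]
    rw [← Finset.sum_filter, ← Finset.sum_filter_ne_zero]
    refine Finset.sum_bij (fun x _ => cosetEmb f hopen s N x) ?_ ?_ ?_ ?_
    · intro x hx
      rw [Finset.mem_filter, Finset.mem_filter] at hx
      rw [Finset.mem_filter, Finsupp.mem_support_iff]
      refine ⟨hx.2, ?_⟩
      have hx1 := hx.1.2
      rw [← hx1]
      induction x using QuotientGroup.induction_on
      rfl
    · intro x _ x' _ hxx
      exact cosetEmb_injective f hinj hopen s N hxx
    · intro z hz
      rw [Finset.mem_filter, Finsupp.mem_support_iff] at hz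
      obtain ⟨hz0, hz⟩ := hz
      induction z using QuotientGroup.induction_on
      induction y using QuotientGroup.induction_on
      rename_i z y
      rw [cosetEmb_mk] at hz
      obtain ⟨m, hm, hmz⟩ := QuotientGroup.eq.1 hz.symm
      refine ⟨((y * m : G) : G ⧸ (N : Subgroup G)), ?_, ?_⟩
      · rw [Finset.mem_filter, Finset.mem_filter]
        have h1 : cosetEmb f hopen s N ((y * m : G) : G ⧸ (N : Subgroup G)) = z := by
          rw [cosetEmb_mk, map_mul, hmz]
          congr 1
          simp [mul_assoc]
        refine ⟨⟨Finset.mem_univ _, ?_⟩, ?_⟩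
        · exact QuotientGroup.mk_mul_of_mem y hm
        · rw [h1]; exact hz0
      · rw [cosetEmb_mk, map_mul, hmz]
        congr 1
        simp [mul_assoc]
    · intro x hx
      rfl⟩
  map_zero' := ext fun N x => rfl
  map_add' a b := ext fun N x => rfl

theorem coord_coeff (f : G →* G') (hinj : Function.Injective f) (hopen : IsOpenMap f) (s : G')
    (a : IwasawaAlgebra p G') (N : OpenSubgroup G) (x : G ⧸ (N : Subgroup G)) :
    ((coord f hinj hopen s a).1 N).coeff x =
      (a.1 (mapOpen f hopen N)).coeff (cosetEmb f hopen s N x) := rfl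

theorem continuous_coord (f : G →* G') (hinj : Function.Injective f) (hopen : IsOpenMap f)
    (s : G') : Continuous (coord (p := p) f hinj hopen s) :=
  continuous_iff.2 fun _ _ => continuous_coeff _ _

theorem coord_of_mul (f : G →* G') (hinj : Function.Injective f) (hopen : IsOpenMap f) (s : G')
    (g : G) : coord (p := p) f hinj hopen s (of p (s * f g)) = of p g := by
  classical
  refine ext fun N x => ?_
  rw [coord_coeff, of_val, of_val, ← cosetEmb_mk, MonoidAlgebra.coeff_single,
    MonoidAlgebra.coeff_single, Finsupp.single_apply, Finsupp.single_apply]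
  exact if_congr (cosetEmb_injective f hinj hopen s N).eq_iff rfl rfl

theorem coord_of_eq_zero (f : G →* G') (hinj : Function.Injective f) (hopen : IsOpenMap f) (s : G')
    (g' : G') (h : s⁻¹ * g' ∉ f.range) : coord (p := p) f hinj hopen s (of p g') = 0 := by
  classical
  refine ext fun N x => ?_
  rw [coord_coeff, of_val, MonoidAlgebra.coeff_single, Finsupp.single_apply, if_neg]
  · rfl
  · intro hx
    induction x using QuotientGroup.induction_on
    rename_i g
    rw [cosetEmb_mk] at hx
    obtain ⟨n, _, hn⟩ := QuotientGroup.eq.1 hx.symm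
    refine h ⟨g * n, ?_⟩
    rw [map_mul, hn]
    simp [mul_assoc]

end coord

variable [IsTopologicalGroup G] [CompactSpace G] [IsTopologicalGroup G'] [CompactSpace G']

/-- The coordinates of the combination `∑ cᵢ [sᵢ]` over coset representatives `sᵢ` are the `cᵢ`. -/
theorem coord_map_mul_of (f : G →* G') (hf : Continuous f) (hinj : Function.Injective f)
    (hopen : IsOpenMap f) (i j : G' ⧸ f.range) [Decidable (i = j)] (c : IwasawaAlgebra p G) :
    coord f hinj hopen i.out (iwasawaMap p f hf c * of p j.out) = if i = j then c else 0 := by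
  let S : AddSubgroup (IwasawaAlgebra p G) :=
    { carrier := {c | coord f hinj hopen i.out (iwasawaMap p f hf c * of p j.out) =
        if i = j then c else 0}
      zero_mem' := by simp
      add_mem' := by
        intro a b ha hb
        simp only [Set.mem_ofPred_eq] at ha hb ⊢
        rw [map_add, add_mul, map_add, ha, hb]
        split_ifs <;> simp
      neg_mem' := by
        intro a ha
        simp only [Set.mem_ofPred_eq] at ha ⊢
        rw [map_neg, neg_mul, map_neg, ha]
        split_ifs <;> simp }
  suffices S = ⊤ from (this ▸ AddSubgroup.mem_top c : c ∈ S)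
  refine eq_top_of_isClosed (D := Set.univ) dense_univ ?_ ?_
  · refine isClosed_eq ?_ ?_
    · exact (continuous_coord f hinj hopen _).comp
        ((continuous_iwasawaMap f hf).mul continuous_const)
    · split_ifs
      · exact continuous_id
      · exact continuous_const
  · intro g _
    change coord f hinj hopen i.out (iwasawaMap p f hf (of p g) * of p j.out) = _
    rw [iwasawaMap_of, ← map_mul]
    split_ifs with hij
    · rw [hij, mul_comm, coord_of_mul]
    · refine coord_of_eq_zero _ _ _ _ _ fun h => hij ?_
      rw [← QuotientGroup.out_eq' i, ← QuotientGroup.out_eq' j, QuotientGroup.eq]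
      have h2 : i.out⁻¹ * j.out = (i.out⁻¹ * (f g * j.out)) * f g⁻¹ := by
        rw [map_inv]; simp [mul_assoc, mul_comm]
      rw [h2]
      exact mul_mem h ⟨_, rfl⟩

/-- An element of the Iwasawa algebra of `G'` is the combination of coset representatives with its
coordinates as coefficients. -/
theorem sum_map_coord_mul_of (f : G →* G') (hf : Continuous f) (hinj : Function.Injective f)
    (hopen : IsOpenMap f) [Fintype (G' ⧸ f.range)] (a : IwasawaAlgebra p G') :
    ∑ i : G' ⧸ f.range, iwasawaMap p f hf (coord f hinj hopen i.out a) * of p i.out = a := by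
  let S : AddSubgroup (IwasawaAlgebra p G') :=
    { carrier := {a | ∑ i : G' ⧸ f.range,
        iwasawaMap p f hf (coord f hinj hopen i.out a) * of p i.out = a}
      zero_mem' := by simp
      add_mem' := by
        intro a b ha hb
        simp only [Set.mem_ofPred_eq] at ha hb ⊢
        simp only [map_add, add_mul, Finset.sum_add_distrib, ha, hb]
      neg_mem' := by
        intro a ha
        simp only [Set.mem_ofPred_eq] at ha ⊢
        simp only [map_neg, neg_mul, Finset.sum_neg_distrib, ha] }
  suffices S = ⊤ from (this ▸ AddSubgroup.mem_top a : a ∈ S)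
  refine eq_top_of_isClosed (D := Set.univ) dense_univ ?_ ?_
  · refine isClosed_eq (continuous_finsetSum _ fun i _ => ?_) continuous_id
    exact ((continuous_iwasawaMap f hf).comp (continuous_coord f hinj hopen _)).mul continuous_const
  · intro g _
    change ∑ i : G' ⧸ f.range, _ = _
    rw [Finset.sum_eq_single (g : G' ⧸ f.range)]
    · obtain ⟨x, hx⟩ := QuotientGroup.eq.1 (QuotientGroup.out_eq' (g : G' ⧸ f.range))
      have hg : g = (g : G' ⧸ f.range).out * f x := by rw [hx]; simp
      generalize (g : G' ⧸ f.range).out = s at hg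
      subst hg
      rw [coord_of_mul, iwasawaMap_of, ← map_mul, mul_comm]
    · intro i _ hi
      rw [coord_of_eq_zero, map_zero, zero_mul]
      intro h
      exact hi ((QuotientGroup.out_eq' i).symm.trans (QuotientGroup.eq.2 h))
    · simp

/-- For an open subgroup of finite index, the Iwasawa algebra of the group is free over that of
the subgroup on a system of coset representatives. -/
def basis (f : G →* G') (hf : Continuous f) (hinj : Function.Injective f)
    (hopen : IsOpenMap f) [Finite (G' ⧸ f.range)] :
    letI := (iwasawaMap p f hf).toAlgebra
    Module.Basis (G' ⧸ f.range) (IwasawaAlgebra p G) (IwasawaAlgebra p G') :=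
  letI := (iwasawaMap p f hf).toAlgebra
  haveI := Fintype.ofFinite (G' ⧸ f.range)
  haveI := Classical.decEq (G' ⧸ f.range)
  Module.Basis.ofEquivFun
    { toFun := fun a i => coord f hinj hopen i.out a
      invFun := fun c => ∑ i, iwasawaMap p f hf (c i) * of p i.out
      left_inv := fun a => sum_map_coord_mul_of f hf hinj hopen a
      right_inv := fun c => funext fun i => by
        simp [map_sum, coord_map_mul_of]
      map_add' := fun a b => funext fun i => map_add _ _ _
      map_smul' := fun r a => funext fun i => by
        conv_lhs => rw [← sum_map_coord_mul_of f hf hinj hopen a]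
        rw [RingHom.id_apply, Pi.smul_apply, Algebra.smul_def, RingHom.algebraMap_toAlgebra,
          Finset.mul_sum, map_sum]
        simp only [← mul_assoc, ← map_mul, coord_map_mul_of]
        simp }

theorem finite_iwasawaMap (f : G →* G') (hf : Continuous f) (hinj : Function.Injective f)
    (hopen : IsOpenMap f) [Finite (G' ⧸ f.range)] : (iwasawaMap p f hf).Finite :=
  letI := (iwasawaMap p f hf).toAlgebra
  Module.Finite.of_basis (basis f hf hinj hopen)

theorem flat_iwasawaMap (f : G →* G') (hf : Continuous f) (hinj : Function.Injective f)
    (hopen : IsOpenMap f) [Finite (G' ⧸ f.range)] : (iwasawaMap p f hf).Flat :=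
  letI := (iwasawaMap p f hf).toAlgebra
  haveI := Module.Free.of_basis (basis (p := p) f hf hinj hopen)
  Module.Flat.of_free (R := IwasawaAlgebra p G) (M := IwasawaAlgebra p G')

theorem injective_iwasawaMap (f : G →* G') (hf : Continuous f) (hinj : Function.Injective f)
    (hopen : IsOpenMap f) : Function.Injective (iwasawaMap p f hf) := by
  classical
  rw [injective_iff_map_eq_zero]
  intro c hc
  have h := coord_map_mul_of (p := p) f hf hinj hopen 1 1 c
  rwa [hc, zero_mul, map_zero, if_pos rfl, eq_comm] at h

/-- Open ideals extend to open ideals along an open subgroup of finite index. -/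
theorem isOpen_map_ideal (f : G →* G') (hf : Continuous f) (hinj : Function.Injective f)
    (hopen : IsOpenMap f) [Finite (G' ⧸ f.range)] (J : Ideal (IwasawaAlgebra p G))
    (hJ : IsOpen (J : Set (IwasawaAlgebra p G))) :
    IsOpen ((J.map (iwasawaMap p f hf) : Ideal (IwasawaAlgebra p G')) :
      Set (IwasawaAlgebra p G')) := by
  have := Fintype.ofFinite (G' ⧸ f.range)
  have h : IsOpen {a : IwasawaAlgebra p G' | ∀ i : G' ⧸ f.range,
      coord f hinj hopen i.out a ∈ J} := by
    simp only [Set.ofPred_forall]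
    exact isOpen_iInter_of_finite fun i => hJ.preimage (continuous_coord f hinj hopen _)
  refine AddSubgroup.isOpen_of_mem_nhds (J.map (iwasawaMap p f hf)).toAddSubgroup (g := 0) ?_
  refine Filter.mem_of_superset (h.mem_nhds fun i => by simp) fun a ha => ?_
  change a ∈ J.map (iwasawaMap p f hf)
  rw [← sum_map_coord_mul_of f hf hinj hopen a]
  exact Ideal.sum_mem _ fun i _ => Ideal.mul_mem_right _ _ (Ideal.mem_map_of_mem _ (ha i))

end IwasawaAlgebra

end IwasawaFree

/-! ### Power series expansions -/

section PowerSeriesExpansion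

/-- Let `A → B` be a split surjection of commutative rings with kernel generated by a
non-zero-divisor `t`. If `A` is separated and complete for the `t`-adic topology, then `A` is the
power series ring over `B` in the variable `t`: the coefficients of `a` are obtained by iterating
the division `a = s (π a) + t a'`. -/
theorem nonempty_ringEquiv_powerSeries {A B : Type*} [CommRing A] [CommRing B] (π : A →+* B)
    (s : B →+* A) (hπs : ∀ b, π (s b) = b) (t : A) (hπt : π t = 0) (ht : ∀ a, t * a = 0 → a = 0)
    (hker : ∀ a, t ∣ a - s (π a)) (hsep : ∀ a, (∀ n, t ^ n ∣ a) → a = 0)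
    (hcomplete : ∀ b : ℕ → A, ∃ a, ∀ n, t ^ n ∣ a - ∑ k ∈ Finset.range n, b k * t ^ k) :
    Nonempty (A ≃+* PowerSeries B) := by
  -- `D` is division by `t` of the part without constant term: `a = s (π a) + t * D a`.
  choose D hD using hker
  have hcancel : ∀ a b, t * a = t * b → a = b := fun a b h => by
    rw [← sub_eq_zero]; exact ht _ (by rw [mul_sub, h, sub_self])
  have hDadd : ∀ a b, D (a + b) = D a + D b := fun a b => hcancel _ _ (by
    rw [mul_add, ← hD, ← hD, ← hD, map_add, map_add]; ring)
  have hDs : ∀ x a, D (s x * a) = s x * D a := fun x a => hcancel _ _ (by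
    rw [mul_left_comm, ← hD, ← hD, map_mul, map_mul, hπs]; ring)
  have hDt : ∀ a, D (t * a) = a := fun a => hcancel _ _ (by
    rw [← hD, map_mul, hπt, zero_mul, map_zero, sub_zero])
  have hDD : ∀ a, s (π a) + t * D a = a := fun a => by rw [← hD]; ring
  have hD0 : D 0 = 0 := by simpa using hDadd 0 0
  -- `ψ a` is the expansion of `a` in powers of `t`.
  let ψ : A → PowerSeries B := fun a => PowerSeries.mk fun k => π (D^[k] a)
  have hψcoeff : ∀ a k, PowerSeries.coeff k (ψ a) = π (D^[k] a) := fun a k =>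
    PowerSeries.coeff_mk _ _
  have hψ : ∀ a, ψ a = PowerSeries.C (π a) + PowerSeries.X * ψ (D a) := by
    intro a
    ext k
    cases k with
    | zero => simp [hψcoeff]
    | succ k =>
      rw [map_add, PowerSeries.coeff_succ_X_mul, hψcoeff, hψcoeff, Function.iterate_succ_apply,
        PowerSeries.coeff_C, if_neg (Nat.succ_ne_zero k), zero_add]
  have hiter_add : ∀ k a b, D^[k] (a + b) = D^[k] a + D^[k] b := by
    intro k
    induction k with
    | zero => intro a b; rfl
    | succ k ih =>
      intro a b
      rw [Function.iterate_succ_apply, Function.iterate_succ_apply, Function.iterate_succ_apply,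
        hDadd, ih]
  have hiter_s : ∀ k x a, D^[k] (s x * a) = s x * D^[k] a := by
    intro k
    induction k with
    | zero => intro x a; rfl
    | succ k ih =>
      intro x a
      rw [Function.iterate_succ_apply, Function.iterate_succ_apply, hDs, ih]
  have hψadd : ∀ a b, ψ (a + b) = ψ a + ψ b := by
    intro a b
    ext k
    rw [map_add, hψcoeff, hψcoeff, hψcoeff, hiter_add, map_add]
  have hψs : ∀ x a, ψ (s x * a) = PowerSeries.C x * ψ a := by
    intro x a
    ext k
    rw [PowerSeries.coeff_C_mul, hψcoeff, hψcoeff, hiter_s, map_mul, hπs]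
  have hψt : ∀ a, ψ (t * a) = PowerSeries.X * ψ a := by
    intro a
    rw [hψ (t * a), hDt, map_mul, hπt, zero_mul, map_zero, zero_add]
  have hψmul : ∀ a b, ψ (a * b) = ψ a * ψ b := by
    -- Replacing `a` by `D a` divides the defect of multiplicativity by `X`.
    have key : ∀ n a b, (PowerSeries.X : PowerSeries B) ^ n ∣ ψ (a * b) - ψ a * ψ b := by
      intro n
      induction n with
      | zero => intro a b; simp
      | succ n ih =>
        intro a b
        have h1 : a * b = s (π a) * b + t * (D a * b) := by
          conv_lhs => rw [← hDD a]
          ring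
        have h2 : ψ (a * b) - ψ a * ψ b = PowerSeries.X * (ψ (D a * b) - ψ (D a) * ψ b) := by
          rw [h1, hψadd, hψs, hψt, hψ a]; ring
        rw [h2, pow_succ']
        exact mul_dvd_mul_left _ (ih _ _)
    intro a b
    rw [← sub_eq_zero]
    ext k
    exact PowerSeries.X_pow_dvd_iff.1 (key (k + 1) a b) k (Nat.lt_succ_self k)
  have hdvd : ∀ n a, t ^ n ∣ a ↔ (PowerSeries.X : PowerSeries B) ^ n ∣ ψ a := by
    intro n
    induction n with
    | zero => intro a; simp
    | succ n ih =>
      intro a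
      constructor
      · rintro ⟨c, rfl⟩
        rw [pow_succ' t, mul_assoc, hψt, pow_succ']
        exact mul_dvd_mul_left _ ((ih _).1 (dvd_mul_right _ _))
      · intro h
        have h0 : π a = 0 := by
          have := PowerSeries.X_pow_dvd_iff.1 h 0 (Nat.succ_pos n)
          rwa [hψcoeff] at this
        have ha : a = t * D a := by
          conv_lhs => rw [← hDD a, h0, map_zero, zero_add]
        rw [ha, pow_succ']
        refine mul_dvd_mul_left _ ((ih _).2 ?_)
        rw [PowerSeries.X_pow_dvd_iff] at h ⊢
        intro m hm
        have := h (m + 1) (Nat.succ_lt_succ hm)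
        rw [hψcoeff] at this ⊢
        rwa [Function.iterate_succ_apply] at this
  have hψ1 : ψ 1 = 1 := by
    have h1 : (1 : A) = s 1 * 1 := by simp
    have hD1 : D 1 = 0 := hcancel _ _ (by rw [← hD]; simp)
    rw [hψ, hD1, map_one]
    have : ψ 0 = 0 := by simpa using hψadd 0 0
    rw [this]; simp
  let Ψ : A →+* PowerSeries B :=
    RingHom.mk' ⟨⟨ψ, hψ1⟩, hψmul⟩ hψadd
  refine ⟨RingEquiv.ofBijective Ψ ⟨?_, ?_⟩⟩
  · rw [injective_iff_map_eq_zero]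
    intro a ha
    refine hsep a fun n => (hdvd n a).2 ?_
    rw [show ψ a = 0 from ha]
    exact dvd_zero _
  · intro f
    obtain ⟨a, ha⟩ := hcomplete fun k => s (PowerSeries.coeff k f)
    refine ⟨a, ?_⟩
    change ψ a = f
    have hpart : ∀ n, ψ (∑ k ∈ Finset.range n, s (PowerSeries.coeff k f) * t ^ k) =
        ∑ k ∈ Finset.range n, PowerSeries.C (PowerSeries.coeff k f) * PowerSeries.X ^ k := by
      intro n
      change Ψ _ = _
      rw [map_sum]
      refine Finset.sum_congr rfl fun k _ => ?_
      have ht1 : Ψ t = PowerSeries.X := by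
        have := hψt 1
        rwa [mul_one, hψ1, mul_one] at this
      have hs1 : ∀ x, Ψ (s x) = PowerSeries.C x := fun x => by
        have := hψs x 1
        rwa [mul_one, hψ1, mul_one] at this
      rw [map_mul, map_pow, ht1, hs1]
    ext k
    have h := (hdvd _ _).1 (ha (k + 1))
    have h2 : ψ (a - ∑ j ∈ Finset.range (k + 1), s (PowerSeries.coeff j f) * t ^ j) =
        ψ a - ψ (∑ j ∈ Finset.range (k + 1), s (PowerSeries.coeff j f) * t ^ j) :=
      map_sub Ψ _ _
    rw [h2, hpart] at h
    have := PowerSeries.X_pow_dvd_iff.1 h k (Nat.lt_succ_self k)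
    rw [map_sub, sub_eq_zero] at this
    rw [this, map_sum]
    simp [PowerSeries.coeff_C_mul, PowerSeries.coeff_X_pow]

/-- In a compact Hausdorff topological ring every power series in `t` has a sum for the `t`-adic
topology. -/
theorem exists_forall_pow_dvd_sub_sum {A : Type*} [CommRing A] [TopologicalSpace A]
    [IsTopologicalRing A] [CompactSpace A] [T2Space A] (t : A) (b : ℕ → A) :
    ∃ a, ∀ n, t ^ n ∣ a - ∑ k ∈ Finset.range n, b k * t ^ k := by
  let C : ℕ → Set A := fun n =>
    (fun a => a - ∑ k ∈ Finset.range n, b k * t ^ k) ⁻¹' (Set.range fun c => t ^ n * c)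
  have hC : ∀ n, IsClosed (C n) := fun n =>
    (isCompact_range (continuous_const_mul (t ^ n))).isClosed.preimage
      (continuous_id.sub continuous_const)
  have hanti : ∀ n, C (n + 1) ⊆ C n := by
    rintro n a ⟨c, hc⟩
    refine ⟨b n + t * c, ?_⟩
    simp only [Finset.sum_range_succ, pow_succ] at hc ⊢
    linear_combination hc
  have hne : ∀ n, (C n).Nonempty := fun n =>
    ⟨∑ k ∈ Finset.range n, b k * t ^ k, 0, by simp⟩
  obtain ⟨a, ha⟩ := IsCompact.nonempty_iInter_of_sequence_nonempty_isCompact_isClosed C hanti hne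
    (hC 0).isCompact hC
  refine ⟨a, fun n => ?_⟩
  obtain ⟨c, hc⟩ := Set.mem_iInter.1 ha n
  exact ⟨c, hc.symm⟩

end PowerSeriesExpansion

/-! ### Iwasawa algebras as power series rings -/

section IwasawaPowerSeries

variable {p : ℕ} [Fact p.Prime]

variable (p) in
/-- The open subgroup `p^j ℤ_p` of `ℤ_p`. -/
def padicPowSubgroup (j : ℕ) : OpenSubgroup (Multiplicative ℤ_[p]) where
  carrier := {x | (p : ℤ_[p]) ^ j ∣ x.toAdd}
  mul_mem' ha hb := dvd_add ha hb
  one_mem' := dvd_zero _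
  inv_mem' ha := (dvd_neg (α := ℤ_[p])).2 ha
  isOpen' := by
    have h : IsOpen {x : ℤ_[p] | (p : ℤ_[p]) ^ j ∣ x} := by
      have : {x : ℤ_[p] | (p : ℤ_[p]) ^ j ∣ x} =
          (((Ideal.span {(p : ℤ_[p]) ^ j}).toAddSubgroup : AddSubgroup ℤ_[p]) : Set ℤ_[p]) := by
        ext x; exact Ideal.mem_span_singleton.symm
      rw [this]
      refine AddSubgroup.isOpen_of_mem_nhds _ (g := 0) ?_
      have hpos : (0 : ℝ) < (p : ℝ) ^ (-(j : ℤ)) :=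
        zpow_pos (by exact_mod_cast (Fact.out : p.Prime).pos) _
      refine Filter.mem_of_superset (Metric.closedBall_mem_nhds 0 hpos) fun x hx => ?_
      rw [mem_closedBall_zero_iff, PadicInt.norm_le_pow_iff_mem_span_pow] at hx
      exact hx
    exact h

theorem mem_padicPowSubgroup {j : ℕ} {x : Multiplicative ℤ_[p]} :
    x ∈ padicPowSubgroup p j ↔ (p : ℤ_[p]) ^ j ∣ x.toAdd := Iff.rfl

namespace IwasawaAlgebra

variable {G : Type*} [CommGroup G] [TopologicalSpace G]

/-- The topological generator of the second factor of `G × ℤ_p`. -/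
def genSnd (p : ℕ) [Fact p.Prime] (G : Type*) [CommGroup G] : G × Multiplicative ℤ_[p] :=
  (1, Multiplicative.ofAdd 1)

omit [TopologicalSpace G] in
theorem genSnd_pow (n : ℕ) : genSnd p G ^ n = (1, Multiplicative.ofAdd (n : ℤ_[p])) := by
  rw [genSnd, Prod.pow_mk, one_pow, ← ofAdd_nsmul, nsmul_one]

theorem exists_level_snd (N : OpenSubgroup (G × Multiplicative ℤ_[p])) :
    ∃ j, ∀ x : Multiplicative ℤ_[p], x ∈ padicPowSubgroup p j → ((1 : G), x) ∈ N := by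
  have h : {x : ℤ_[p] | ((1 : G), Multiplicative.ofAdd x) ∈ N} ∈ nhds (0 : ℤ_[p]) := by
    refine IsOpen.mem_nhds (N.isOpen.preimage (f := fun x : ℤ_[p] =>
      ((1 : G), Multiplicative.ofAdd x)) (by fun_prop)) ?_
    exact one_mem N
  obtain ⟨j, hj⟩ := PadicInt.exists_pow_dvd_subset_of_mem_nhds p h
  exact ⟨j, fun x hx => hj x.toAdd (by rwa [sub_zero])⟩

variable [IsTopologicalGroup G] [CompactSpace G]

instance : CompactSpace (Multiplicative ℤ_[p]) := inferInstanceAs (CompactSpace ℤ_[p])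

omit [IsTopologicalGroup G] [CompactSpace G] in
theorem coeff_of_mul (g : G) (a : IwasawaAlgebra p G) (N : OpenSubgroup G)
    (x : G ⧸ (N : Subgroup G)) : ((of p g * a).1 N).coeff (g * x) = (a.1 N).coeff x := by
  change ((of p g).1 N * a.1 N).coeff (g * x) = _
  rw [of_val, MonoidAlgebra.coeff_single_mul_eq_mul_coeff x, one_mul]
  intro y _
  exact mul_right_inj _

/-- The element `[γ] - 1`, with `γ` the topological generator of the second factor of `G × ℤ_p`. -/
def genVar (p : ℕ) [Fact p.Prime] (G : Type*) [CommGroup G] [TopologicalSpace G] :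
    IwasawaAlgebra p (G × Multiplicative ℤ_[p]) := of p (genSnd p G) - 1

omit [IsTopologicalGroup G] [CompactSpace G] in
theorem prod_padicPowSubgroup_le (V : OpenSubgroup G) (j : ℕ) :
    V.prod (padicPowSubgroup p j) ≤ V.prod (padicPowSubgroup p 0) := fun x hx =>
  ⟨hx.1, mem_padicPowSubgroup.2 (by simp)⟩

omit [IsTopologicalGroup G] [CompactSpace G] in
theorem mk_prod_eq_mk_appr (V : OpenSubgroup G) (j : ℕ) (g : G) (x : Multiplicative ℤ_[p]) :
    ((g, x) : (G × Multiplicative ℤ_[p]) ⧸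
      ((V.prod (padicPowSubgroup p j) : OpenSubgroup _) : Subgroup _)) =
      ((g, Multiplicative.ofAdd ((x.toAdd.appr j : ℕ) : ℤ_[p])) :
        G × Multiplicative ℤ_[p]) := by
  rw [QuotientGroup.eq]
  refine ⟨by simp, ?_⟩
  have := PadicInt.appr_spec j x.toAdd
  rw [Ideal.mem_span_singleton, ← dvd_neg] at this
  change (p : ℤ_[p]) ^ j ∣ -x.toAdd + _
  convert this using 1
  simp [add_comm, sub_eq_add_neg]

/-- The fibre of `(G × ℤ_p)/(V × p^j ℤ_p) → (G × ℤ_p)/(V × ℤ_p)` over the class of `(g, 0)` consists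
of the classes of the `(g, i)` for `0 ≤ i < p^j`. -/
theorem coeff_prod_eq_sum_range (a : IwasawaAlgebra p (G × Multiplicative ℤ_[p]))
    (V : OpenSubgroup G) (j : ℕ) (g : G) :
    (a.1 (V.prod (padicPowSubgroup p 0))).coeff ((g, 1) : G × Multiplicative ℤ_[p]) =
      ∑ i ∈ Finset.range (p ^ j), (a.1 (V.prod (padicPowSubgroup p j))).coeff
        ((g, Multiplicative.ofAdd (i : ℤ_[p])) : G × Multiplicative ℤ_[p]) := by
  classical
  have := Fintype.ofFinite ((G × Multiplicative ℤ_[p]) ⧸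
    ((V.prod (padicPowSubgroup p j) : OpenSubgroup _) : Subgroup _))
  rw [coeff_eq_sum a (prod_padicPowSubgroup_le V j)]
  symm
  refine Finset.sum_bij (fun i _ => (((g, Multiplicative.ofAdd (i : ℤ_[p])) :
    G × Multiplicative ℤ_[p]) : (G × Multiplicative ℤ_[p]) ⧸
      ((V.prod (padicPowSubgroup p j) : OpenSubgroup _) : Subgroup _))) ?_ ?_ ?_ ?_
  · intro i _
    rw [Finset.mem_filter]
    refine ⟨Finset.mem_univ _, ?_⟩
    change (((g, Multiplicative.ofAdd (i : ℤ_[p])) : G × Multiplicative ℤ_[p]) :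
      (G × Multiplicative ℤ_[p]) ⧸
        ((V.prod (padicPowSubgroup p 0) : OpenSubgroup _) : Subgroup _)) = _
    rw [QuotientGroup.eq]
    exact ⟨by simp, mem_padicPowSubgroup.2 (by simp)⟩
  · intro i hi i' hi' hii
    rw [QuotientGroup.eq] at hii
    have h1 : (p : ℤ_[p]) ^ j ∣ -(i : ℤ_[p]) + (i' : ℤ_[p]) := hii.2
    have h2 : ((p ^ j : ℕ) : ℤ) ∣ (i' : ℤ) - i := by
      rw [Nat.cast_pow, ← PadicInt.pow_p_dvd_int_iff]
      push_cast
      rwa [sub_eq_neg_add]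
    rw [Finset.mem_range] at hi hi'
    have := (Nat.modEq_iff_dvd.2 h2)
    rwa [Nat.ModEq, Nat.mod_eq_of_lt hi, Nat.mod_eq_of_lt hi'] at this
  · intro z hz
    rw [Finset.mem_filter] at hz
    induction z using QuotientGroup.induction_on
    rename_i z
    obtain ⟨z1, z2⟩ := z
    have hz2 : ((z1, z2) : (G × Multiplicative ℤ_[p]) ⧸
        ((V.prod (padicPowSubgroup p 0) : OpenSubgroup _) : Subgroup _)) =
        ((g, 1) : G × Multiplicative ℤ_[p]) := hz.2
    rw [QuotientGroup.eq] at hz2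
    refine ⟨z2.toAdd.appr j, Finset.mem_range.2 (PadicInt.appr_lt _ _), ?_⟩
    rw [mk_prod_eq_mk_appr V j z1 z2, QuotientGroup.eq]
    have h3 : z1⁻¹ * g ∈ V := hz2.1
    have h4 := inv_mem h3
    rw [mul_inv_rev, inv_inv] at h4
    exact ⟨h4, mem_padicPowSubgroup.2 (by simp)⟩
  · intro i _
    rfl

omit [IsTopologicalGroup G] [CompactSpace G] in
/-- A distribution killed by `[γ] - 1` is invariant under translation along `ℤ_p`. -/
theorem coeff_eq_of_genVar_mul_eq_zero {a : IwasawaAlgebra p (G × Multiplicative ℤ_[p])}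
    (h : genVar p G * a = 0) (V : OpenSubgroup G) (j n : ℕ) (g : G) :
    (a.1 (V.prod (padicPowSubgroup p j))).coeff
        ((g, Multiplicative.ofAdd (n : ℤ_[p])) : G × Multiplicative ℤ_[p]) =
      (a.1 (V.prod (padicPowSubgroup p j))).coeff ((g, 1) : G × Multiplicative ℤ_[p]) := by
  have hinv : of p (genSnd p G ^ n) * a = a := by
    have h1 : of p (genSnd p G) * a = a := by
      rwa [genVar, sub_mul, one_mul, sub_eq_zero] at h
    induction n with
    | zero => simp
    | succ n ih => rw [pow_succ, map_mul, mul_assoc, h1, ih]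
  have key := coeff_of_mul (genSnd p G ^ n) a (V.prod (padicPowSubgroup p j))
    ((g, 1) : G × Multiplicative ℤ_[p])
  rw [hinv, genSnd_pow, ← QuotientGroup.mk_mul, Prod.mk_mul_mk, one_mul, mul_one] at key
  exact key

/-- The total mass of an invariant distribution along `ℤ_p` is `p^j` times the mass of a coset of
`p^j ℤ_p`. -/
theorem coeff_zero_eq_of_genVar_mul_eq_zero
    {a : IwasawaAlgebra p (G × Multiplicative ℤ_[p])} (h : genVar p G * a = 0)
    (V : OpenSubgroup G) (j : ℕ) (g : G) :
    (a.1 (V.prod (padicPowSubgroup p 0))).coeff ((g, 1) : G × Multiplicative ℤ_[p]) =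
      ((p ^ j : ℕ) : ℤ_[p]) *
        (a.1 (V.prod (padicPowSubgroup p j))).coeff ((g, 1) : G × Multiplicative ℤ_[p]) := by
  rw [coeff_prod_eq_sum_range a V j g,
    Finset.sum_congr rfl fun i _ => coeff_eq_of_genVar_mul_eq_zero h V j i g,
    Finset.sum_const, Finset.card_range, nsmul_eq_mul]

/-- A distribution invariant under translation along `ℤ_p` vanishes on all products of cosets, since
its total mass along `ℤ_p` is divisible by every power of `p`. -/
theorem coeff_mk_eq_zero_of_genVar_mul_eq_zero
    {a : IwasawaAlgebra p (G × Multiplicative ℤ_[p])} (h : genVar p G * a = 0)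
    (V : OpenSubgroup G) (j : ℕ) (g : G) (x : Multiplicative ℤ_[p]) :
    (a.1 (V.prod (padicPowSubgroup p j))).coeff ((g, x) : G × Multiplicative ℤ_[p]) = 0 := by
  rw [mk_prod_eq_mk_appr V j g x, coeff_eq_of_genVar_mul_eq_zero h V j _ g]
  have h1 := coeff_zero_eq_of_genVar_mul_eq_zero h V j g
  have h0 : (a.1 (V.prod (padicPowSubgroup p 0))).coeff
      ((g, 1) : G × Multiplicative ℤ_[p]) = 0 := by
    refine PadicInt.eq_zero_of_forall_pow_dvd p fun k => ?_
    rw [coeff_zero_eq_of_genVar_mul_eq_zero h V k g, ← Nat.cast_pow]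
    exact dvd_mul_right _ _
  rw [h0] at h1
  exact (mul_eq_zero.1 h1.symm).resolve_left
    (Nat.cast_ne_zero.2 (pow_ne_zero _ (Fact.out : p.Prime).ne_zero))

omit [IsTopologicalGroup G] [CompactSpace G] in
theorem exists_prod_padicPowSubgroup_le (N : OpenSubgroup (G × Multiplicative ℤ_[p])) :
    ∃ (V : OpenSubgroup G) (j : ℕ), V.prod (padicPowSubgroup p j) ≤ N := by
  obtain ⟨j, hj⟩ := exists_level_snd N
  refine ⟨N.comap (MonoidHom.inl G (Multiplicative ℤ_[p]))
    (Continuous.prodMk continuous_id continuous_const), j, ?_⟩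
  rintro ⟨g, x⟩ ⟨hg, hx⟩
  have h1 : ((g, 1) : G × Multiplicative ℤ_[p]) ∈ N := hg
  have := mul_mem h1 (hj x hx)
  simpa using this

/-- The element `[γ] - 1` is not a zero divisor: the values of a distribution on a compact group
which is invariant under translation along `ℤ_p` are divisible by all powers of `p`. -/
theorem genVar_mul_eq_zero {a : IwasawaAlgebra p (G × Multiplicative ℤ_[p])}
    (h : genVar p G * a = 0) : a = 0 := by
  classical
  refine ext fun N x => ?_
  obtain ⟨V, j, hVN⟩ := exists_prod_padicPowSubgroup_le N
  have := Fintype.ofFinite ((G × Multiplicative ℤ_[p]) ⧸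
    ((V.prod (padicPowSubgroup p j) : OpenSubgroup _) : Subgroup _))
  rw [coeff_eq_sum a hVN]
  exact Finset.sum_eq_zero fun z _ => QuotientGroup.induction_on z fun y =>
    coeff_mk_eq_zero_of_genVar_mul_eq_zero h V j y.1 y.2

/-- The `([γ] - 1)`-adic topology is separated: at each finite level modulo `p`, the element
`[γ] - 1` is nilpotent. -/
theorem eq_zero_of_forall_genVar_pow_dvd {a : IwasawaAlgebra p (G × Multiplicative ℤ_[p])}
    (h : ∀ n, genVar p G ^ n ∣ a) : a = 0 := by
  refine eq_zero_of_forall_pow_dvd fun N k => ?_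
  obtain ⟨j, hj⟩ := exists_level_snd N
  have hu : (level N (of p (genSnd p G))) ^ p ^ j = 1 := by
    rw [← map_pow, ← map_pow, genSnd_pow]
    change MonoidAlgebra.single _ 1 = MonoidAlgebra.single 1 1
    congr 1
    rw [QuotientGroup.eq_one_iff]
    exact hj _ (mem_padicPowSubgroup.2 (by simp))
  -- Modulo `p`, the `p^j`-th power of `[γ] - 1` is `[γ] ^ p^j - 1`, which vanishes at level `N`.
  have h1 : (p : MonoidAlgebra ℤ_[p] ((G × Multiplicative ℤ_[p]) ⧸ (N : Subgroup _))) ∣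
      (level N (genVar p G)) ^ p ^ j := by
    obtain ⟨r, hr⟩ := exists_add_pow_prime_pow_eq (Fact.out : p.Prime) (level N (genVar p G)) 1 j
    rw [genVar, map_sub, map_one, sub_add_cancel, hu, one_pow] at hr
    refine ⟨-((level N (of p (genSnd p G)) - 1) * r), ?_⟩
    rw [genVar, map_sub, map_one]
    linear_combination -hr
  have h2 := pow_dvd_pow_of_dvd h1 k
  rw [← pow_mul, ← map_pow] at h2
  rw [Nat.cast_pow]
  exact h2.trans (map_dvd (level N) (h _))

omit [IsTopologicalGroup G] [CompactSpace G] in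
variable (p G) in
theorem continuous_fst_prod_padic : Continuous (MonoidHom.fst G (Multiplicative ℤ_[p])) :=
  continuous_fst

omit [IsTopologicalGroup G] [CompactSpace G] in
variable (p G) in
theorem continuous_inl_prod_padic : Continuous (MonoidHom.inl G (Multiplicative ℤ_[p])) :=
  Continuous.prodMk continuous_id continuous_const

variable (p G) in
/-- The additive map `a ↦ a - s (π a)`, where `π` and `s` are induced by the projection of `G × ℤ_p`
to `G` and by the inclusion of `G`. -/
def subProj : IwasawaAlgebra p (G × Multiplicative ℤ_[p]) →+
    IwasawaAlgebra p (G × Multiplicative ℤ_[p]) :=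
  AddMonoidHom.id _ - ((iwasawaMap p _ (continuous_inl_prod_padic p G)).comp
    (iwasawaMap p _ (continuous_fst_prod_padic p G))).toAddMonoidHom

omit [IsTopologicalGroup G] [CompactSpace G] in
/-- On a group element `[(g, n)]` with `n` a natural number, the divisibility is that of
`[γ] ^ n - 1` by `[γ] - 1`. -/
theorem genVar_dvd_subProj_of (g : G) (n : ℕ) : genVar p G ∣
    subProj p G (of p ((g, Multiplicative.ofAdd (n : ℤ_[p])) : G × Multiplicative ℤ_[p])) := by
  have h0 : subProj p G (of p ((g, Multiplicative.ofAdd (n : ℤ_[p])) : G × Multiplicative ℤ_[p])) =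
      of p ((g, Multiplicative.ofAdd (n : ℤ_[p])) : G × Multiplicative ℤ_[p]) -
        iwasawaMap p _ (continuous_inl_prod_padic p G)
          (iwasawaMap p _ (continuous_fst_prod_padic p G)
            (of p ((g, Multiplicative.ofAdd (n : ℤ_[p])) : G × Multiplicative ℤ_[p]))) := rfl
  have h1 : of p ((g, Multiplicative.ofAdd (n : ℤ_[p])) : G × Multiplicative ℤ_[p]) =
      of p ((g, 1) : G × Multiplicative ℤ_[p]) * of p (genSnd p G) ^ n := by
    rw [← map_pow, ← map_mul, genSnd_pow, Prod.mk_mul_mk, one_mul, mul_one]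
  rw [h0, iwasawaMap_of, iwasawaMap_of, MonoidHom.coe_fst, MonoidHom.inl_apply, h1]
  have h2 := sub_dvd_pow_sub_pow (of p (genSnd p G)) 1 n
  rw [one_pow] at h2
  have h3 := h2.mul_left (of p ((g, 1) : G × Multiplicative ℤ_[p]))
  rwa [mul_sub, mul_one] at h3

/-- The kernel of `ℤ_p⟦G × ℤ_p⟧ → ℤ_p⟦G⟧` is generated by `[γ] - 1`. -/
theorem genVar_dvd_subProj (a : IwasawaAlgebra p (G × Multiplicative ℤ_[p])) :
    genVar p G ∣ subProj p G a := by
  let I : AddSubgroup (IwasawaAlgebra p (G × Multiplicative ℤ_[p])) :=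
    (Ideal.span {genVar p G}).toAddSubgroup
  have hI : (I : Set (IwasawaAlgebra p (G × Multiplicative ℤ_[p]))) =
      Set.range fun c => genVar p G * c := by
    ext a
    refine Ideal.mem_span_singleton.trans ?_
    exact exists_congr fun _ => eq_comm
  have hI' : IsClosed (I : Set (IwasawaAlgebra p (G × Multiplicative ℤ_[p]))) := by
    rw [hI]; exact (isCompact_range (continuous_const_mul _)).isClosed
  have hcont : Continuous (subProj p G) := continuous_id.sub
    ((continuous_iwasawaMap _ _).comp (continuous_iwasawaMap _ _))
  suffices I.comap (subProj p G) = ⊤ from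
    Ideal.mem_span_singleton.1 (this ▸ AddSubgroup.mem_top a : a ∈ I.comap (subProj p G))
  refine eq_top_of_isClosed (D := {x | ∃ n : ℕ, x.2 = Multiplicative.ofAdd (n : ℤ_[p])}) ?_
    (hI'.preimage hcont) ?_
  · have h1 : Dense (Set.univ ×ˢ Set.range fun n : ℕ => Multiplicative.ofAdd (n : ℤ_[p]) :
        Set (G × Multiplicative ℤ_[p])) :=
      dense_univ.prod (PadicInt.denseRange_natCast (p := p))
    refine h1.mono ?_
    rintro ⟨g, x⟩ ⟨_, n, hn⟩
    exact ⟨n, hn.symm⟩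
  · rintro ⟨g, x⟩ ⟨n, hn⟩
    change x = _ at hn
    subst hn
    exact Ideal.mem_span_singleton.2 (genVar_dvd_subProj_of g n)

variable (p G) in
/-- The Iwasawa algebra of `G × ℤ_p` is the power series ring in one variable over that of `G`. -/
theorem nonempty_prod_ringEquiv_powerSeries :
    Nonempty (IwasawaAlgebra p (G × Multiplicative ℤ_[p]) ≃+*
      PowerSeries (IwasawaAlgebra p G)) := by
  refine nonempty_ringEquiv_powerSeries (iwasawaMap p _ (continuous_fst_prod_padic p G))
    (iwasawaMap p _ (continuous_inl_prod_padic p G)) ?_ (genVar p G) ?_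
    (fun a => genVar_mul_eq_zero) genVar_dvd_subProj
    (fun a => eq_zero_of_forall_genVar_pow_dvd) (exists_forall_pow_dvd_sub_sum _)
  · intro b
    rw [← RingHom.comp_apply, ← iwasawaMap_comp]
    exact congrArg (fun f => f b) iwasawaMap_id
  · rw [genVar, map_sub, iwasawaMap_of, map_one]
    change of p 1 - 1 = 0
    rw [map_one, sub_self]

end IwasawaAlgebra

end IwasawaPowerSeries

/-! ### The dimension of the generic fibre -/

section FormalDimension

/-- The generic fibre of `Spf R` has as points the primes of `R` not containing `p`. -/
def primesAwayOrderIso (p : ℕ) (R : Type*) [CommRing R] :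
    PrimeSpectrum (Localization.Away (p : R)) ≃o {q : PrimeSpectrum R // (p : R) ∉ q.asIdeal} where
  toFun q := ⟨PrimeSpectrum.comap (algebraMap R _) q, fun h => by
    exact q.2.ne_top (Ideal.eq_top_of_isUnit_mem _ (Ideal.mem_comap.1 h)
      (IsLocalization.Away.algebraMap_isUnit (p : R)))⟩
  invFun q := ⟨Ideal.map (algebraMap R _) q.1.asIdeal,
    IsLocalization.isPrime_of_isPrime_disjoint (Submonoid.powers (p : R)) _ _ q.1.2
      ((Ideal.disjoint_powers_iff_notMem _ q.1.2.isRadical).2 q.2)⟩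
  left_inv q := PrimeSpectrum.ext
    (IsLocalization.map_under (Submonoid.powers (p : R)) (Localization.Away (p : R)) q.asIdeal)
  right_inv q := Subtype.ext (PrimeSpectrum.ext
    (IsLocalization.under_map_of_isPrime_disjoint (Submonoid.powers (p : R))
      (Localization.Away (p : R)) q.1.2
      ((Ideal.disjoint_powers_iff_notMem _ q.1.2.isRadical).2 q.2)))
  map_rel_iff' {q q'} :=
    (IsLocalization.orderIsoOfPrime (Submonoid.powers (p : R))
      (Localization.Away (p : R))).map_rel_iff
      (a := ⟨q.asIdeal, q.2⟩) (b := ⟨q'.asIdeal, q'.2⟩)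

theorem formalDim_eq_krullDim (p : ℕ) (R : Type*) [CommRing R] :
    formalDim p R = Order.krullDim {q : PrimeSpectrum R // (p : R) ∉ q.asIdeal} :=
  Order.krullDim_eq_of_orderIso (primesAwayOrderIso p R)

variable {R S : Type*} [CommRing R] [CommRing S]

theorem comap_strictMono_of_isIntegral {φ : R →+* S} (hφ : φ.IsIntegral) :
    StrictMono (PrimeSpectrum.comap φ) := by
  algebraize [φ]
  intro q q' h
  exact Ideal.IsIntegral.comap_lt_comap (R := R) (I := q.asIdeal) (J := q'.asIdeal) h

/-- Lying over and going up lift a chain of primes along an integral injection; the top of the chain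
is kept track of so that `p` can be kept out of the lifted primes. -/
theorem exists_ltSeries_of_isIntegral {φ : R →+* S} (hφ : φ.IsIntegral)
    (hinj : Function.Injective φ) (l : LTSeries (PrimeSpectrum R)) :
    ∃ L : LTSeries (PrimeSpectrum S), L.length = l.length ∧
      PrimeSpectrum.comap φ L.last = l.last := by
  algebraize [φ]
  obtain ⟨Q, -, hQ, hQl⟩ := Ideal.exists_ideal_over_prime_of_isIntegral (R := R) (S := S)
    l.head.asIdeal ⊥ (by
      rw [← RingHom.ker_eq_comap_bot]
      exact ((RingHom.injective_iff_ker_eq_bot _).1 hinj).le.trans bot_le)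
  have : Q.LiesOver l.head.asIdeal := ⟨hQl.symm⟩
  obtain ⟨L, hL, -, hmap⟩ := Ideal.exists_ltSeries_of_hasGoingUp l Q
  refine ⟨L, hL, ?_⟩
  have h1 := congrArg List.getLast? hmap
  rw [List.getLast?_map, List.getLast?_eq_getLast_of_ne_nil L.toList_ne_nil,
    List.getLast?_eq_getLast_of_ne_nil l.toList_ne_nil, RelSeries.getLast_toList,
    RelSeries.getLast_toList] at h1
  exact Option.some.inj h1

/-- Integral injections preserve the Krull dimension. -/
theorem ringKrullDim_eq_of_isIntegral {φ : R →+* S} (hφ : φ.IsIntegral)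
    (hinj : Function.Injective φ) : ringKrullDim S = ringKrullDim R := by
  refine le_antisymm (Order.krullDim_le_of_strictMono _ (comap_strictMono_of_isIntegral hφ)) ?_
  refine iSup_le fun l => ?_
  obtain ⟨L, hL, -⟩ := exists_ltSeries_of_isIntegral hφ hinj l
  rw [← hL]
  exact Order.LTSeries.length_le_krullDim L

/-- Integral injections preserve the dimension of the generic fibre. -/
theorem formalDim_eq_of_isIntegral (p : ℕ) {φ : R →+* S} (hφ : φ.IsIntegral)
    (hinj : Function.Injective φ) : formalDim p S = formalDim p R := by
  rw [formalDim_eq_krullDim, formalDim_eq_krullDim]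
  have hmem : ∀ q : PrimeSpectrum S,
      (p : R) ∈ (PrimeSpectrum.comap φ q).asIdeal ↔ (p : S) ∈ q.asIdeal := fun q => by
    rw [PrimeSpectrum.comap_asIdeal, Ideal.mem_comap, map_natCast]
  refine le_antisymm (Order.krullDim_le_of_strictMono
    (fun q => ⟨PrimeSpectrum.comap φ q.1, fun h => q.2 ((hmem q.1).1 h)⟩)
    fun q q' h => comap_strictMono_of_isIntegral hφ h) ?_
  refine iSup_le fun l => ?_
  obtain ⟨L, hL, hlast⟩ := exists_ltSeries_of_isIntegral hφ hinj
    (l.map Subtype.val fun _ _ h => h)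
  have hp : (p : S) ∉ L.last.asIdeal := by
    rw [← hmem, hlast]
    exact l.last.2
  let L' : LTSeries {q : PrimeSpectrum S // (p : S) ∉ q.asIdeal} :=
    LTSeries.mk L.length
      (fun i => ⟨L i, fun h => hp (LTSeries.monotone L (Fin.le_last i) h)⟩)
      (fun _ _ h => LTSeries.strictMono L h)
  have h2 : L'.length = l.length := hL
  rw [← h2]
  exact Order.LTSeries.length_le_krullDim L'

/-- A noetherian local domain of residue characteristic `p` with a system of `d + 1` generators of
its maximal ideal and a chain of `d + 1` primes not containing `p`. Such a ring has the dimensions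
of `ℤ_p⟦T₁, …, T_d⟧`: its Krull dimension is at most `d + 1` by Krull's height theorem, and the
chain gives the opposite inequality. -/
structure IsFormallySmoothLike (p d : ℕ) (R : Type*) [CommRing R] : Prop where
  isDomain : IsDomain R
  isNoetherianRing : IsNoetherianRing R
  isLocalRing : IsLocalRing R
  not_isUnit : ¬ IsUnit (p : R)
  exists_generators : ∃ s : Finset R, s.card ≤ d + 1 ∧
    ∀ x, x ∈ Ideal.span (s : Set R) ↔ ¬ IsUnit x
  exists_chain : ∃ l : LTSeries (PrimeSpectrum R), l.length = d ∧ (p : R) ∉ l.last.asIdeal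

namespace IsFormallySmoothLike

variable {p d : ℕ}

theorem of_ringEquiv (h : IsFormallySmoothLike p d R) (e : R ≃+* S) :
    IsFormallySmoothLike p d S := by
  classical
  obtain ⟨h1, h2, h3, h4, ⟨s, hs, hs'⟩, ⟨l, hl, hl'⟩⟩ := h
  refine ⟨e.toMulEquiv.symm.isDomain _, isNoetherianRing_of_ringEquiv R e, e.isLocalRing, ?_, ?_,
    ?_⟩
  · rw [← map_natCast e]
    rwa [MulEquiv.isUnit_map e]
  · refine ⟨s.image e, Finset.card_image_le.trans hs, fun x => ?_⟩
    have h5 : Ideal.span ((s.image e : Finset S) : Set S) =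
        (Ideal.span (s : Set R)).map (e : R →+* S) := by
      rw [Ideal.map_span, Finset.coe_image]
      rfl
    rw [h5, ← MulEquiv.isUnit_map e.symm, ← hs', Ideal.map_coe e, Ideal.mem_map_of_equiv]
    constructor
    · rintro ⟨y, hy, rfl⟩
      rwa [e.symm_apply_apply]
    · exact fun hy => ⟨_, hy, e.apply_symm_apply x⟩
  · refine ⟨l.map (PrimeSpectrum.comapEquiv e) (OrderIso.strictMono _), hl, ?_⟩
    intro h5
    apply hl'
    have h6 : (p : S) ∈ (PrimeSpectrum.comapEquiv e l.last).asIdeal := h5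
    have h7 : e.symm (p : S) ∈ l.last.asIdeal := h6
    rwa [map_natCast] at h7

/-- The chain of primes of `R⟦X⟧` consists of `0` and the inverse images of the chain of `R` under
`X ↦ 0`. -/
theorem powerSeries (h : IsFormallySmoothLike p d R) :
    IsFormallySmoothLike p (d + 1) (PowerSeries R) := by
  classical
  obtain ⟨h1, h2, h3, h4, ⟨s, hs, hs'⟩, ⟨l, hl, hl'⟩⟩ := h
  refine ⟨inferInstance, inferInstance, inferInstance, ?_, ?_, ?_⟩
  · rw [PowerSeries.isUnit_iff_constantCoeff, map_natCast]
    exact h4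
  · refine ⟨insert PowerSeries.X (s.image PowerSeries.C), ?_, fun x => ?_⟩
    · exact (Finset.card_insert_le _ _).trans (Nat.succ_le_succ (Finset.card_image_le.trans hs))
    rw [PowerSeries.isUnit_iff_constantCoeff, ← hs']
    refine ⟨fun hx => ?_, fun hx => ?_⟩
    · have h5 := Ideal.mem_map_of_mem (PowerSeries.constantCoeff (R := R)) hx
      rw [Ideal.map_span] at h5
      refine Ideal.span_le.2 ?_ h5
      rintro _ ⟨y, hy, rfl⟩
      rcases Finset.mem_insert.1 (Finset.mem_coe.1 hy) with rfl | hy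
      · simp
      · obtain ⟨z, hz, rfl⟩ := Finset.mem_image.1 hy
        simpa using Ideal.subset_span (Finset.mem_coe.2 hz)
    · have h5 := Ideal.mem_map_of_mem (PowerSeries.C (R := R)) hx
      rw [Ideal.map_span] at h5
      have h6 : x = PowerSeries.C (PowerSeries.constantCoeff x) +
          (x - PowerSeries.C (PowerSeries.constantCoeff x)) := by ring
      rw [h6]
      refine add_mem (Ideal.span_mono ?_ h5) ?_
      · rw [Finset.coe_insert, Finset.coe_image]
        exact Set.subset_insert _ _
      · refine Ideal.mem_of_dvd _ (PowerSeries.X_dvd_iff.2 (by simp))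
          (Ideal.subset_span (Finset.mem_coe.2 (Finset.mem_insert_self _ _)))
  · have hinj : StrictMono (PrimeSpectrum.comap (PowerSeries.constantCoeff (R := R))) := by
      intro q q' h
      refine lt_of_le_of_ne (Ideal.comap_mono h.le) fun heq => h.ne ?_
      exact PrimeSpectrum.comap_injective_of_surjective _
        PowerSeries.constantCoeff_surj heq
    let l' := l.map _ hinj
    have hlt : (⟨⊥, Ideal.isPrime_bot⟩ : PrimeSpectrum (PowerSeries R)) < l'.head := by
      refine lt_of_le_of_ne (show (⊥ : Ideal _) ≤ _ from bot_le) fun heq => ?_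
      have h5 : (PowerSeries.X : PowerSeries R) ∈ l'.head.asIdeal := by
        change PowerSeries.constantCoeff (PowerSeries.X : PowerSeries R) ∈ l.head.asIdeal
        simp
      rw [← heq] at h5
      exact PowerSeries.X_ne_zero ((Submodule.mem_bot _).1 h5)
    refine ⟨RelSeries.cons l' _ hlt, ?_, ?_⟩
    · rw [RelSeries.cons_length]
      exact congrArg (· + 1) hl
    · rw [RelSeries.last_cons]
      intro h5
      apply hl'
      have h6 : PowerSeries.constantCoeff (p : PowerSeries R) ∈ l.last.asIdeal := h5
      rwa [map_natCast] at h6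

theorem ringKrullDim_le (h : IsFormallySmoothLike p d R) : ringKrullDim R ≤ (d + 1 : ℕ) := by
  obtain ⟨h1, h2, h3, h4, ⟨s, hs, hs'⟩, -⟩ := h
  rw [← IsLocalRing.maximalIdeal_height_eq_ringKrullDim]
  have hle : IsLocalRing.maximalIdeal R = Ideal.span (s : Set R) := Ideal.ext fun x => (hs' x).symm
  have htop : Ideal.span (s : Set R) ≠ ⊤ := hle ▸ Ideal.IsPrime.ne_top'
  rw [hle]
  have h5 := Ideal.height_le_spanFinrank (Ideal.span (s : Set R)) htop
  have h6 := Submodule.spanFinrank_span_le_ncard_of_finite (R := R) s.finite_toSet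
  rw [Set.ncard_coe_finset] at h6
  have h7 : (Ideal.span (s : Set R)).height ≤ ((d + 1 : ℕ) : ℕ∞) :=
    h5.trans (by exact_mod_cast h6.trans hs)
  exact_mod_cast h7

theorem le_chain (h : IsFormallySmoothLike p d R) :
    (d : WithBot ℕ∞) ≤ formalDim p R := by
  obtain ⟨l, hl, hl'⟩ := h.exists_chain
  rw [formalDim_eq_krullDim]
  let L' : LTSeries {q : PrimeSpectrum R // (p : R) ∉ q.asIdeal} :=
    LTSeries.mk l.length
      (fun i => ⟨l i, fun h => hl' (LTSeries.monotone l (Fin.le_last i) h)⟩)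
      (fun _ _ h => LTSeries.strictMono l h)
  have h2 : L'.length = d := hl
  rw [← h2]
  exact Order.LTSeries.length_le_krullDim L'

/-- A chain of primes not containing `p` is prolonged by the maximal ideal. -/
theorem formalDim_add_one_le (h : IsFormallySmoothLike p d R) :
    formalDim p R + 1 ≤ ringKrullDim R := by
  have := h.isLocalRing
  obtain ⟨l, -, hl'⟩ := h.exists_chain
  have : Nonempty {q : PrimeSpectrum R // (p : R) ∉ q.asIdeal} := ⟨⟨_, hl'⟩⟩
  rw [formalDim_eq_krullDim, Order.krullDim_eq_iSup_length, ← WithBot.coe_one, ← WithBot.coe_add,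
    ENat.iSup_add, WithBot.coe_iSup (OrderTop.bddAbove _)]
  refine iSup_le fun l => ?_
  have hlt : (l.map Subtype.val fun _ _ h => h).last < IsLocalRing.closedPoint R := by
    refine lt_of_le_of_ne (IsLocalRing.le_maximalIdeal l.last.1.2.ne_top) fun heq => ?_
    have h5 : (p : R) ∉ (l.map Subtype.val fun _ _ h => h).last.asIdeal := l.last.2
    rw [heq] at h5
    exact h5 h.not_isUnit
  exact Order.LTSeries.length_le_krullDim
    (RelSeries.snoc (l.map Subtype.val fun _ _ h => h) _ hlt)

end IsFormallySmoothLike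

end FormalDimension

/-! ### Components of finite flat algebras -/

section Coverings

variable {R S : Type*} [CommRing R] [CommRing S]

theorem exists_comap_eq_of_isIntegral {φ : R →+* S} (hφ : φ.IsIntegral) {I : Ideal S}
    {q : PrimeSpectrum R} (h : I.comap φ ≤ q.asIdeal) :
    ∃ Q : PrimeSpectrum S, I ≤ Q.asIdeal ∧ PrimeSpectrum.comap φ Q = q := by
  algebraize [φ]
  obtain ⟨Q, hIQ, hQ, hQq⟩ := Ideal.exists_ideal_over_prime_of_isIntegral (R := R) (S := S)
    q.asIdeal I h
  exact ⟨⟨Q, hQ⟩, hIQ, PrimeSpectrum.ext hQq⟩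

/-- An integral continuous ring homomorphism along which open ideals extend to open ideals maps
every closed formal subscheme onto its scheme-theoretic image, in all three senses. -/
theorem mapsOnto_comap_of_isIntegral (p : ℕ) [TopologicalSpace R] [TopologicalSpace S]
    [IsTopologicalRing S] {φ : R →+* S} (hφ : φ.IsIntegral) (hcont : Continuous φ)
    (hopen : ∀ q : Ideal R, IsOpen (q : Set R) → IsOpen ((q.map φ : Ideal S) : Set S))
    (I : Ideal S) : MapsOnto p φ I (I.comap φ) := by
  have hp : ∀ Q : PrimeSpectrum S,
      (p : R) ∈ (PrimeSpectrum.comap φ Q).asIdeal ↔ (p : S) ∈ Q.asIdeal := fun Q => by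
    rw [PrimeSpectrum.comap_asIdeal, Ideal.mem_comap, map_natCast]
  have hle : ∀ Q : PrimeSpectrum S, I ≤ Q.asIdeal →
      I.comap φ ≤ (PrimeSpectrum.comap φ Q).asIdeal := fun Q hQ => Ideal.comap_mono hQ
  refine ⟨Set.Subset.antisymm ?_ ?_, Set.Subset.antisymm ?_ ?_, Set.Subset.antisymm ?_ ?_⟩
  · rintro _ ⟨Q, hQ, rfl⟩
    exact hle Q hQ
  · intro q hq
    obtain ⟨Q, hQ, rfl⟩ := exists_comap_eq_of_isIntegral hφ (I := I) (q := q) hq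
    exact ⟨Q, hQ, rfl⟩
  · rintro _ ⟨Q, ⟨hQ, hQo⟩, rfl⟩
    exact ⟨hle Q hQ, IsOpen.preimage hcont hQo⟩
  · rintro q ⟨hq, hqo⟩
    obtain ⟨Q, hQ, rfl⟩ := exists_comap_eq_of_isIntegral hφ (I := I) (q := q) hq
    exact ⟨Q, ⟨hQ, AddSubgroup.isOpen_mono
      (H₁ := ((PrimeSpectrum.comap φ Q).asIdeal.map φ).toAddSubgroup)
      (H₂ := Q.asIdeal.toAddSubgroup) (Ideal.map_comap_le (f := φ) (K := Q.asIdeal))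
      (hopen _ hqo)⟩, rfl⟩
  · rintro _ ⟨Q, ⟨hQ, hQp, hQm⟩, rfl⟩
    refine ⟨hle Q hQ, fun h => hQp ((hp Q).1 h), fun q' hq' hle' => ?_⟩
    obtain ⟨Q', hQQ', rfl⟩ := exists_comap_eq_of_isIntegral hφ (I := Q.asIdeal) (q := q') hle'
    exact Ideal.comap_mono (hQm (fun h => hq' ((hp Q').2 h)) hQQ')
  · rintro q ⟨hq, hqp, hqm⟩
    obtain ⟨Q, hQ, rfl⟩ := exists_comap_eq_of_isIntegral hφ (I := I) (q := q) hq
    refine ⟨Q, ⟨hQ, fun h => hqp ((hp Q).2 h), fun Q' hQ' hle' => ?_⟩, rfl⟩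
    by_contra hnot
    have hlt := comap_strictMono_of_isIntegral hφ (lt_of_le_not_ge hle' hnot)
    exact hlt.not_ge (hqm (fun h => hQ' ((hp Q').1 h)) hlt.le)

/-- Minimal primes contract to minimal primes along a flat homomorphism (going down). -/
theorem comap_mem_minimalPrimes_of_flat {φ : R →+* S} (hφ : φ.Flat) {P : Ideal S}
    (hP : P ∈ minimalPrimes S) : P.comap φ ∈ minimalPrimes R := by
  algebraize [φ]
  have hprime : P.IsPrime := hP.1.1
  refine ⟨⟨hprime.comap φ, bot_le⟩, fun q hq hle => ?_⟩
  have hqp : q.IsPrime := hq.1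
  have : P.LiesOver (P.comap φ) := ⟨rfl⟩
  obtain ⟨Q, hQP, hQ, hQq⟩ := Ideal.exists_ideal_le_liesOver_of_le P (q := P.comap φ) hle
  rw [hQq.over]
  exact Ideal.comap_mono (hP.2 ⟨hQ, bot_le⟩ hQP)

/-- Over a noetherian local domain with the dimensions of `ℤ_p⟦T₁, …, T_d⟧`, the components of a
finite flat algebra have these dimensions too. -/
theorem IsFormallySmoothLike.dim_quotient_minimalPrime {p d : ℕ} (h : IsFormallySmoothLike p d R)
    {φ : R →+* S} (hfin : φ.Finite) (hflat : φ.Flat) {P : Ideal S} (hP : P ∈ minimalPrimes S) :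
    formalDim p (S ⧸ P) = (d : WithBot ℕ∞) ∧ ringKrullDim (S ⧸ P) = ((d + 1 : ℕ) : WithBot ℕ∞) := by
  have := h.isDomain
  have h0 : P.comap φ = ⊥ := by
    have h1 := comap_mem_minimalPrimes_of_flat hflat hP
    rwa [IsDomain.minimalPrimes_eq_singleton_bot, Set.mem_singleton_iff] at h1
  have hint : ((Ideal.Quotient.mk P).comp φ).IsIntegral :=
    ((RingHom.Finite.of_surjective _ Ideal.Quotient.mk_surjective).comp hfin).to_isIntegral
  have hinj : Function.Injective ((Ideal.Quotient.mk P).comp φ) := by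
    rw [RingHom.injective_iff_ker_eq_bot, ← RingHom.comap_ker, Ideal.mk_ker, h0]
  have h1 := h.le_chain
  have h2 := h.formalDim_add_one_le
  have h3 := h.ringKrullDim_le
  rw [formalDim_eq_of_isIntegral p hint hinj, ringKrullDim_eq_of_isIntegral hint hinj]
  push_cast at h3 ⊢
  refine ⟨le_antisymm ?_ h1, le_antisymm h3 ((add_le_add_left h1 1).trans h2)⟩
  have h4 := h2.trans h3
  generalize formalDim p R = x at h4
  cases x with
  | bot => exact bot_le
  | coe x =>
    have h5 : x + 1 ≤ (d : ℕ∞) + 1 := by exact_mod_cast h4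
    have h6 := (ENat.add_le_add_iff_right (by simp)).1 h5
    exact_mod_cast h6

end Coverings

/-! ### The Iwasawa algebra of `ℤ_p^d` -/

section StandardIwasawaAlgebra

variable (p : ℕ) [Fact p.Prime]

namespace IwasawaAlgebra

/-- The Iwasawa algebra of the trivial group is `ℤ_p`. -/
theorem nonempty_ringEquiv_padicInt (G : Type*) [CommGroup G] [TopologicalSpace G]
    [Subsingleton G] : Nonempty (IwasawaAlgebra p G ≃+* ℤ_[p]) := by
  have hsub : ∀ N : OpenSubgroup G, Subsingleton (G ⧸ (N : Subgroup G)) := fun N =>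
    QuotientGroup.mk_surjective.subsingleton
  have := hsub ⊤
  refine ⟨RingEquiv.ofBijective
    ((MonoidAlgebra.uniqueRingEquiv (G ⧸ ((⊤ : OpenSubgroup G) : Subgroup G)) :
      MonoidAlgebra ℤ_[p] _ ≃+* ℤ_[p]).toRingHom.comp
      ((Pi.evalRingHom _ ⊤).comp (iwasawaSubring p G).subtype)) ⟨fun a b h => ?_, fun c => ?_⟩⟩
  · have h1 : a.1 ⊤ = b.1 ⊤ := (MonoidAlgebra.uniqueRingEquiv _).injective h
    refine Subtype.ext (funext fun N => ?_)
    have h2 : N = ⊤ := SetLike.ext fun x => by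
      rw [Subsingleton.elim x 1]
      exact ⟨fun _ => one_mem _, fun _ => one_mem _⟩
    rw [h2, h1]
  · refine ⟨⟨fun N => MonoidAlgebra.single 1 c, fun N N' h => MonoidAlgebra.mapDomain_single⟩, ?_⟩
    have h1 : (MonoidAlgebra.uniqueRingEquiv
        (G ⧸ ((⊤ : OpenSubgroup G) : Subgroup G))).symm c = MonoidAlgebra.single 1 c :=
      MonoidAlgebra.uniqueRingEquiv_symm_apply _ c
    change MonoidAlgebra.uniqueRingEquiv _ (MonoidAlgebra.single 1 c) = c
    rw [← h1, RingEquiv.apply_symm_apply]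

end IwasawaAlgebra

theorem isFormallySmoothLike_padicInt : IsFormallySmoothLike p 0 ℤ_[p] where
  isDomain := inferInstance
  isNoetherianRing := inferInstance
  isLocalRing := inferInstance
  not_isUnit := PadicInt.prime_p.not_isUnit
  exists_generators := ⟨{(p : ℤ_[p])}, by simp, fun x => by
    rw [Finset.coe_singleton, ← PadicInt.maximalIdeal_eq_span_p]
    exact IsLocalRing.mem_maximalIdeal x⟩
  exists_chain := ⟨RelSeries.singleton _ ⟨⊥, Ideal.isPrime_bot⟩, rfl, fun h =>
    PadicInt.prime_p.ne_zero ((Submodule.mem_bot _).1 h)⟩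

/-- Splitting off the first coordinate of `ℤ_p^{d+1}`. -/
def padicConsEquiv (d : ℕ) : Multiplicative (Fin (d + 1) → ℤ_[p]) ≃ₜ*
    Multiplicative (Fin d → ℤ_[p]) × Multiplicative ℤ_[p] where
  toFun x := (Multiplicative.ofAdd fun i => x.toAdd i.succ, Multiplicative.ofAdd (x.toAdd 0))
  invFun x := Multiplicative.ofAdd (Fin.cons x.2.toAdd x.1.toAdd)
  left_inv x := by
    apply Multiplicative.toAdd.injective
    funext i
    refine Fin.cases ?_ (fun i => ?_) i <;> rfl
  right_inv x := rfl
  map_mul' x y := rfl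
  continuous_toFun := by
    refine (continuous_ofAdd.comp (continuous_pi fun i => ?_)).prodMk
      (continuous_ofAdd.comp ((continuous_apply 0).comp continuous_toAdd))
    exact (continuous_apply i.succ).comp continuous_toAdd
  continuous_invFun := by
    refine continuous_ofAdd.comp (continuous_pi fun i => ?_)
    refine Fin.cases ?_ (fun i => ?_) i
    · exact continuous_toAdd.comp continuous_snd
    · exact (continuous_apply i).comp (continuous_toAdd.comp continuous_fst)

instance (d : ℕ) : CompactSpace (Multiplicative (Fin d → ℤ_[p])) :=
  inferInstanceAs (CompactSpace (Fin d → ℤ_[p]))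

/-- The ring `ℤ_p⟦ℤ_p^d⟧` is an iterated power series ring over `ℤ_p`. -/
theorem isFormallySmoothLike_iwasawaAlgebra (d : ℕ) :
    IsFormallySmoothLike p d (IwasawaAlgebra p (Multiplicative (Fin d → ℤ_[p]))) := by
  induction d with
  | zero =>
    have : Subsingleton (Multiplicative (Fin 0 → ℤ_[p])) :=
      inferInstanceAs (Subsingleton (Fin 0 → ℤ_[p]))
    obtain ⟨e⟩ := IwasawaAlgebra.nonempty_ringEquiv_padicInt p (Multiplicative (Fin 0 → ℤ_[p]))
    exact (isFormallySmoothLike_padicInt p).of_ringEquiv e.symm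
  | succ d ih =>
    obtain ⟨e⟩ := IwasawaAlgebra.nonempty_prod_ringEquiv_powerSeries p
      (Multiplicative (Fin d → ℤ_[p]))
    exact (ih.powerSeries.of_ringEquiv e.symm).of_ringEquiv
      (IwasawaAlgebra.congr p (padicConsEquiv p d)).symm

end StandardIwasawaAlgebra

/-! ### A criterion for a group to be isomorphic to `ℤ_pⁿ` -/

section PadicGroups

/-- A continuous bijective homomorphism from a compact group to a Hausdorff group is an isomorphism
of topological groups. -/
theorem exists_continuousMulEquiv_of_bijective {G G' : Type*} [Group G] [TopologicalSpace G]
    [CompactSpace G] [Group G'] [TopologicalSpace G'] [T2Space G'] (f : G →* G')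
    (hf : Continuous f) (hbij : Function.Bijective f) : ∃ e : G ≃ₜ* G', ∀ x, e x = f x := by
  let e := MulEquiv.ofBijective f hbij
  have he : Continuous e := hf
  exact ⟨⟨e, he, (Continuous.homeoOfEquivCompactToT2 (f := e.toEquiv) he).continuous_symm⟩,
    fun _ => rfl⟩

variable {p : ℕ} [Fact p.Prime] {V : Type*} [CommGroup V]

theorem exists_basis_of_zmod_module {E : Type*} [AddCommGroup E] [Module (ZMod p) E] {n : ℕ}
    (hcard : Nat.card E = p ^ n) :
    ∃ b : Fin n → E, ∀ m : Fin n → ℤ, ∑ i, m i • b i = 0 ↔ ∀ i, (p : ℤ) ∣ m i := by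
  have hfin : Finite E := Nat.finite_of_card_ne_zero (by
    rw [hcard]; exact pow_ne_zero _ (Fact.out : p.Prime).ne_zero)
  have hmf : Module.Finite (ZMod p) E := Module.Finite.of_finite
  have hrank : Module.finrank (ZMod p) E = n := by
    have h1 : Nat.card E = Nat.card (ZMod p) ^ Module.finrank (ZMod p) E :=
      Module.natCard_eq_pow_finrank
    rw [hcard, Nat.card_zmod] at h1
    exact (Nat.pow_right_injective (Fact.out : p.Prime).two_le h1).symm
  let b : Module.Basis (Fin n) (ZMod p) E := Module.finBasisOfFinrankEq (ZMod p) E hrank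
  refine ⟨b, fun m => ?_⟩
  simp_rw [← Int.cast_smul_eq_zsmul (ZMod p), ← ZMod.intCast_zmod_eq_zero_iff_dvd]
  exact ⟨fun h => Fintype.linearIndependent_iff.1 b.linearIndependent _ h,
    fun h => Finset.sum_eq_zero fun i _ => by rw [h i, zero_smul]⟩

/-- Lifts of a basis of the elementary abelian `p`-group `V / F`. -/
theorem exists_basis_modulo {n : ℕ} (F : Subgroup V) (hidx : F.index = p ^ n)
    (hpow : ∀ z, z ^ p ∈ F) :
    ∃ x : Fin n → V, ∀ m : Fin n → ℤ, ∏ i, x i ^ m i ∈ F ↔ ∀ i, (p : ℤ) ∣ m i := by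
  have hkill : ∀ y : Additive (V ⧸ F), p • y = 0 := fun y => by
    obtain ⟨z, hz⟩ := QuotientGroup.mk_surjective y.toMul
    apply Additive.toMul.injective
    rw [toMul_nsmul, ← hz]
    exact (QuotientGroup.eq_one_iff _).2 (hpow z)
  obtain ⟨b, hb⟩ := @exists_basis_of_zmod_module p _ (Additive (V ⧸ F)) _
    (AddCommGroup.zmodModule hkill) n hidx
  choose x hx using fun i => QuotientGroup.mk_surjective (b i).toMul
  refine ⟨x, fun m => ?_⟩
  have h1 : ((∏ i, x i ^ m i : V) : V ⧸ F) = (∑ i, m i • b i).toMul := by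
    have h2 : ((∏ i, x i ^ m i : V) : V ⧸ F) = ∏ i, ((x i : V) : V ⧸ F) ^ m i := by
      rw [← QuotientGroup.mk'_apply, map_prod]
      rfl
    rw [h2, toMul_sum]
    exact Finset.prod_congr rfl fun i _ => by rw [hx, toMul_zsmul]
  rw [← hb, ← QuotientGroup.eq_one_iff, h1, ← toMul_zero, Additive.toMul.injective.eq_iff]

/-- Dévissage of the filtration: the relation describing `F 1` in terms of the exponents propagates
to all `F k`, because `z ↦ z ^ p` induces injections `F (k - 1) / F k → F k / F (k + 1)`. -/
theorem prod_zpow_mem_iff {n : ℕ} {F : ℕ → Subgroup V} (h0 : F 0 = ⊤) (hanti : Antitone F)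
    (hpow : ∀ z k, z ^ p ∈ F (k + 1) ↔ z ∈ F k) {x : Fin n → V}
    (hx : ∀ m : Fin n → ℤ, ∏ i, x i ^ m i ∈ F 1 ↔ ∀ i, (p : ℤ) ∣ m i) (k : ℕ) :
    ∀ m : Fin n → ℤ, ∏ i, x i ^ m i ∈ F k ↔ ∀ i, (p : ℤ) ^ k ∣ m i := by
  induction k with
  | zero => simp [h0]
  | succ k ih =>
    intro m
    have key : ∀ m' : Fin n → ℤ, (∀ i, m i = p * m' i) →
        (∏ i, x i ^ m i ∈ F (k + 1) ↔ ∀ i, (p : ℤ) ^ (k + 1) ∣ m i) := by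
      intro m' hm'
      have h1 : ∏ i, x i ^ m i = (∏ i, x i ^ m' i) ^ p := by
        rw [← Finset.prod_pow]
        refine Finset.prod_congr rfl fun i _ => ?_
        rw [hm', mul_comm, zpow_mul, zpow_natCast]
      rw [h1, hpow, ih]
      refine forall_congr' fun i => ?_
      rw [hm', pow_succ']
      exact (mul_dvd_mul_iff_left (by exact_mod_cast (Fact.out : p.Prime).ne_zero)).symm
    constructor
    · intro h
      obtain ⟨m', hm'⟩ := Classical.axiomOfChoice ((hx m).1 (hanti (Nat.le_add_left 1 k) h))
      exact (key m' hm').1 h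
    · intro h
      obtain ⟨m', hm'⟩ := Classical.axiomOfChoice
        fun i => (dvd_pow_self (p : ℤ) (Nat.succ_ne_zero k)).trans (h i)
      exact (key m' hm').2 h

/-- The products `∏ xᵢ ^ mᵢ` represent all cosets of `F`: there are as many of them modulo `F` as
the index of `F`. -/
theorem exists_prod_zpow_congr {n : ℕ} {F : Subgroup V} {k : ℕ} (hidx : F.index = p ^ (n * k))
    {x : Fin n → V} (hx : ∀ m : Fin n → ℤ, ∏ i, x i ^ m i ∈ F ↔ ∀ i, (p : ℤ) ^ k ∣ m i) (v : V) :
    ∃ m : Fin n → ℤ, v⁻¹ * ∏ i, x i ^ m i ∈ F := by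
  have hp := (Fact.out : p.Prime)
  have : NeZero (p ^ k) := ⟨pow_ne_zero _ hp.ne_zero⟩
  let g : (Fin n → ZMod (p ^ k)) → V ⧸ F := fun c => ((∏ i, x i ^ ((c i).val : ℤ) : V) : V ⧸ F)
  have hcard : Nat.card (V ⧸ F) = p ^ (n * k) := hidx
  have hfin : Finite (V ⧸ F) := Nat.finite_of_card_ne_zero (by
    rw [hcard]; exact pow_ne_zero _ hp.ne_zero)
  have hinj : Function.Injective g := by
    intro c c' h
    have h1 := QuotientGroup.eq.1 h
    rw [← Finset.prod_inv_distrib, ← Finset.prod_mul_distrib] at h1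
    have h2 : ∏ i, x i ^ (((c' i).val : ℤ) - (c i).val) ∈ F := by
      convert h1 using 2 with i
      rw [sub_eq_neg_add, zpow_add, zpow_neg]
    funext i
    have h3 := (hx _).1 h2 i
    have h4 : (((c i).val : ℤ) : ZMod (p ^ k)) = (((c' i).val : ℤ) : ZMod (p ^ k)) := by
      rw [ZMod.intCast_eq_intCast_iff_dvd_sub]
      exact_mod_cast h3
    simpa using h4
  have hbij := (Nat.bijective_iff_injective_and_card g).2 ⟨hinj, by
    rw [hcard, Nat.card_fun, Nat.card_zmod, Nat.card_fin, ← pow_mul, mul_comm]⟩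
  obtain ⟨c, hc⟩ := hbij.2 (v : V ⧸ F)
  exact ⟨fun i => (c i).val, QuotientGroup.eq.1 hc.symm⟩

end PadicGroups

section PadicGroups

variable {p : ℕ} [Fact p.Prime] {V : Type*} [CommGroup V] [TopologicalSpace V]

variable (p) in
/-- The map `ℤⁿ → ℤ_pⁿ × V` with components the inclusion and `m ↦ ∏ xᵢ ^ mᵢ`. -/
def zpowGraph {n : ℕ} (x : Fin n → V) :
    Multiplicative (Fin n → ℤ) →* Multiplicative (Fin n → ℤ_[p]) × V where
  toFun m := (Multiplicative.ofAdd fun i => (m.toAdd i : ℤ_[p]), ∏ i, x i ^ m.toAdd i)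
  map_one' := by
    refine Prod.ext (Multiplicative.toAdd.injective (funext fun i => ?_)) ?_
    · exact Int.cast_zero
    · change ∏ i, x i ^ (0 : ℤ) = 1
      exact Finset.prod_eq_one fun i _ => zpow_zero (x i)
  map_mul' a b := by
    refine Prod.ext (Multiplicative.toAdd.injective (funext fun i => ?_)) ?_
    · exact Int.cast_add _ _
    · change ∏ i, x i ^ (a.toAdd i + b.toAdd i) = (∏ i, x i ^ a.toAdd i) * ∏ i, x i ^ b.toAdd i
      rw [← Finset.prod_mul_distrib]
      exact Finset.prod_congr rfl fun i _ => zpow_add _ _ _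

/-- In a compact group, a decreasing sequence of open subgroups with trivial intersection is a basis
of neighbourhoods of `1`. -/
theorem eventually_of_iInter_eq_one [CompactSpace V] {F : ℕ → Subgroup V}
    (hopen : ∀ k, IsOpen (F k : Set V)) [IsTopologicalGroup V] (hanti : Antitone F)
    (hinter : ∀ z, (∀ k, z ∈ F k) → z = 1) {s : Set V} (hs : s ∈ nhds 1) :
    ∃ k, (F k : Set V) ⊆ s := by
  refine exists_subset_nhds_of_compactSpace (V := fun k => (F k : Set V))
    (hanti.directed_ge) (fun k => (F k).isClosed_of_isOpen (hopen k)) fun z hz => ?_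
  rw [hinter z fun k => Set.mem_iInter.1 hz k]
  exact hs

/-- A compact abelian group `V` with a filtration by open subgroups such that `V / F k` has order
`p ^ (n k)` and `z ^ p ∈ F (k + 1) ↔ z ∈ F k` is isomorphic to `ℤ_pⁿ`: the closure of the graph
of `m ↦ ∏ xᵢ ^ mᵢ`, the `xᵢ` lifting a basis of `V / F 1`, is the graph of an isomorphism. -/
theorem nonempty_continuousMulEquiv_padic [IsTopologicalGroup V] [CompactSpace V] [T2Space V]
    {n : ℕ} {F : ℕ → Subgroup V} (hopen : ∀ k, IsOpen (F k : Set V)) (h0 : F 0 = ⊤)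
    (hanti : Antitone F) (hidx : ∀ k, (F k).index = p ^ (n * k))
    (hpow : ∀ z k, z ^ p ∈ F (k + 1) ↔ z ∈ F k) (hinter : ∀ z, (∀ k, z ∈ F k) → z = 1) :
    Nonempty (V ≃ₜ* Multiplicative (Fin n → ℤ_[p])) := by
  obtain ⟨x, hx⟩ := exists_basis_modulo (p := p) (n := n) (F 1) (by rw [hidx, mul_one])
    fun z => (hpow z 0).2 (h0 ▸ Subgroup.mem_top z)
  have hx' := prod_zpow_mem_iff h0 hanti hpow hx
  let Γ := (zpowGraph p x).range.topologicalClosure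
  -- The relation `pᵏ ∣ a ↔ v ∈ F k` holds on the graph of `m ↦ ∏ xᵢ ^ mᵢ`, and it is closed.
  have hrel : ∀ z ∈ Γ, ∀ k, (∀ i, (p : ℤ_[p]) ^ k ∣ z.1.toAdd i) ↔ z.2 ∈ F k := by
    intro z hz k
    have hA : IsClopen {z : Multiplicative (Fin n → ℤ_[p]) × V |
        ∀ i, (p : ℤ_[p]) ^ k ∣ z.1.toAdd i} := by
      rw [Set.ofPred_forall]
      refine isClopen_iInter_of_finite fun i => ?_
      exact (padicPowSubgroup p k).isClopen.preimage (continuous_ofAdd.comp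
        ((continuous_apply i).comp (continuous_toAdd.comp continuous_fst)))
    have hB : IsClopen {z : Multiplicative (Fin n → ℤ_[p]) × V | z.2 ∈ F k} :=
      (OpenSubgroup.isClopen ⟨F k, hopen k⟩).preimage continuous_snd
    have hcl : IsClosed {z : Multiplicative (Fin n → ℤ_[p]) × V |
        (∀ i, (p : ℤ_[p]) ^ k ∣ z.1.toAdd i) ↔ z.2 ∈ F k} := by
      have h1 := (hA.inter hB).union (hA.compl.inter hB.compl)
      convert h1.isClosed using 1
      ext z
      simp only [Set.mem_ofPred_eq, Set.mem_union, Set.mem_inter_iff, Set.mem_compl_iff]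
      tauto
    refine (hcl.closure_subset_iff.2 ?_ hz :)
    rintro _ ⟨m, rfl⟩
    refine Iff.trans (forall_congr' fun i => ?_) (hx' k m.toAdd).symm
    change (p : ℤ_[p]) ^ k ∣ ((m.toAdd i : ℤ) : ℤ_[p]) ↔ _
    rw [← PadicInt.norm_int_le_pow_iff_dvd, PadicInt.norm_le_pow_iff_mem_span_pow,
      Ideal.mem_span_singleton]
  have hcompact : CompactSpace Γ :=
    isCompact_iff_compactSpace.1 (zpowGraph p x).range.isClosed_topologicalClosure.isCompact
  have hfst : Function.Bijective ((MonoidHom.fst _ V).comp Γ.subtype) := by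
    constructor
    · rw [injective_iff_map_eq_one]
      rintro ⟨⟨a, v⟩, hz⟩ h
      obtain rfl : a = 1 := h
      refine Subtype.ext (Prod.ext rfl (hinter _ fun k => ?_))
      exact (hrel _ hz k).1 fun i => dvd_zero _
    · have hcl : IsClosed (Set.range ((MonoidHom.fst _ V).comp Γ.subtype)) :=
        (isCompact_range (continuous_fst.comp continuous_subtype_val)).isClosed
      rw [← Set.range_eq_univ, ← hcl.closure_eq]
      have hd : DenseRange fun m : Fin n → ℤ =>
          (Multiplicative.ofAdd fun i => (m i : ℤ_[p]) : Multiplicative (Fin n → ℤ_[p])) :=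
        DenseRange.piMap fun _ => PadicInt.denseRange_intCast
      refine (hd.mono ?_ : Dense _).closure_eq
      rintro _ ⟨m, rfl⟩
      exact ⟨⟨_, Subgroup.le_topologicalClosure _ ⟨Multiplicative.ofAdd m, rfl⟩⟩, rfl⟩
  have hsnd : Function.Bijective ((MonoidHom.snd (Multiplicative (Fin n → ℤ_[p])) V).comp
      Γ.subtype) := by
    constructor
    · rw [injective_iff_map_eq_one]
      rintro ⟨⟨a, v⟩, hz⟩ h
      obtain rfl : v = 1 := h
      refine Subtype.ext (Prod.ext (Multiplicative.toAdd.injective (funext fun i => ?_)) rfl)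
      exact PadicInt.eq_zero_of_forall_pow_dvd p fun k => (hrel _ hz k).2 (one_mem _) i
    · have hcl : IsClosed (Set.range ((MonoidHom.snd (Multiplicative (Fin n → ℤ_[p])) V).comp
          Γ.subtype)) :=
        (isCompact_range (continuous_snd.comp continuous_subtype_val)).isClosed
      rw [← Set.range_eq_univ, ← hcl.closure_eq]
      refine Set.eq_univ_of_forall fun v => mem_closure_iff_nhds.2 fun s hs => ?_
      have hs' : (fun w => v * w) ⁻¹' s ∈ nhds 1 :=
        (continuous_const_mul v).continuousAt (by rwa [mul_one])
      obtain ⟨k, hk⟩ := eventually_of_iInter_eq_one hopen hanti hinter hs'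
      obtain ⟨m, hm⟩ := exists_prod_zpow_congr (hidx k) (hx' k) v
      refine ⟨_, ?_, ⟨_, Subgroup.le_topologicalClosure _ ⟨Multiplicative.ofAdd m, rfl⟩⟩, rfl⟩
      have := hk hm
      rwa [Set.mem_preimage, mul_inv_cancel_left] at this
  obtain ⟨e, -⟩ := exists_continuousMulEquiv_of_bijective _
    (continuous_fst.comp continuous_subtype_val) hfst
  obtain ⟨e', -⟩ := exists_continuousMulEquiv_of_bijective _
    (continuous_snd.comp continuous_subtype_val) hsnd
  exact ⟨e'.symm.trans e⟩

end PadicGroups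

/-! ### Principal units -/

section PrincipalUnits

variable (p : ℕ) {O : Type*} [CommRing O]

/-- The group of units congruent to `1` modulo `p ^ k`. -/
def principalUnits (O : Type*) [CommRing O] (k : ℕ) : Subgroup Oˣ :=
  (Units.map (Ideal.Quotient.mk (Ideal.span {(p : O) ^ k}) : O →* O ⧸ Ideal.span {(p : O) ^ k})).ker

variable {p}

theorem mem_principalUnits {k : ℕ} {u : Oˣ} : u ∈ principalUnits p O k ↔ (p : O) ^ k ∣ u.1 - 1 := by
  rw [principalUnits, MonoidHom.mem_ker, ← Units.val_eq_one, ← Ideal.mem_span_singleton,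
    ← Ideal.Quotient.eq, map_one]
  rfl

theorem principalUnits_antitone : Antitone (principalUnits p O) := fun _ _ h _ hu =>
  mem_principalUnits.2 ((pow_dvd_pow _ h).trans (mem_principalUnits.1 hu))

variable (hreg : ∀ x : O, (p : O) * x = 0 → x = 0) (hjac : ∀ x : O, IsUnit (1 + p * x))

include hreg in
theorem natCast_mul_left_cancel {x y : O} (k : ℕ) (h : (p : O) ^ k * x = (p : O) ^ k * y) :
    x = y := by
  induction k with
  | zero => simpa using h
  | succ k ih =>
    refine ih (sub_eq_zero.1 (hreg _ ?_))
    rw [pow_succ'] at h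
    linear_combination h

include hreg hjac in
/-- For a principal unit `z` modulo `p ^ 2`, the factor `1 + z + ⋯ + z ^ (p - 1)` of `z ^ p - 1` is
`p` times a unit. -/
theorem pow_mem_principalUnits_iff {z : Oˣ} (hz : z ∈ principalUnits p O 2) (k : ℕ) :
    z ^ p ∈ principalUnits p O (k + 1) ↔ z ∈ principalUnits p O k := by
  rw [mem_principalUnits] at hz
  have h1 : (p : O) ^ 2 ∣ ∑ i ∈ Finset.range p, (z.1 ^ i - 1) :=
    Finset.dvd_sum fun i _ => hz.trans (sub_one_dvd_pow_sub_one z.1 i)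
  obtain ⟨s, hs⟩ := h1
  have h2 : z.1 ^ p - 1 = p * ((z.1 - 1) * (1 + p * s)) := by
    rw [← geom_sum_mul z.1 p]
    rw [Finset.sum_sub_distrib, Finset.sum_const, Finset.card_range, nsmul_one] at hs
    linear_combination (z.1 - 1) * hs
  obtain ⟨w, hw⟩ := hjac s
  rw [mem_principalUnits, mem_principalUnits, Units.val_pow_eq_pow_val, h2, ← hw]
  constructor
  · rintro ⟨c, hc⟩
    rw [pow_succ', mul_assoc] at hc
    have h3 : (z.1 - 1) * w.1 = (p : O) ^ k * c :=
      natCast_mul_left_cancel hreg 1 (by simpa using hc)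
    exact (Units.dvd_mul_right).1 ⟨c, h3⟩
  · rintro h
    rw [pow_succ']
    exact mul_dvd_mul_left _ (h.mul_right _)

include hreg hjac in
/-- The map `1 + p ^ (k + 1) c ↦ c mod p` identifies the successive quotients with `O / p O`. -/
theorem relIndex_principalUnits (k : ℕ) : (principalUnits p O (k + 1 + 1)).relIndex
    (principalUnits p O (k + 1)) = Nat.card (O ⧸ Ideal.span {(p : O)}) := by
  choose c hc using fun u : principalUnits p O (k + 1) => mem_principalUnits.1 u.2
  have hval : ∀ u, u.1.1 = 1 + (p : O) ^ (k + 1) * c u := fun u => by rw [← hc]; ring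
  have key : ∀ u x, u.1.1 = 1 + (p : O) ^ (k + 1) * x → c u = x := fun u x h =>
    natCast_mul_left_cancel hreg (k + 1) (add_left_cancel ((hval u).symm.trans h))
  let f : principalUnits p O (k + 1) →* Multiplicative (O ⧸ Ideal.span {(p : O)}) :=
    { toFun := fun u => Multiplicative.ofAdd (Ideal.Quotient.mk _ (c u))
      map_one' := by
        rw [key 1 0 (by simp), map_zero]
        rfl
      map_mul' := fun u v => by
        rw [key (u * v) (c u + c v + p * (p ^ k * c u * c v)) (by
          change u.1.1 * v.1.1 = _
          rw [hval, hval]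
          ring), ← ofAdd_add, ← map_add, Multiplicative.ofAdd.injective.eq_iff, Ideal.Quotient.eq,
          add_sub_cancel_left]
        exact Ideal.mem_span_singleton.2 (dvd_mul_right _ _) }
  have hker : f.ker = (principalUnits p O (k + 1 + 1)).subgroupOf (principalUnits p O (k + 1)) := by
    ext u
    rw [MonoidHom.mem_ker, Subgroup.mem_subgroupOf, mem_principalUnits, hc, pow_succ _ (k + 1)]
    change Ideal.Quotient.mk _ (c u) = 0 ↔ _
    rw [Ideal.Quotient.eq_zero_iff_dvd]
    constructor
    · exact mul_dvd_mul_left _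
    · rintro ⟨d, hd⟩
      exact ⟨d, natCast_mul_left_cancel hreg (k + 1) (by rw [hd, mul_assoc])⟩
  have hsurj : Function.Surjective f := by
    intro y
    obtain ⟨x, hx⟩ := Ideal.Quotient.mk_surjective y.toAdd
    obtain ⟨w, hw⟩ := hjac (p ^ k * x)
    have hw' : w.1 = 1 + (p : O) ^ (k + 1) * x := by rw [hw]; ring
    refine ⟨⟨w, mem_principalUnits.2 ⟨x, by rw [hw', add_sub_cancel_left]⟩⟩, ?_⟩
    change Multiplicative.ofAdd (Ideal.Quotient.mk _ (c _)) = _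
    rw [key _ x hw', hx]
    rfl
  rw [Subgroup.relIndex, ← hker, Subgroup.index_ker, f.range_eq_top.2 hsurj,
    Nat.card_congr Subgroup.topEquiv.toEquiv]
  rfl

include hreg hjac in
theorem relIndex_principalUnits_two {n : ℕ} (hcard : Nat.card (O ⧸ Ideal.span {(p : O)}) = p ^ n)
    (k : ℕ) : (principalUnits p O (k + 2)).relIndex (principalUnits p O 2) = p ^ (n * k) := by
  induction k with
  | zero => rw [mul_zero, pow_zero, Subgroup.relIndex_self]
  | succ k ih =>
    rw [← Subgroup.relIndex_mul_relIndex (principalUnits p O (k + 1 + 2))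
      (principalUnits p O (k + 2)) (principalUnits p O 2)
      (principalUnits_antitone (by omega)) (principalUnits_antitone (by omega)), ih,
      show k + 1 + 2 = k + 1 + 1 + 1 from rfl, relIndex_principalUnits hreg hjac (k + 1), hcard,
      ← pow_add]
    congr 1
    ring

variable [TopologicalSpace O] [IsTopologicalRing O]

theorem isOpen_principalUnits (hopen : ∀ k, IsOpen (Ideal.span {(p : O) ^ k} : Set O)) (k : ℕ) :
    IsOpen (principalUnits p O k : Set Oˣ) := by
  have h : (principalUnits p O k : Set Oˣ) =
      (fun u : Oˣ => u.1 - 1) ⁻¹' (Ideal.span {(p : O) ^ k} : Set O) := by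
    ext u
    exact mem_principalUnits.trans Ideal.mem_span_singleton.symm
  rw [h]
  exact (hopen k).preimage (Units.continuous_val.sub continuous_const)

include hreg hjac in
/-- In a compact `p`-torsion free ring `O` with `p` topologically nilpotent, the group
`1 + p ^ 2 O` is isomorphic to `ℤ_pⁿ`, where `p ^ n` is the order of `O / p O`. -/
theorem nonempty_principalUnits_equiv [Fact p.Prime] [CompactSpace O] [T2Space O] {n : ℕ}
    (hcard : Nat.card (O ⧸ Ideal.span {(p : O)}) = p ^ n)
    (hopen : ∀ k, IsOpen (Ideal.span {(p : O) ^ k} : Set O))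
    (hsep : ∀ x : O, (∀ k, (p : O) ^ k ∣ x) → x = 0) :
    Nonempty (principalUnits p O 2 ≃ₜ* Multiplicative (Fin n → ℤ_[p])) := by
  have hc : CompactSpace (principalUnits p O 2) := isCompact_iff_compactSpace.1
    ((principalUnits p O 2).isClosed_of_isOpen (isOpen_principalUnits hopen 2)).isCompact
  refine nonempty_continuousMulEquiv_padic (p := p)
    (F := fun k => (principalUnits p O (k + 2)).subgroupOf (principalUnits p O 2))
    (fun k => (isOpen_principalUnits hopen _).preimage continuous_subtype_val)
    (Subgroup.subgroupOf_self _) (fun k l h z hz =>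
      principalUnits_antitone (Nat.add_le_add_right h 2) hz)
    (relIndex_principalUnits_two hreg hjac hcard)
    (fun z k => pow_mem_principalUnits_iff hreg hjac z.2 (k + 2)) fun z hz => ?_
  refine Subtype.ext (Units.ext (sub_eq_zero.1 (hsep _ fun k => ?_)))
  exact (pow_dvd_pow _ (Nat.le_add_right k 2)).trans (mem_principalUnits.1 (hz k))

end PrincipalUnits

/-! ### Submodules of `ℤ_pⁿ` -/

section PadicLattices

variable {p : ℕ} [Fact p.Prime]

/-- A closed subgroup of a topological `ℤ_p`-module is a submodule, as `ℤ` is dense in `ℤ_p`. -/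
theorem smul_mem_of_isClosed {E : Type*} [AddCommGroup E] [Module ℤ_[p] E] [TopologicalSpace E]
    [ContinuousSMul ℤ_[p] E] {M : AddSubgroup E} (hM : IsClosed (M : Set E)) (c : ℤ_[p]) {x : E}
    (hx : x ∈ M) : c • x ∈ M := by
  have hcl : IsClosed {c : ℤ_[p] | c • x ∈ M} :=
    hM.preimage (continuous_id.smul continuous_const)
  refine hcl.closure_subset_iff.2 ?_ (PadicInt.denseRange_intCast c)
  rintro _ ⟨m, rfl⟩
  change ((m : ℤ) : ℤ_[p]) • x ∈ M
  rw [Int.cast_smul_eq_zsmul]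
  exact zsmul_mem hx m

theorem finrank_le_of_smul_mem {R E : Type*} [CommRing R] [IsDomain R] [IsNoetherianRing R]
    [AddCommGroup E] [Module R E] [Module.IsTorsionFree R E] [Module.Finite R E]
    {M M' : Submodule R E} {m : R} (hm : m ≠ 0) (h : ∀ x ∈ M', m • x ∈ M) :
    Module.finrank R M' ≤ Module.finrank R M := by
  let f : M' →ₗ[R] M :=
    ((LinearMap.lsmul R E m).comp M'.subtype).codRestrict M fun x => h x x.2
  refine LinearMap.finrank_le_finrank_of_injective (f := f) fun x y hxy => ?_
  exact Subtype.ext (smul_right_injective E hm (congrArg Subtype.val hxy))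

theorem isOpen_of_smul_mem {n : ℕ} {M : Submodule ℤ_[p] (Fin n → ℤ_[p])} {c : ℤ_[p]}
    (hc : c ≠ 0) (h : ∀ x, c • x ∈ M) : IsOpen (M : Set (Fin n → ℤ_[p])) := by
  have hset : IsOpen {x : Fin n → ℤ_[p] | ∀ i, (p : ℤ_[p]) ^ c.valuation ∣ x i} := by
    rw [Set.ofPred_forall]
    refine isOpen_iInter_of_finite fun i => ?_
    have hcont : Continuous fun x : Fin n → ℤ_[p] => Multiplicative.ofAdd (x i) :=
      continuous_ofAdd.comp (continuous_apply i)
    exact hcont.isOpen_preimage _ (padicPowSubgroup p c.valuation).isOpen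
  refine AddSubgroup.isOpen_of_mem_nhds M.toAddSubgroup (g := 0)
    (Filter.mem_of_superset (hset.mem_nhds fun i => dvd_zero _) fun x hx => ?_)
  choose y hy using hx
  have h1 := PadicInt.unitCoeff_spec hc
  have h2 : x = c • (((PadicInt.unitCoeff hc)⁻¹ : ℤ_[p]ˣ) : ℤ_[p]) • y := by
    funext i
    rw [hy i, Pi.smul_apply, Pi.smul_apply, smul_eq_mul, smul_eq_mul]
    nth_rw 2 [h1]
    rw [mul_assoc, mul_left_comm _ _ (y i), ← mul_assoc, Units.mul_inv, one_mul]
  rw [h2]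
  exact h _

/-- A submodule of rank `r` of `ℤ_pⁿ` has a complement of rank `n - r` up to an open subgroup. -/
theorem exists_almost_complement {n : ℕ} (M : Submodule ℤ_[p] (Fin n → ℤ_[p])) :
    ∃ l : (Fin (n - Module.finrank ℤ_[p] M) → ℤ_[p]) →ₗ[ℤ_[p]] (Fin n → ℤ_[p]),
      (∀ a, l a ∈ M → a = 0) ∧
        IsOpen ((LinearMap.range l ⊔ M : Submodule ℤ_[p] (Fin n → ℤ_[p])) :
          Set (Fin n → ℤ_[p])) := by
  have hq : Module.finrank ℤ_[p] ((Fin n → ℤ_[p]) ⧸ M) = n - Module.finrank ℤ_[p] M := by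
    have h := M.finrank_quotient_add_finrank
    rw [Module.finrank_fin_fun] at h
    omega
  obtain ⟨w, hw⟩ := exists_linearIndependent_of_le_finrank hq.ge
  choose y hy using fun i => M.mkQ_surjective (w i)
  let l := Fintype.linearCombination ℤ_[p] y
  have hl : ∀ a, M.mkQ (l a) = ∑ i, a i • w i := fun a => by
    simp only [l, Fintype.linearCombination_apply, map_sum, map_smul, hy]
  refine ⟨l, fun a ha => ?_, ?_⟩
  · have h1 : ∑ i, a i • w i = 0 := by
      rw [← hl]
      exact (Submodule.Quotient.mk_eq_zero M).2 ha
    exact funext fun i => Fintype.linearIndependent_iff.1 hw a h1 i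
  · have hrank : Module.finrank ℤ_[p]
        (((Fin n → ℤ_[p]) ⧸ M) ⧸ Submodule.span ℤ_[p] (Set.range w)) = 0 := by
      have h := (Submodule.span ℤ_[p] (Set.range w)).finrank_quotient_add_finrank
      rw [finrank_span_eq_card hw, Fintype.card_fin] at h
      omega
    have hex : ∀ x : Fin n → ℤ_[p], ∃ a : ℤ_[p], a ≠ 0 ∧ a • x ∈ LinearMap.range l ⊔ M := by
      intro x
      obtain ⟨a, ha, hax⟩ := Module.finrank_eq_zero_iff.1 hrank (Submodule.Quotient.mk (M.mkQ x))
      refine ⟨a, ha, ?_⟩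
      rw [← Submodule.Quotient.mk_smul, Submodule.Quotient.mk_eq_zero, ← map_smul,
        ← Fintype.range_linearCombination] at hax
      obtain ⟨b, hb⟩ := hax
      have h1 : M.mkQ (a • x - l b) = 0 := by
        rw [map_sub, ← hb, hl, Fintype.linearCombination_apply, sub_self]
      have h2 := (Submodule.Quotient.mk_eq_zero M).1 h1
      rw [← sub_add_cancel (a • x) (l b)]
      exact add_mem (Submodule.mem_sup_right h2) (Submodule.mem_sup_left ⟨b, rfl⟩)
    choose a ha hax using fun i : Fin n => hex (Pi.single i 1)
    refine isOpen_of_smul_mem (c := ∏ i, a i) (Finset.prod_ne_zero_iff.2 fun i _ => ha i)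
      fun x => ?_
    rw [pi_eq_sum_univ' x, Finset.smul_sum]
    refine Submodule.sum_mem _ fun i _ => ?_
    rw [← Finset.mul_prod_erase Finset.univ a (Finset.mem_univ i), mul_comm, mul_smul,
      smul_comm (a i)]
    refine Submodule.smul_mem _ _ (Submodule.smul_mem _ _ ?_)
    exact hax i

end PadicLattices

/-! ### The dimension of a `p`-adic analytic group -/

section PadicDimension

variable {p : ℕ} [Fact p.Prime]

/-- If `z ↦ z ^ q` is injective on `N`, the index of the subgroup of `q`-th powers does not change
on passing from `N` to a subgroup of finite index. -/
theorem relIndex_map_pow_eq {G : Type*} [CommGroup G] (q : ℕ) {N N' : Subgroup G} (h : N' ≤ N)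
    (hfin : N'.relIndex N ≠ 0) (hinj : ∀ z ∈ N, z ^ q = 1 → z = 1) :
    (N'.map (powMonoidHom q)).relIndex N' = (N.map (powMonoidHom q)).relIndex N := by
  have hle : ∀ M : Subgroup G, M.map (powMonoidHom q) ≤ M := by
    rintro M _ ⟨z, hz, rfl⟩
    exact pow_mem hz q
  have h1 := Subgroup.relIndex_mul_relIndex _ _ _ (hle N') h
  have h2 := Subgroup.relIndex_mul_relIndex _ _ _ (Subgroup.map_mono (f := powMonoidHom q) h)
    (hle N)
  have h3 : (N'.map (powMonoidHom q)).relIndex (N.map (powMonoidHom q)) = N'.relIndex N := by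
    rw [Subgroup.relIndex, Subgroup.relIndex, ← Subgroup.index_comap_of_surjective _
      ((powMonoidHom q).subgroupMap_surjective N)]
    congr 1
    ext z
    constructor
    · rintro ⟨w, hw, hwz⟩
      have h4 : z.1 * w⁻¹ = 1 := hinj _ (mul_mem z.2 (inv_mem (h hw))) (by
        rw [mul_pow, inv_pow, mul_inv_eq_one]
        exact hwz.symm)
      rw [Subgroup.mem_subgroupOf, mul_inv_eq_one.1 h4]
      exact hw
    · exact fun hz => ⟨z.1, hz, rfl⟩
  rw [h3, mul_comm, ← h1, mul_comm] at h2
  exact mul_right_cancel₀ hfin (by linarith)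

/-- The subgroup of `p`-th powers of a group isomorphic to `ℤ_p^r` has index `p ^ r`. -/
theorem relIndex_map_pow_of_equiv {G : Type*} [CommGroup G] {N : Subgroup G} {r : ℕ}
    (e : N ≃* Multiplicative (Fin r → ℤ_[p])) :
    (N.map (powMonoidHom p)).relIndex N = p ^ r ∧ ∀ z ∈ N, z ^ p = 1 → z = 1 := by
  constructor
  · let f : N →* Multiplicative (Fin r → ZMod p) :=
      (AddMonoidHom.toMultiplicative
        ((PadicInt.toZMod (p := p)).toAddMonoidHom.compLeft (Fin r))).comp e.toMonoidHom
    have hf : Function.Surjective f := by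
      intro y
      choose a ha using fun i => ZMod.ringHom_surjective (PadicInt.toZMod (p := p)) (y.toAdd i)
      refine ⟨e.symm (Multiplicative.ofAdd a), ?_⟩
      change Multiplicative.ofAdd (fun i =>
        PadicInt.toZMod ((e (e.symm (Multiplicative.ofAdd a))).toAdd i)) = y
      rw [e.apply_symm_apply]
      exact congrArg Multiplicative.ofAdd (funext ha)
    have hker : f.ker = (N.map (powMonoidHom p)).subgroupOf N := by
      ext z
      have h1 : z ∈ f.ker ↔ ∀ i, (p : ℤ_[p]) ∣ (e z).toAdd i := by
        rw [MonoidHom.mem_ker]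
        have h2 : f z = 1 ↔ ∀ i, PadicInt.toZMod ((e z).toAdd i) = 0 :=
          ⟨fun h i => congrFun (congrArg Multiplicative.toAdd h) i,
            fun h => Multiplicative.toAdd.injective (funext h)⟩
        rw [h2]
        refine forall_congr' fun i => ?_
        rw [← RingHom.mem_ker, PadicInt.ker_toZMod, PadicInt.maximalIdeal_eq_span_p,
          Ideal.mem_span_singleton]
      rw [h1]
      constructor
      · intro h
        choose y hy using h
        refine ⟨(e.symm (Multiplicative.ofAdd y)).1, (e.symm (Multiplicative.ofAdd y)).2, ?_⟩
        change ((e.symm (Multiplicative.ofAdd y)) ^ p : N).1 = z.1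
        rw [← map_pow, ← ofAdd_nsmul]
        refine congrArg Subtype.val (e.injective ?_)
        rw [e.apply_symm_apply]
        refine Multiplicative.toAdd.injective (funext fun i => ?_)
        rw [hy]
        exact nsmul_eq_mul _ _
      · rintro ⟨w, hw, hwz⟩ i
        have h3 : z = (⟨w, hw⟩ : N) ^ p := Subtype.ext hwz.symm
        rw [h3, map_pow, toAdd_pow]
        exact ⟨(e ⟨w, hw⟩).toAdd i, nsmul_eq_mul _ _⟩
    rw [Subgroup.relIndex, ← hker, Subgroup.index_ker, f.range_eq_top.2 hf,
      Nat.card_congr Subgroup.topEquiv.toEquiv, Nat.card_congr Multiplicative.toAdd, Nat.card_fun,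
      Nat.card_zmod, Nat.card_fin]
  · intro z hz h
    have h1 : e ⟨z, hz⟩ = 1 := by
      refine Multiplicative.toAdd.injective (funext fun i => ?_)
      have h2 : (⟨z, hz⟩ : N) ^ p = 1 := Subtype.ext h
      have h3 := congrArg (fun y => (e y).toAdd i) h2
      simp only [map_pow, toAdd_pow, map_one] at h3
      have h4 : (p : ℤ_[p]) * (e ⟨z, hz⟩).toAdd i = 0 := (nsmul_eq_mul _ _).symm.trans h3
      exact (mul_eq_zero.1 h4).resolve_left (Nat.cast_ne_zero.2 (Fact.out : p.Prime).ne_zero)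
    exact congrArg Subtype.val ((map_eq_one_iff e e.injective).1 h1)

/-- The dimension of a compact `p`-adic analytic abelian group is well defined. -/
theorem padicAnalyticDim_eq {G : Type*} [CommGroup G] [TopologicalSpace G] [IsTopologicalGroup G]
    [CompactSpace G] {r : ℕ} (N : OpenSubgroup G)
    (e : (N : Subgroup G) ≃ₜ* Multiplicative (Fin r → ℤ_[p])) : padicAnalyticDim p G = r := by
  -- Two charts have a common open subgroup; the index of its `p`-th powers is both `p ^ r` and
  -- `p ^ s`.
  have key : {s : ℕ | ∃ N : OpenSubgroup G,
      Nonempty ((N : Subgroup G) ≃ₜ* Multiplicative (Fin s → ℤ_[p]))} = {r} := by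
    refine Set.eq_singleton_iff_unique_mem.2 ⟨⟨N, ⟨e⟩⟩, ?_⟩
    rintro s ⟨N', ⟨e'⟩⟩
    have hfin : ∀ M L : OpenSubgroup G,
        ((M : Subgroup G) ⊓ (L : Subgroup G)).relIndex (L : Subgroup G) ≠ 0 := fun M L => by
      have : Finite (G ⧸ ((M : Subgroup G) ⊓ (L : Subgroup G))) :=
        Subgroup.quotient_finite_of_isOpen _ (M.isOpen.inter L.isOpen)
      have h1 : ((M : Subgroup G) ⊓ (L : Subgroup G)).index ≠ 0 := Subgroup.index_ne_zero_of_finite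
      rw [← Subgroup.relIndex_mul_index inf_le_right] at h1
      exact left_ne_zero_of_mul h1
    obtain ⟨h1, h1'⟩ := relIndex_map_pow_of_equiv (p := p) e.toMulEquiv
    obtain ⟨h2, h2'⟩ := relIndex_map_pow_of_equiv (p := p) e'.toMulEquiv
    have h3 := relIndex_map_pow_eq p inf_le_right (hfin N' N) h1'
    have h4 := relIndex_map_pow_eq p inf_le_right (hfin N N') h2'
    rw [inf_comm] at h4
    rw [h1] at h3
    rw [h2, h3] at h4
    exact (Nat.pow_right_injective (Fact.out : p.Prime).two_le h4).symm
  rw [padicAnalyticDim, key, csInf_singleton]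

end PadicDimension

/-! ### Ranks of closed subgroups -/

section ClosedSubgroups

variable {p : ℕ} [Fact p.Prime] {n : ℕ} {A : Type*} [CommGroup A] [TopologicalSpace A]
  {V : OpenSubgroup A} (e : (V : Subgroup A) ≃ₜ* Multiplicative (Fin n → ℤ_[p]))

/-- The part of a closed subgroup `C` lying in a chart `V ≃ ℤ_pⁿ`, as a `ℤ_p`-submodule. -/
def chartLattice (C : Subgroup A) (hC : IsClosed (C : Set A)) :
    Submodule ℤ_[p] (Fin n → ℤ_[p]) :=
  let M : AddSubgroup (Fin n → ℤ_[p]) :=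
    { carrier := {x | (e.symm (Multiplicative.ofAdd x) : A) ∈ C}
      add_mem' := fun {x y} hx hy => by
        change (e.symm (Multiplicative.ofAdd (x + y)) : A) ∈ C
        rw [ofAdd_add, map_mul]
        exact mul_mem hx hy
      zero_mem' := by
        change (e.symm (Multiplicative.ofAdd 0) : A) ∈ C
        rw [ofAdd_zero, map_one]
        exact one_mem C
      neg_mem' := fun {x} hx => by
        change (e.symm (Multiplicative.ofAdd (-x)) : A) ∈ C
        rw [ofAdd_neg, map_inv]
        exact inv_mem (show (e.symm (Multiplicative.ofAdd x) : A) ∈ C from hx) }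
  { M with
    smul_mem' := fun c x hx => smul_mem_of_isClosed (M := M) (hC.preimage
      (continuous_subtype_val.comp (e.symm.continuous_toFun.comp continuous_ofAdd))) c hx }

theorem mem_chartLattice {C : Subgroup A} {hC : IsClosed (C : Set A)} {x : Fin n → ℤ_[p]} :
    x ∈ chartLattice e C hC ↔ (e.symm (Multiplicative.ofAdd x) : A) ∈ C := Iff.rfl

/-- The rank of a closed subgroup, computed in a chart. -/
def chartRank (C : Subgroup A) (hC : IsClosed (C : Set A)) : ℕ :=
  Module.finrank ℤ_[p] (chartLattice e C hC)

theorem continuous_chart_linear {r : ℕ} (l : (Fin r → ℤ_[p]) →ₗ[ℤ_[p]] (Fin n → ℤ_[p])) :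
    Continuous fun a : Multiplicative (Fin r → ℤ_[p]) =>
      (e.symm (Multiplicative.ofAdd (l a.toAdd)) : A) :=
  continuous_subtype_val.comp (e.symm.continuous_toFun.comp
    (continuous_ofAdd.comp (l.continuous_on_pi.comp continuous_toAdd)))

/-- The homomorphism `ℤ_p^r → A` given in a chart by a linear map. -/
def chartHom {r : ℕ} (l : (Fin r → ℤ_[p]) →ₗ[ℤ_[p]] (Fin n → ℤ_[p])) :
    Multiplicative (Fin r → ℤ_[p]) →* A where
  toFun a := (e.symm (Multiplicative.ofAdd (l a.toAdd)) : A)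
  map_one' := by
    change (e.symm (Multiplicative.ofAdd (l 0)) : A) = 1
    rw [map_zero, ofAdd_zero, map_one]
    rfl
  map_mul' a b := by
    change (e.symm (Multiplicative.ofAdd (l (a.toAdd + b.toAdd))) : A) = _
    rw [map_add, ofAdd_add, map_mul]
    rfl

/-- A basis of the lattice of `C` in a chart gives an isomorphism of `ℤ_p^r` with the open subgroup
`C ∩ V` of `C`. -/
theorem padicAnalyticDim_eq_chartRank [IsTopologicalGroup A] [CompactSpace A] [T2Space A]
    (C : Subgroup A) (hC : IsClosed (C : Set A)) :
    padicAnalyticDim p C = chartRank e C hC := by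
  have : CompactSpace C := isCompact_iff_compactSpace.1 hC.isCompact
  let b := Module.finBasisOfFinrankEq ℤ_[p] (chartLattice e C hC) (n := chartRank e C hC) rfl
  let l := (chartLattice e C hC).subtype.comp b.equivFun.symm.toLinearMap
  have hl : Function.Injective l := Subtype.val_injective.comp b.equivFun.symm.injective
  have hlC : ∀ a, chartHom e l a ∈ C := fun a =>
    (mem_chartLattice e).1 (b.equivFun.symm a.toAdd).2
  let N : OpenSubgroup C := V.comap C.subtype continuous_subtype_val
  let f : Multiplicative (Fin (chartRank e C hC) → ℤ_[p]) →* (N : Subgroup C) :=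
    ((chartHom e l).codRestrict C hlC).codRestrict (N : Subgroup C) fun a =>
      (e.symm (Multiplicative.ofAdd (l a.toAdd))).2
  have hf : Continuous f :=
    ((continuous_chart_linear e l).subtype_mk hlC).subtype_mk _
  have hbij : Function.Bijective f := by
    constructor
    · intro a a' h
      have h1 : chartHom e l a = chartHom e l a' :=
        congrArg (fun z : (N : Subgroup C) => (z.1 : A)) h
      exact hl (e.symm.injective (Subtype.ext h1))
    · rintro ⟨⟨c, hc⟩, hcV⟩
      have hcV' : c ∈ (V : Subgroup A) := hcV
      have hx : (e ⟨c, hcV'⟩).toAdd ∈ chartLattice e C hC := by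
        rw [mem_chartLattice, ofAdd_toAdd, e.symm_apply_apply]
        exact hc
      refine ⟨Multiplicative.ofAdd (b.equivFun ⟨_, hx⟩), Subtype.ext (Subtype.ext ?_)⟩
      change (e.symm (Multiplicative.ofAdd
        ((b.equivFun.symm (b.equivFun ⟨_, hx⟩) : chartLattice e C hC) : Fin n → ℤ_[p])) : A) = c
      rw [LinearEquiv.symm_apply_apply, ofAdd_toAdd, e.symm_apply_apply]
  obtain ⟨e', -⟩ := exists_continuousMulEquiv_of_bijective f hf hbij
  exact padicAnalyticDim_eq N e'.symm

theorem chartRank_mono {C C' : Subgroup A} {hC : IsClosed (C : Set A)}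
    {hC' : IsClosed (C' : Set A)} (h : C ≤ C') : chartRank e C hC ≤ chartRank e C' hC' :=
  finrank_le_of_smul_mem (m := (1 : ℤ_[p])) one_ne_zero fun x hx => by
    rw [one_smul]
    exact h hx

theorem smul_mem_chartLattice {C C' : Subgroup A} {hC : IsClosed (C : Set A)}
    {hC' : IsClosed (C' : Set A)} {m : ℕ} (h : ∀ z ∈ C', z ^ m ∈ C) {x : Fin n → ℤ_[p]}
    (hx : x ∈ chartLattice e C' hC') : (m : ℤ_[p]) • x ∈ chartLattice e C hC := by
  have h1 := h _ hx
  rw [mem_chartLattice, Nat.cast_smul_eq_nsmul, ofAdd_nsmul, map_pow]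
  exact h1

/-- The rank does not change on passing to a subgroup containing the `m`-th powers. -/
theorem chartRank_eq_of_pow_mem {C C' : Subgroup A} {hC : IsClosed (C : Set A)}
    {hC' : IsClosed (C' : Set A)} (hle : C ≤ C') {m : ℕ} (hm : m ≠ 0)
    (h : ∀ z ∈ C', z ^ m ∈ C) : chartRank e C hC = chartRank e C' hC' :=
  (chartRank_mono e hle).antisymm (finrank_le_of_smul_mem (m := (m : ℤ_[p]))
    (Nat.cast_ne_zero.2 hm) fun _ hx => smul_mem_chartLattice e h hx)

/-- If, up to a bounded power, the elements of `Γ` are products of powers of `R` elements, then the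
closure of the image of `Γ` has rank at most `R`. -/
theorem chartRank_closure_range_le [IsTopologicalGroup A] [CompactSpace A] {Γ : Type*}
    [CommGroup Γ] (f : Γ →* A) {R : ℕ} (ε : Fin R → Γ) {t : ℕ} (ht : t ≠ 0)
    (hε : ∀ γ : Γ, ∃ a : Fin R → ℤ, γ ^ t = ∏ i, ε i ^ a i) :
    chartRank e f.range.topologicalClosure f.range.isClosed_topologicalClosure ≤ R := by
  have hfin : Finite (A ⧸ (V : Subgroup A)) := Subgroup.quotient_finite_of_isOpen _ V.isOpen
  have hm : (V : Subgroup A).index ≠ 0 := Subgroup.index_ne_zero_of_finite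
  set m := (V : Subgroup A).index with hmdef
  -- The `m`-th power map carries `A` into `V`, which gives a homomorphism from all of `A`
  -- to `ℤ_pⁿ`.
  let h : A →* Multiplicative (Fin n → ℤ_[p]) := e.toMonoidHom.comp
    ((powMonoidHom m).codRestrict (V : Subgroup A) fun a => (V : Subgroup A).pow_index_mem a)
  have hcont : Continuous h := e.continuous_toFun.comp ((continuous_pow m).subtype_mk _)
  let S := Submodule.span ℤ_[p] (Set.range fun i => (h (f (ε i))).toAdd)
  have hSclosed : IsClosed (S : Set (Fin n → ℤ_[p])) := by
    have h1 : (S : Set (Fin n → ℤ_[p])) =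
        Set.range (Fintype.linearCombination ℤ_[p] fun i => (h (f (ε i))).toAdd) := by
      rw [← LinearMap.coe_range, Fintype.range_linearCombination]
    rw [h1]
    exact (isCompact_range (LinearMap.continuous_on_pi _)).isClosed
  have hclo : ∀ a ∈ f.range.topologicalClosure, t • (h a).toAdd ∈ S := by
    intro a ha
    have hcl : IsClosed {a : A | t • (h a).toAdd ∈ S} :=
      hSclosed.preimage ((continuous_toAdd.comp hcont).const_smul t)
    refine hcl.closure_subset_iff.2 ?_ ha
    rintro _ ⟨γ, rfl⟩
    obtain ⟨c, hc⟩ := hε γ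
    change t • (h (f γ)).toAdd ∈ S
    rw [← toAdd_pow, ← map_pow, ← map_pow, hc, map_prod, map_prod, toAdd_prod]
    refine Submodule.sum_mem _ fun i _ => ?_
    rw [map_zpow, map_zpow, toAdd_zpow]
    exact S.toAddSubgroup.zsmul_mem (Submodule.subset_span (Set.mem_range_self i)) _
  have hle : chartRank e f.range.topologicalClosure f.range.isClosed_topologicalClosure ≤
      Module.finrank ℤ_[p] S := by
    refine finrank_le_of_smul_mem (m := ((t * m : ℕ) : ℤ_[p]))
      (Nat.cast_ne_zero.2 (mul_ne_zero ht hm)) fun x hx => ?_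
    have h1 := hclo _ hx
    have h2 : (h (e.symm (Multiplicative.ofAdd x) : A)) = Multiplicative.ofAdd (m • x) := by
      have h3 : (powMonoidHom m).codRestrict (V : Subgroup A)
          (fun a => (V : Subgroup A).pow_index_mem a) (e.symm (Multiplicative.ofAdd x) : A) =
          (e.symm (Multiplicative.ofAdd x)) ^ m := rfl
      change e _ = _
      rw [h3, map_pow, e.apply_symm_apply, ofAdd_nsmul]
    rwa [h2, toAdd_ofAdd, smul_smul, ← Nat.cast_smul_eq_nsmul ℤ_[p]] at h1
  exact hle.trans ((finrank_range_le_card _).trans (Fintype.card_fin R).le)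

/-- The quotient of an `n`-dimensional compact group by a closed subgroup of rank `r` contains
`ℤ_p^{n - r}` with finite index. -/
theorem exists_padic_to_quotient [IsTopologicalGroup A] [CompactSpace A] (C : Subgroup A)
    (hC : IsClosed (C : Set A)) :
    ∃ g : Multiplicative (Fin (n - chartRank e C hC) → ℤ_[p]) →* A ⧸ C,
      Continuous g ∧ Function.Injective g ∧ g.range.index ≠ 0 := by
  obtain ⟨l, hl, hopen⟩ := exists_almost_complement (chartLattice e C hC)
  refine ⟨(QuotientGroup.mk' C).comp (chartHom e l),
    QuotientGroup.continuous_mk.comp (continuous_chart_linear e l), ?_, ?_⟩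
  · rw [injective_iff_map_eq_one]
    intro a ha
    exact hl _ ((mem_chartLattice e).2 ((QuotientGroup.eq_one_iff _).1 ha))
  · rw [← Subgroup.index_comap_of_surjective _ (QuotientGroup.mk'_surjective C)]
    let D := ((QuotientGroup.mk' C).comp (chartHom e l)).range.comap (QuotientGroup.mk' C)
    have hDopen : IsOpen (D : Set A) := by
      have h1 : IsOpen ((fun a : (V : Subgroup A) => (a : A)) '' ((fun a => (e a).toAdd) ⁻¹'
          ((LinearMap.range l ⊔ chartLattice e C hC : Submodule ℤ_[p] (Fin n → ℤ_[p])) :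
            Set (Fin n → ℤ_[p])))) :=
        V.isOpen.isOpenMap_subtype_val _
          (hopen.preimage (continuous_toAdd.comp e.continuous_toFun))
      refine Subgroup.isOpen_of_mem_nhds D (g := 1) (Filter.mem_of_superset (h1.mem_nhds ?_) ?_)
      · refine ⟨1, ?_, rfl⟩
        rw [Set.mem_preimage, map_one]
        exact zero_mem _
      · rintro _ ⟨a, ha, rfl⟩
        obtain ⟨_, ⟨b, rfl⟩, y, hy, hby⟩ := Submodule.mem_sup.1 ha
        refine ⟨Multiplicative.ofAdd b, ?_⟩
        have h2 : (a : A) = chartHom e l (Multiplicative.ofAdd b) *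
            (e.symm (Multiplicative.ofAdd y) : A) := by
          change (a : A) = ((e.symm (Multiplicative.ofAdd (l b)) *
            e.symm (Multiplicative.ofAdd y) : (V : Subgroup A)) : A)
          rw [← map_mul, ← ofAdd_add, hby, ofAdd_toAdd, e.symm_apply_apply]
        change _ = QuotientGroup.mk' C (a : A)
        rw [h2, map_mul, MonoidHom.comp_apply, eq_comm]
        have h3 : QuotientGroup.mk' C (e.symm (Multiplicative.ofAdd y) : A) = 1 :=
          (QuotientGroup.eq_one_iff _).2 hy
        rw [h3, mul_one]
    have : Finite (A ⧸ D) := Subgroup.quotient_finite_of_isOpen _ hDopen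
    exact (Subgroup.index_ne_zero_of_finite : D.index ≠ 0)

/-- A continuous injective homomorphism from a compact group to a Hausdorff group is a closed
embedding; if its image has finite index, the image is open as well. -/
theorem isOpenMap_of_finite_index {G G' : Type*} [Group G] [TopologicalSpace G] [CompactSpace G]
    [Group G'] [TopologicalSpace G'] [IsTopologicalGroup G'] [T2Space G'] (f : G →* G')
    (hf : Continuous f) (hinj : Function.Injective f) (hidx : f.range.index ≠ 0) :
    IsOpenMap f := by
  have hcl := hf.isClosedEmbedding hinj
  have : f.range.FiniteIndex := ⟨hidx⟩
  have hopen : IsOpen (Set.range f) :=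
    f.range.isOpen_of_isClosed_of_finiteIndex hcl.isClosed_range
  exact (Topology.IsOpenEmbedding.mk hcl.isEmbedding hopen).isOpenMap

end ClosedSubgroups

/-! ### The rings of local integers -/

section LocalIntegers

variable {K : Type*} [Field K] [NumberField K] (v : HeightOneSpectrum (𝓞 K))

theorem adicCompletionIntegers_dvd_iff {x y : v.adicCompletionIntegers K} :
    x ∣ y ↔ Valued.v y.1 ≤ Valued.v x.1 :=
  (HeightOneSpectrum.adicCompletionIntegers.integers K v).dvd_iff_le

theorem isOpen_setOf_valued_sub_le (x : v.adicCompletion K) {c : v.adicCompletion K} (hc : c ≠ 0) :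
    IsOpen {y : v.adicCompletion K | Valued.v (y - x) ≤ Valued.v c} := by
  have h1 : (Valued.v : Valuation (v.adicCompletion K) _).restrict c ≠ 0 := by simpa using hc
  have h2 := (Valued.isOpen_closedBall (v.adicCompletion K) h1).preimage
    (continuous_id.sub (continuous_const (y := x)))
  convert h2 using 1
  ext y
  exact ((Valued.v : Valuation (v.adicCompletion K) _).restrict_le_iff).symm

theorem isOpen_setOf_dvd {c : v.adicCompletionIntegers K} (hc : c ≠ 0) :
    IsOpen {x : v.adicCompletionIntegers K | c ∣ x} := by
  have h := (isOpen_setOf_valued_sub_le v 0 (c := c.1) (by simpa using hc)).preimage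
    (continuous_subtype_val (p := (· ∈ v.adicCompletionIntegers K)))
  convert h using 1
  ext x
  rw [Set.mem_preimage, Set.mem_ofPred_eq, Set.mem_ofPred_eq, sub_zero,
    adicCompletionIntegers_dvd_iff]

/-- The global integers are dense in the local integers. -/
theorem exists_dvd_algebraMap_sub (x : v.adicCompletionIntegers K) {c : v.adicCompletionIntegers K}
    (hc : c ≠ 0) : ∃ a : 𝓞 K, c ∣ algebraMap (𝓞 K) (v.adicCompletionIntegers K) a - x := by
  have hc' : c.1 ≠ 0 := by simpa using hc
  have hopen := isOpen_setOf_valued_sub_le v x.1 hc'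
  obtain ⟨k, hk⟩ := (v.denseRange_algebraMap (K := K)).exists_mem_open hopen
    ⟨x.1, by simp⟩
  rw [HeightOneSpectrum.algebraMap_adicCompletion] at hk
  have hk' : Valued.v ((k : v.adicCompletion K) - x.1) ≤ Valued.v c.1 := hk
  have hk1 : v.valuation K k ≤ 1 := by
    rw [← HeightOneSpectrum.valuedAdicCompletion_eq_valuation', ← sub_add_cancel
      (k : v.adicCompletion K) x.1]
    exact (Valuation.map_add _ _ _).trans (max_le (hk'.trans c.2) x.2)
  have hγ : Valued.v c.1 ≠ 0 := (Valuation.ne_zero_iff _).2 hc'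
  obtain ⟨a, ha⟩ := v.exists_valuation_sub_lt_of_integer hk1 (Units.mk0 _ hγ)
  refine ⟨a, ?_⟩
  rw [adicCompletionIntegers_dvd_iff]
  change Valued.v (((algebraMap (𝓞 K) K a : K) : v.adicCompletion K) - x.1) ≤ _
  have h1 : ((algebraMap (𝓞 K) K a : K) : v.adicCompletion K) - x.1 =
      ((algebraMap (𝓞 K) K a - k : K) : v.adicCompletion K) + ((k : v.adicCompletion K) - x.1) := by
    have h2 := HeightOneSpectrum.adicCompletion.coe_add K v (algebraMap (𝓞 K) K a - k) k
    rw [sub_add_cancel] at h2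
    rw [h2]
    ring
  rw [h1]
  refine (Valuation.map_add _ _ _).trans (max_le ?_ hk')
  rw [HeightOneSpectrum.valuedAdicCompletion_eq_valuation']
  exact ha.le

instance : Finite (IsLocalRing.ResidueField (v.adicCompletionIntegers K)) := by
  have hfin : Finite (𝓞 K ⧸ v.asIdeal) := v.asIdeal.finiteQuotientOfFreeOfNeBot v.ne_bot
  let f : 𝓞 K →+* IsLocalRing.ResidueField (v.adicCompletionIntegers K) :=
    (IsLocalRing.residue _).comp (algebraMap (𝓞 K) (v.adicCompletionIntegers K))
  have hf : ∀ a ∈ v.asIdeal, f a = 0 := by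
    intro a ha
    rw [RingHom.comp_apply, IsLocalRing.residue_eq_zero_iff, IsLocalRing.mem_maximalIdeal,
      mem_nonunits_iff, HeightOneSpectrum.adicCompletionIntegers.isUnit_iff_valued_eq_one]
    refine ne_of_lt ?_
    rw [HeightOneSpectrum.algebraMap_adicCompletionIntegers_apply,
      HeightOneSpectrum.valuedAdicCompletion_eq_valuation']
    exact (v.valuation_lt_one_iff_mem a).2 ha
  obtain ⟨ϖ, hϖ⟩ := IsDiscreteValuationRing.exists_irreducible (v.adicCompletionIntegers K)
  refine Finite.of_surjective (Ideal.Quotient.lift v.asIdeal f hf) fun y => ?_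
  obtain ⟨x, rfl⟩ := IsLocalRing.residue_surjective y
  obtain ⟨a, ha⟩ := exists_dvd_algebraMap_sub v x hϖ.ne_zero
  refine ⟨Ideal.Quotient.mk _ a, ?_⟩
  rw [Ideal.Quotient.lift_mk, RingHom.comp_apply, ← sub_eq_zero, ← map_sub,
    IsLocalRing.residue_eq_zero_iff, hϖ.maximalIdeal_eq]
  exact Ideal.mem_span_singleton.2 ha

theorem compactSpace_adicCompletionIntegers : CompactSpace (v.adicCompletionIntegers K) := by
  have h := (Valued.integer.compactSpace_iff_completeSpace_and_isDiscreteValuationRing_and_finite_residueField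
    (K := v.adicCompletion K)).2 ⟨(Valued.isClosed_integer (v.adicCompletion K)).completeSpace_coe,
      (inferInstance : IsDiscreteValuationRing (v.adicCompletionIntegers K)),
      (inferInstance : Finite (IsLocalRing.ResidueField (v.adicCompletionIntegers K)))⟩
  exact h

instance : CompactSpace (v.adicCompletionIntegers K) := compactSpace_adicCompletionIntegers v

end LocalIntegers

/-! ### The ring `𝓞_{K,p}` and its units -/

section IntegersAt

variable (p : ℕ) {K : Type*} [Field K] [NumberField K]

theorem not_isUnit_natCast {v : HeightOneSpectrum (𝓞 K)} (hv : (p : 𝓞 K) ∈ v.asIdeal) :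
    ¬ IsUnit (p : v.adicCompletionIntegers K) := by
  rw [← map_natCast (algebraMap (𝓞 K) (v.adicCompletionIntegers K)),
    HeightOneSpectrum.adicCompletionIntegers.isUnit_iff_valued_eq_one,
    HeightOneSpectrum.algebraMap_adicCompletionIntegers_apply,
    HeightOneSpectrum.valuedAdicCompletion_eq_valuation']
  exact ((v.valuation_lt_one_iff_mem (K := K) _).2 hv).ne

theorem integersAt_dvd_iff {p : ℕ} (k : ℕ) {x : IntegersAt p K} :
    (p : IntegersAt p K) ^ k ∣ x ↔ ∀ v, (p : v.1.adicCompletionIntegers K) ^ k ∣ x v := by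
  constructor
  · rintro ⟨y, rfl⟩ v
    exact ⟨y v, rfl⟩
  · intro h
    choose y hy using h
    exact ⟨y, funext hy⟩

variable [Fact p.Prime]

theorem natCast_adicCompletionIntegers_ne_zero (v : HeightOneSpectrum (𝓞 K)) :
    (p : v.adicCompletionIntegers K) ≠ 0 := by
  rw [← map_natCast (algebraMap (𝓞 K) (v.adicCompletionIntegers K)), Ne,
    map_eq_zero_iff _ (FaithfulSMul.algebraMap_injective (𝓞 K) (v.adicCompletionIntegers K))]
  exact Nat.cast_ne_zero.2 (Fact.out : p.Prime).ne_zero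

variable (K) in
instance finite_placesAbove : Finite (PlacesAbove p K) := by
  have h : (Ideal.span {(p : 𝓞 K)} : Ideal (𝓞 K)) ≠ 0 := by
    rw [Ne, Ideal.zero_eq_bot, Ideal.span_singleton_eq_bot]
    exact Nat.cast_ne_zero.2 (Fact.out : p.Prime).ne_zero
  refine ((Ideal.finite_factors h).subset fun v hv => ?_).to_subtype
  exact Ideal.dvd_iff_le.2 ((Ideal.span_singleton_le_iff_mem _).2 hv)

variable {p}

theorem isOpen_span_pow_integersAt (k : ℕ) :
    IsOpen (Ideal.span {(p : IntegersAt p K) ^ k} : Set (IntegersAt p K)) := by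
  have h : (Ideal.span {(p : IntegersAt p K) ^ k} : Set (IntegersAt p K)) =
      ⋂ v : PlacesAbove p K, (fun x => x v) ⁻¹'
        {x | (p : v.1.adicCompletionIntegers K) ^ k ∣ x} := by
    ext x
    rw [SetLike.mem_coe, Ideal.mem_span_singleton, integersAt_dvd_iff, Set.mem_iInter]
    rfl
  rw [h]
  exact isOpen_iInter_of_finite fun v => (isOpen_setOf_dvd v.1
    (pow_ne_zero k (natCast_adicCompletionIntegers_ne_zero p v.1))).preimage (continuous_apply v)

theorem integersAt_eq_zero_of_natCast_mul (x : IntegersAt p K) (h : (p : IntegersAt p K) * x = 0) :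
    x = 0 :=
  funext fun v => (mul_eq_zero.1 (congrFun h v)).resolve_left
    (natCast_adicCompletionIntegers_ne_zero p v.1)

omit [Fact p.Prime] in
theorem isUnit_one_add_natCast_mul (x : IntegersAt p K) :
    IsUnit (1 + (p : IntegersAt p K) * x) := by
  rw [Pi.isUnit_iff]
  intro v
  have h : ¬ IsUnit ((p : v.1.adicCompletionIntegers K) * x v) := fun h =>
    not_isUnit_natCast p v.2 (isUnit_of_mul_isUnit_left h)
  exact ((IsLocalRing.isUnit_or_isUnit_of_isUnit_add
    (a := 1 + (p : v.1.adicCompletionIntegers K) * x v)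
    (b := -((p : v.1.adicCompletionIntegers K) * x v)) (by simp)).resolve_right
      (by rwa [IsUnit.neg_iff]))

omit [Fact p.Prime] in
theorem integersAt_eq_zero_of_forall_dvd (x : IntegersAt p K)
    (h : ∀ k, (p : IntegersAt p K) ^ k ∣ x) : x = 0 := by
  funext v
  by_contra hx
  obtain ⟨k, hk⟩ := FiniteMultiplicity.of_not_isUnit (not_isUnit_natCast p v.2) hx
  exact hk ((integersAt_dvd_iff _).1 (h (k + 1)) v)

/-- Divisibility by `p` in `𝓞 K` is tested at the places above `p`: elsewhere `p` is a unit. -/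
theorem natCast_dvd_of_forall_dvd {a : 𝓞 K} (h : ∀ v : PlacesAbove p K,
    (p : v.1.adicCompletionIntegers K) ∣ algebraMap (𝓞 K) (v.1.adicCompletionIntegers K) a) :
    (p : 𝓞 K) ∣ a := by
  have hp : (p : 𝓞 K) ≠ 0 := Nat.cast_ne_zero.2 (Fact.out : p.Prime).ne_zero
  have hval : ∀ v : HeightOneSpectrum (𝓞 K),
      v.valuation K (algebraMap (𝓞 K) K a / algebraMap (𝓞 K) K (p : 𝓞 K)) ≤ 1 := by
    intro v
    have hp0 : v.valuation K (algebraMap (𝓞 K) K (p : 𝓞 K)) ≠ 0 := by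
      rw [Ne, Valuation.zero_iff]
      simpa using hp
    rw [map_div₀, div_le_one₀ (zero_lt_iff.2 hp0)]
    by_cases hv : (p : 𝓞 K) ∈ v.asIdeal
    · have h1 := h ⟨v, hv⟩
      rw [← map_natCast (algebraMap (𝓞 K) (v.adicCompletionIntegers K)),
        adicCompletionIntegers_dvd_iff, HeightOneSpectrum.algebraMap_adicCompletionIntegers_apply,
        HeightOneSpectrum.algebraMap_adicCompletionIntegers_apply,
        HeightOneSpectrum.valuedAdicCompletion_eq_valuation',
        HeightOneSpectrum.valuedAdicCompletion_eq_valuation'] at h1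
      exact h1
    · rw [v.valuation_eq_one_iff_notMem.2 hv]
      exact v.valuation_le_one a
  obtain ⟨b, hb⟩ := HeightOneSpectrum.mem_integers_of_valuation_le_one K _ hval
  refine ⟨b, FaithfulSMul.algebraMap_injective (𝓞 K) K ?_⟩
  rw [map_mul, hb, mul_div_cancel₀]
  simpa using hp

/-- The global integers are `p`-adically dense in `𝓞_{K,p}`. -/
theorem exists_natCast_dvd_sub (x : IntegersAt p K) : ∃ a : 𝓞 K, ∀ v : PlacesAbove p K,
    (p : v.1.adicCompletionIntegers K) ∣
      algebraMap (𝓞 K) (v.1.adicCompletionIntegers K) a - x v := by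
  classical
  have := Fintype.ofFinite (PlacesAbove p K)
  have hp : (p : 𝓞 K) ≠ 0 := Nat.cast_ne_zero.2 (Fact.out : p.Prime).ne_zero
  choose a ha using fun v : PlacesAbove p K =>
    exists_dvd_algebraMap_sub v.1 (x v) (natCast_adicCompletionIntegers_ne_zero p v.1)
  -- The Chinese remainder theorem, with exponents the multiplicities of the `v` in `p`.
  let e : PlacesAbove p K → ℕ := fun v =>
    (Associates.mk v.1.asIdeal).count (Associates.mk (Ideal.span {(p : 𝓞 K)})).factors
  obtain ⟨y, hy⟩ := IsDedekindDomain.exists_forall_sub_mem_ideal (s := Finset.univ)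
    (fun v : PlacesAbove p K => v.1.asIdeal) e (fun v _ => v.1.prime)
    (fun v _ w _ h => fun h' => h (Subtype.ext (HeightOneSpectrum.ext h'))) (fun v => a v)
  refine ⟨y, fun v => ?_⟩
  rw [← sub_add_sub_cancel _ (algebraMap (𝓞 K) (v.1.adicCompletionIntegers K) (a v)), ← map_sub]
  refine dvd_add ?_ (ha v)
  rw [← map_natCast (algebraMap (𝓞 K) (v.1.adicCompletionIntegers K)),
    adicCompletionIntegers_dvd_iff, HeightOneSpectrum.algebraMap_adicCompletionIntegers_apply,
    HeightOneSpectrum.algebraMap_adicCompletionIntegers_apply,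
    HeightOneSpectrum.valuedAdicCompletion_eq_valuation',
    HeightOneSpectrum.valuedAdicCompletion_eq_valuation', HeightOneSpectrum.valuation_of_algebraMap,
    HeightOneSpectrum.valuation_of_algebraMap, HeightOneSpectrum.intValuation_if_neg _ hp,
    HeightOneSpectrum.intValuation_le_pow_iff_mem]
  exact hy v (Finset.mem_univ v)

/-- The ring `𝓞_{K,p} / p` is `𝓞_K / p`, of order the norm of `p`. -/
theorem card_integersAt_quotient :
    Nat.card (IntegersAt p K ⧸ Ideal.span {(p : IntegersAt p K)}) = p ^ Module.finrank ℚ K := by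
  let f : 𝓞 K →+* IntegersAt p K :=
    RingHom.pi fun v : PlacesAbove p K => algebraMap (𝓞 K) (v.1.adicCompletionIntegers K)
  let g := (Ideal.Quotient.mk (Ideal.span {(p : IntegersAt p K)})).comp f
  have hdvd : ∀ x : IntegersAt p K, (p : IntegersAt p K) ∣ x ↔
      ∀ v, (p : v.1.adicCompletionIntegers K) ∣ x v := fun x => by
    simpa using integersAt_dvd_iff 1 (x := x)
  have hker : RingHom.ker g = Ideal.span {(p : 𝓞 K)} := by
    ext a
    rw [RingHom.mem_ker, RingHom.comp_apply, Ideal.Quotient.eq_zero_iff_dvd, hdvd,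
      Ideal.mem_span_singleton]
    refine ⟨fun h => natCast_dvd_of_forall_dvd h, fun h v => ?_⟩
    have h1 := map_dvd (algebraMap (𝓞 K) (v.1.adicCompletionIntegers K)) h
    rwa [map_natCast] at h1
  have hsurj : Function.Surjective g := by
    intro y
    obtain ⟨x, rfl⟩ := Ideal.Quotient.mk_surjective y
    obtain ⟨a, ha⟩ := exists_natCast_dvd_sub x
    refine ⟨a, ?_⟩
    rw [RingHom.comp_apply, Ideal.Quotient.mk_eq_mk_iff_sub_mem, Ideal.mem_span_singleton, hdvd]
    exact ha
  rw [← Nat.card_congr (RingHom.quotientKerEquivOfSurjective hsurj).toEquiv, hker]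
  change Submodule.cardQuot _ = _
  rw [← Ideal.absNorm_apply, Ideal.absNorm_span_singleton]
  have h1 : Algebra.norm ℤ (p : 𝓞 K) = (p : ℤ) ^ Module.finrank ℤ (𝓞 K) := by
    have := Algebra.norm_algebraMap (R := ℤ) (S := 𝓞 K) (p : ℤ)
    simpa using this
  rw [h1, RingOfIntegers.rank]
  simp [Int.natAbs_pow]

variable (p K) in
/-- The group `1 + p² 𝓞_{K,p}` is an open subgroup of `𝓞_{K,p}ˣ` isomorphic to `ℤ_p^{[K : ℚ]}`. -/
theorem exists_chart_units_integersAt : ∃ V : OpenSubgroup (IntegersAt p K)ˣ,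
    Nonempty ((V : Subgroup (IntegersAt p K)ˣ) ≃ₜ*
      Multiplicative (Fin (Module.finrank ℚ K) → ℤ_[p])) :=
  ⟨⟨principalUnits p (IntegersAt p K) 2, isOpen_principalUnits isOpen_span_pow_integersAt 2⟩,
    nonempty_principalUnits_equiv integersAt_eq_zero_of_natCast_mul isUnit_one_add_natCast_mul
      card_integersAt_quotient isOpen_span_pow_integersAt integersAt_eq_zero_of_forall_dvd⟩

end IntegersAt

/-! ### Units of `K ⊗ ℝ` -/

section InfiniteUnits

variable {K : Type*} [Field K]

/-- A nonzero element of `K_v`, positive if `v` is real, is joined to `1` by the one-parameter group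
`t ↦ exp (t log x)`. -/
theorem exists_path_completion {v : InfinitePlace K} {x : v.Completion} (hx : x ≠ 0)
    (hpos : ∀ hv : v.IsReal, 0 < InfinitePlace.Completion.extensionEmbeddingOfIsReal hv x) :
    ∃ γ : ℝ → v.Completion, Continuous γ ∧ γ 0 = 1 ∧ γ 1 = x ∧ ∀ t, γ t ≠ 0 := by
  by_cases hv : v.IsReal
  · let e := InfinitePlace.Completion.ringEquivRealOfIsReal hv
    have he : Continuous e.symm :=
      (InfinitePlace.Completion.isometryEquivRealOfIsReal hv).symm.continuous
    refine ⟨fun t => e.symm (Real.exp (t * Real.log (e x))), ?_, ?_, ?_, fun t => ?_⟩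
    · fun_prop
    · simp
    · beta_reduce
      rw [one_mul, Real.exp_log (show 0 < e x from hpos hv), e.symm_apply_apply]
    · rw [Ne, map_eq_zero_iff _ e.symm.injective]
      exact Real.exp_ne_zero _
  · have hv' : v.IsComplex := InfinitePlace.not_isReal_iff_isComplex.1 hv
    let e := InfinitePlace.Completion.ringEquivComplexOfIsComplex hv'
    have he : Continuous e.symm :=
      (InfinitePlace.Completion.isometryEquivComplexOfIsComplex hv').symm.continuous
    refine ⟨fun t => e.symm (Complex.exp (t * Complex.log (e x))), ?_, ?_, ?_, fun t => ?_⟩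
    · fun_prop
    · simp
    · beta_reduce
      rw [Complex.ofReal_one, one_mul, Complex.exp_log ((map_ne_zero_iff _ e.injective).2 hx),
        e.symm_apply_apply]
    · rw [Ne, map_eq_zero_iff _ e.symm.injective]
      exact Complex.exp_ne_zero _

variable (K) in
/-- The signs at the real places of a unit of `K ⊗ ℝ`. -/
def infiniteSigns : (InfiniteAdeleRing K)ˣ →* ({v : InfinitePlace K // v.IsReal} → SignTypeˣ) :=
  MonoidHom.pi fun v => Units.map ((signHom : ℝ →*₀ SignType).toMonoidHom.comp
    ((InfinitePlace.Completion.extensionEmbeddingOfIsReal v.2).toMonoidHom.comp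
      (Pi.evalMonoidHom (fun v : InfinitePlace K => v.Completion) v.1)))

theorem mem_ker_infiniteSigns {x : (InfiniteAdeleRing K)ˣ} : x ∈ (infiniteSigns K).ker ↔
    ∀ v : {v : InfinitePlace K // v.IsReal},
      0 < InfinitePlace.Completion.extensionEmbeddingOfIsReal v.2 (x.1 v.1) := by
  rw [MonoidHom.mem_ker, funext_iff]
  refine forall_congr' fun v => ?_
  rw [← sign_eq_one_iff, ← Units.val_inj]
  rfl

/-- A unit of `K ⊗ ℝ` which is positive at the real places is joined to `1` by a path. -/
theorem ker_infiniteSigns_le :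
    (infiniteSigns K).ker ≤ Subgroup.connectedComponentOfOne (InfiniteAdeleRing K)ˣ := by
  intro x hx
  rw [mem_ker_infiniteSigns] at hx
  have hx0 : ∀ v, x.1 v ≠ 0 := fun v h => by
    have h1 : x.1 v * (x⁻¹).1 v = 1 := congrFun x.mul_inv v
    rw [h, zero_mul] at h1
    exact zero_ne_one h1
  choose γ hγ h0 h1 hne using fun v => exists_path_completion (hx0 v) fun hv => hx ⟨v, hv⟩
  let Γ : ℝ → (InfiniteAdeleRing K)ˣ := fun t =>
    { val := fun v => γ v t
      inv := fun v => (γ v t)⁻¹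
      val_inv := funext fun v => mul_inv_cancel₀ (hne v t)
      inv_val := funext fun v => inv_mul_cancel₀ (hne v t) }
  have hΓ : Continuous Γ := Units.continuous_iff.2
    ⟨continuous_pi fun v => hγ v, continuous_pi fun v => (hγ v).inv₀ (hne v)⟩
  have hc : IsPreconnected (Set.range Γ) := isPreconnected_range hΓ
  refine hc.subset_connectedComponent ⟨0, ?_⟩ ⟨1, ?_⟩
  · exact Units.ext (funext h0)
  · exact Units.ext (funext h1)

variable [NumberField K]

variable (K) in
theorem isOpen_connectedComponentOfOne_infinite :
    IsOpen (Subgroup.connectedComponentOfOne (InfiniteAdeleRing K)ˣ :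
      Set (InfiniteAdeleRing K)ˣ) := by
  refine Subgroup.isOpen_mono ker_infiniteSigns_le ?_
  have h : ((infiniteSigns K).ker : Set (InfiniteAdeleRing K)ˣ) =
      ⋂ v : {v : InfinitePlace K // v.IsReal}, {x |
        0 < InfinitePlace.Completion.extensionEmbeddingOfIsReal v.2 (x.1 v.1)} := by
    ext x
    rw [Set.mem_iInter]
    exact mem_ker_infiniteSigns
  rw [h]
  refine isOpen_iInter_of_finite fun v => isOpen_lt continuous_const ?_
  exact (InfinitePlace.Completion.isometry_extensionEmbeddingOfIsReal v.2).continuous.comp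
    ((continuous_apply v.1).comp Units.continuous_val)

variable (K) in
theorem index_connectedComponentOfOne_infinite_ne_zero :
    (Subgroup.connectedComponentOfOne (InfiniteAdeleRing K)ˣ).index ≠ 0 := by
  have : (infiniteSigns K).ker.FiniteIndex := Subgroup.finiteIndex_ker _
  exact (Subgroup.finiteIndex_of_le ker_infiniteSigns_le).index_ne_zero

end InfiniteUnits

/-! ### The idele group and its subgroup `U · 𝓞_{K,p}ˣ · K_∞°` -/

section IdeleTopology

variable {p : ℕ} {K : Type*} [Field K] [NumberField K]

variable (K) in
/-- The projection of the adeles to the completion at a finite place. -/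
def adeleEval (v : HeightOneSpectrum (𝓞 K)) : AdeleRing (𝓞 K) K →+* v.adicCompletion K where
  toFun x := x.2 v
  map_one' := rfl
  map_mul' _ _ := rfl
  map_zero' := rfl
  map_add' _ _ := rfl

theorem continuous_adeleEval (v : HeightOneSpectrum (𝓞 K)) : Continuous (adeleEval K v) :=
  (RestrictedProduct.continuous_eval v).comp
    (continuous_snd (X := InfiniteAdeleRing K) (Y := FiniteAdeleRing (𝓞 K) K))

theorem continuous_adeleToInfinite : Continuous (adeleToInfinite K) :=
  continuous_fst (X := InfiniteAdeleRing K) (Y := FiniteAdeleRing (𝓞 K) K)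

theorem continuous_adeleToTame : Continuous (adeleToTame p K) := by
  have h : Continuous (RestrictedProduct.mapAlong
      (fun v : HeightOneSpectrum (𝓞 K) => v.adicCompletion K)
      (fun v : PlacesAway p K => v.1.adicCompletion K)
      (A₁ := fun v => (v.adicCompletionIntegers K : Set (v.adicCompletion K)))
      (A₂ := fun v => (v.1.adicCompletionIntegers K : Set (v.1.adicCompletion K)))
      (fun v : PlacesAway p K => v.1) Subtype.val_injective.tendsto_cofinite
      (fun v x => x) (Filter.Eventually.of_forall fun v x hx => hx)) :=
    RestrictedProduct.mapAlong_continuous _ _ _ _ _ _ fun v => continuous_id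
  exact h.comp (continuous_snd (X := InfiniteAdeleRing K) (Y := FiniteAdeleRing (𝓞 K) K))

/-- The idele with the given infinite component and trivial finite components. -/
def infiniteIdele : (InfiniteAdeleRing K)ˣ →* (AdeleRing (𝓞 K) K)ˣ where
  toFun x := ⟨(x.1, 1), (x⁻¹.1, 1), Prod.ext x.mul_inv (one_mul 1), Prod.ext x.inv_mul (one_mul 1)⟩
  map_one' := rfl
  map_mul' _ _ := Units.ext (Prod.ext rfl (one_mul 1).symm)

variable (p) in
/-- The ideles that are units at the places above `p`. -/
def unitsAbove : Subgroup (AdeleRing (𝓞 K) K)ˣ where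
  carrier := {x | ∀ v : PlacesAbove p K, adeleEval K v.1 x ∈ v.1.adicCompletionIntegers K ∧
    adeleEval K v.1 (x⁻¹).1 ∈ v.1.adicCompletionIntegers K}
  one_mem' v := ⟨one_mem _, one_mem _⟩
  mul_mem' {x y} hx hy v := by
    rw [mul_inv, Units.val_mul, Units.val_mul, map_mul, map_mul]
    exact ⟨mul_mem (hx v).1 (hy v).1, mul_mem (hx v).2 (hy v).2⟩
  inv_mem' {x} hx v := ⟨(hx v).2, by rw [inv_inv]; exact (hx v).1⟩

/-- The components above `p` of an idele that is a unit there. -/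
def unitsAboveToUnitsAt : unitsAbove (K := K) p →* (IntegersAt p K)ˣ where
  toFun x := ⟨fun v => ⟨adeleEval K v.1 x.1, (x.2 v).1⟩,
    fun v => ⟨adeleEval K v.1 (x.1⁻¹).1, (x.2 v).2⟩,
    funext fun v => Subtype.ext (congrArg (adeleEval K v.1) x.1.mul_inv),
    funext fun v => Subtype.ext (congrArg (adeleEval K v.1) x.1.inv_mul)⟩
  map_one' := rfl
  map_mul' _ _ := rfl

theorem isOpen_unitsAbove [Finite (PlacesAbove p K)] :
    IsOpen (unitsAbove (K := K) p : Set (AdeleRing (𝓞 K) K)ˣ) := by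
  have h : (unitsAbove (K := K) p : Set (AdeleRing (𝓞 K) K)ˣ) = ⋂ v : PlacesAbove p K,
      (fun x : (AdeleRing (𝓞 K) K)ˣ => adeleEval K v.1 x) ⁻¹' v.1.adicCompletionIntegers K ∩
        (fun x : (AdeleRing (𝓞 K) K)ˣ => adeleEval K v.1 (x⁻¹).1) ⁻¹'
          v.1.adicCompletionIntegers K := by
    ext x
    rw [Set.mem_iInter]
    rfl
  rw [h]
  refine isOpen_iInter_of_finite fun v => IsOpen.inter ?_ ?_
  · exact (Valued.isOpen_valuationSubring _).preimage
      ((continuous_adeleEval v.1).comp Units.continuous_val)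
  · exact (Valued.isOpen_valuationSubring _).preimage
      ((continuous_adeleEval v.1).comp (Units.continuous_val.comp continuous_inv))

theorem continuous_unitsAboveToUnitsAt : Continuous (unitsAboveToUnitsAt (p := p) (K := K)) := by
  refine Units.continuous_iff.2 ⟨continuous_pi fun v => ?_, continuous_pi fun v => ?_⟩
  · exact Continuous.subtype_mk ((continuous_adeleEval v.1).comp
      (Units.continuous_val.comp continuous_subtype_val)) _
  · exact Continuous.subtype_mk ((continuous_adeleEval v.1).comp
      (Units.continuous_val.comp (continuous_inv.comp continuous_subtype_val))) _

theorem adeleEval_unitsAtToIdele (y : (IntegersAt p K)ˣ) (v : PlacesAbove p K) :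
    adeleEval K v.1 (unitsAtToIdele p K y).1 = y.1 v := by
  change ((extendByOne p K y.1 v.1 : v.1.adicCompletionIntegers K) : v.1.adicCompletion K) = _
  rw [extendByOne, dif_pos v.2]

theorem adeleEval_unitsAtToIdele_of_notMem (y : (IntegersAt p K)ˣ) (v : PlacesAway p K) :
    adeleEval K v.1 (unitsAtToIdele p K y).1 = 1 := by
  change ((extendByOne p K y.1 v.1 : v.1.adicCompletionIntegers K) : v.1.adicCompletion K) = _
  rw [extendByOne, dif_neg v.2]
  rfl

theorem unitsAtToIdele_mem_unitsAbove (y : (IntegersAt p K)ˣ) :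
    unitsAtToIdele p K y ∈ unitsAbove p := fun v => by
  rw [← map_inv, adeleEval_unitsAtToIdele, adeleEval_unitsAtToIdele]
  exact ⟨(y.1 v).2, (y⁻¹.1 v).2⟩

theorem map_adeleToTame_unitsAtToIdele (y : (IntegersAt p K)ˣ) :
    Units.map (adeleToTame p K : AdeleRing (𝓞 K) K →* TameAdeleRing p K)
      (unitsAtToIdele p K y) = 1 :=
  Units.ext (RestrictedProduct.ext _ _ fun v => adeleEval_unitsAtToIdele_of_notMem y v)

theorem map_adeleToInfinite_unitsAtToIdele (y : (IntegersAt p K)ˣ) :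
    Units.map (adeleToInfinite K : AdeleRing (𝓞 K) K →* InfiniteAdeleRing K)
      (unitsAtToIdele p K y) = 1 := rfl

variable (U : Subgroup (TameAdeleRing p K)ˣ)

/-- The subgroup `U · 𝓞_{K,p}ˣ · K_∞°` of the ideles. -/
def levelUnits : Subgroup (AdeleRing (𝓞 K) K)ˣ :=
  tameSubgroup U ⊔ (unitsAtToIdele p K).range ⊔ infiniteComponent K

variable {U}

/-- The components of an idele can be tested separately for membership in `U · 𝓞_{K,p}ˣ · K_∞°`. -/
theorem mem_levelUnits_iff {x : (AdeleRing (𝓞 K) K)ˣ} : x ∈ levelUnits U ↔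
    Units.map (adeleToTame p K : AdeleRing (𝓞 K) K →* TameAdeleRing p K) x ∈ U ∧
    Units.map (adeleToInfinite K : AdeleRing (𝓞 K) K →* InfiniteAdeleRing K) x ∈
      Subgroup.connectedComponentOfOne (InfiniteAdeleRing K)ˣ ∧ x ∈ unitsAbove p := by
  constructor
  · intro h
    let W : Subgroup (AdeleRing (𝓞 K) K)ˣ :=
      U.comap (Units.map (adeleToTame p K : AdeleRing (𝓞 K) K →* TameAdeleRing p K)) ⊓
      ((Subgroup.connectedComponentOfOne (InfiniteAdeleRing K)ˣ).comap
        (Units.map (adeleToInfinite K : AdeleRing (𝓞 K) K →* InfiniteAdeleRing K)) ⊓ unitsAbove p)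
    have hW : levelUnits U ≤ W := by
      refine sup_le (sup_le ?_ ?_) ?_
      · rintro u hu
        refine ⟨hu.1, ?_, fun v => ⟨?_, ?_⟩⟩
        · have h1 : Units.map
              (adeleToInfinite K : AdeleRing (𝓞 K) K →* InfiniteAdeleRing K) u = 1 :=
            Units.ext hu.2.1
          exact Subgroup.mem_comap.2 (h1 ▸ one_mem _)
        · have h1 : adeleEval K v.1 u.1 = 1 := hu.2.2 v
          rw [h1]; exact one_mem _
        · have h1 : adeleEval K v.1 (u⁻¹).1 = 1 := (inv_mem hu).2.2 v
          rw [h1]; exact one_mem _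
      · rintro _ ⟨y, rfl⟩
        refine ⟨?_, Subgroup.mem_comap.2 (map_adeleToInfinite_unitsAtToIdele y ▸ one_mem _),
          unitsAtToIdele_mem_unitsAbove y⟩
        exact Subgroup.mem_comap.2 (map_adeleToTame_unitsAtToIdele y ▸ one_mem _)
      · rintro z hz
        refine ⟨?_, hz.1, fun v => ⟨?_, ?_⟩⟩
        · have h1 : Units.map (adeleToTame p K : AdeleRing (𝓞 K) K →* TameAdeleRing p K) z = 1 :=
            Units.ext (RestrictedProduct.ext _ _ fun v => hz.2 v.1)
          exact Subgroup.mem_comap.2 (h1 ▸ one_mem _)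
        · have h1 : adeleEval K v.1 z.1 = 1 := hz.2 v.1
          rw [h1]; exact one_mem _
        · have h1 : adeleEval K v.1 (z⁻¹).1 = 1 := (inv_mem hz).2 v.1
          rw [h1]; exact one_mem _
    exact hW h
  · rintro ⟨h1, h2, h3⟩
    let y : (IntegersAt p K)ˣ := unitsAboveToUnitsAt ⟨x, h3⟩
    let z : (AdeleRing (𝓞 K) K)ˣ := infiniteIdele
      (Units.map (adeleToInfinite K : AdeleRing (𝓞 K) K →* InfiniteAdeleRing K) x)
    -- The factor `x y⁻¹ z⁻¹` is trivial above `p` and at infinity.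
    have hx : x = x * (unitsAtToIdele p K y)⁻¹ * z⁻¹ * unitsAtToIdele p K y * z := by
      rw [mul_right_comm _ z⁻¹, inv_mul_cancel_right, inv_mul_cancel_right]
    rw [hx]
    refine mul_mem (mul_mem (Subgroup.mem_sup_left (Subgroup.mem_sup_left ⟨?_, ?_, fun v => ?_⟩))
      (Subgroup.mem_sup_left (Subgroup.mem_sup_right ⟨y, rfl⟩)))
      (Subgroup.mem_sup_right ⟨h2, fun v => rfl⟩)
    · have hz : Units.map (adeleToTame p K : AdeleRing (𝓞 K) K →* TameAdeleRing p K) z = 1 := rfl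
      rw [map_mul, map_mul, map_inv, map_inv, map_adeleToTame_unitsAtToIdele, hz]
      simpa using h1
    · have hz : Units.map (adeleToInfinite K : AdeleRing (𝓞 K) K →* InfiniteAdeleRing K) z =
        Units.map (adeleToInfinite K : AdeleRing (𝓞 K) K →* InfiniteAdeleRing K) x := rfl
      have h : Units.map (adeleToInfinite K : AdeleRing (𝓞 K) K →* InfiniteAdeleRing K)
          (x * (unitsAtToIdele p K y)⁻¹ * z⁻¹) = 1 := by
        rw [map_mul, map_mul, map_inv, map_inv, map_adeleToInfinite_unitsAtToIdele, hz, inv_one,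
          mul_one, mul_inv_cancel]
      exact congrArg Units.val h
    · have hz : Units.map (adeleEval K v.1 : AdeleRing (𝓞 K) K →* v.1.adicCompletion K) z = 1 := rfl
      have hy : Units.map (adeleEval K v.1 : AdeleRing (𝓞 K) K →* v.1.adicCompletion K)
          (unitsAtToIdele p K y) =
          Units.map (adeleEval K v.1 : AdeleRing (𝓞 K) K →* v.1.adicCompletion K) x :=
        Units.ext (adeleEval_unitsAtToIdele y v)
      have h : Units.map (adeleEval K v.1 : AdeleRing (𝓞 K) K →* v.1.adicCompletion K)
          (x * (unitsAtToIdele p K y)⁻¹ * z⁻¹) = 1 := by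
        rw [map_mul, map_mul, map_inv, map_inv, hy, hz, mul_inv_cancel, inv_one, mul_one]
      exact congrArg Units.val h

theorem isOpen_levelUnits [Finite (PlacesAbove p K)]
    (hU : IsOpen (U : Set (TameAdeleRing p K)ˣ)) :
    IsOpen (levelUnits U : Set (AdeleRing (𝓞 K) K)ˣ) := by
  have h : (levelUnits U : Set (AdeleRing (𝓞 K) K)ˣ) =
      (Units.map (adeleToTame p K : AdeleRing (𝓞 K) K →* TameAdeleRing p K) ⁻¹' U) ∩
      ((Units.map (adeleToInfinite K : AdeleRing (𝓞 K) K →* InfiniteAdeleRing K) ⁻¹'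
        Subgroup.connectedComponentOfOne (InfiniteAdeleRing K)ˣ) ∩
        (unitsAbove (K := K) p : Set (AdeleRing (𝓞 K) K)ˣ)) := by
    ext x
    exact mem_levelUnits_iff
  rw [h]
  exact (hU.preimage (continuous_adeleToTame.units_map _)).inter
    (((isOpen_connectedComponentOfOne_infinite K).preimage
      (continuous_adeleToInfinite.units_map _)).inter isOpen_unitsAbove)

/-- An element `k u z` of `Kˣ · U · K_∞°` has components `k` above `p`, and if it lies in
`U · 𝓞_{K,p}ˣ · K_∞°` then so does `k`. -/
theorem eq_of_mem_levelSubgroup {y : (AdeleRing (𝓞 K) K)ˣ} (hy : y ∈ levelSubgroup U) :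
    ∃ k : Kˣ, (y ∈ levelUnits U → k ∈ globalUnits U) ∧
      ∀ v : PlacesAbove p K, adeleEval K v.1 y = ((k : K) : v.1.adicCompletion K) := by
  obtain ⟨a, ha, z, hz, rfl⟩ := Subgroup.mem_sup.1 hy
  obtain ⟨_, ⟨k, rfl⟩, u, hu, rfl⟩ := Subgroup.mem_sup.1 ha
  refine ⟨k, fun h => ?_, fun v => ?_⟩
  · have hu' : u ∈ levelUnits U := Subgroup.mem_sup_left (Subgroup.mem_sup_left hu)
    have hz' : z ∈ levelUnits U := Subgroup.mem_sup_right hz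
    exact (Subgroup.mul_mem_cancel_right _ hu').1 ((Subgroup.mul_mem_cancel_right _ hz').1 h)
  · rw [Units.val_mul, Units.val_mul, map_mul, map_mul,
      show adeleEval K v.1 z.1 = 1 from hz.2 v.1, show adeleEval K v.1 u.1 = 1 from hu.2.2 v,
      mul_one, mul_one]
    rfl

/-- Since `U · 𝓞_{K,p}ˣ · K_∞°` is open, an element of `𝓞_{K,p}ˣ` which is a limit of elements of
`Kˣ · U · K_∞°` is a limit of elements of `Γ(U)`. -/
theorem mem_closure_globalUnitsAt [Finite (PlacesAbove p K)]
    (hU : IsOpen (U : Set (TameAdeleRing p K)ˣ)) {x : (IntegersAt p K)ˣ}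
    (hx : unitsAtToIdele p K x ∈ (levelSubgroup U).topologicalClosure) :
    x ∈ (globalUnitsAt U).topologicalClosure := by
  refine mem_closure_iff.2 fun O hO hxO => ?_
  -- A neighbourhood of `x` in the ideles, inside `U · 𝓞_{K,p}ˣ · K_∞°`, on which the components
  -- above `p` lie in `O`.
  have hopen : IsOpen (levelUnits U ∩
      Subtype.val '' (unitsAboveToUnitsAt (p := p) (K := K) ⁻¹' O)) :=
    (isOpen_levelUnits hU).inter
      (isOpen_unitsAbove.isOpenMap_subtype_val _ (hO.preimage continuous_unitsAboveToUnitsAt))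
  obtain ⟨y, ⟨hy1, ⟨y', hy'⟩, hy2, rfl⟩, hy3⟩ := mem_closure_iff.1 hx _ hopen
    ⟨Subgroup.mem_sup_left (Subgroup.mem_sup_right ⟨x, rfl⟩),
      ⟨_, unitsAtToIdele_mem_unitsAbove x⟩, by
        have h : unitsAboveToUnitsAt ⟨_, unitsAtToIdele_mem_unitsAbove x⟩ = x :=
          Units.ext (funext fun v => Subtype.ext (adeleEval_unitsAtToIdele x v))
        rw [Set.mem_preimage, h]
        exact hxO, rfl⟩
  obtain ⟨k, hk1, hk2⟩ := eq_of_mem_levelSubgroup hy3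
  exact ⟨_, hy2, k, hk1 hy1, hk2⟩

/-- The group `Q(U)` is a subgroup of `H(U)`. -/
theorem injective_qToH [Finite (PlacesAbove p K)]
    (hU : IsOpen (U : Set (TameAdeleRing p K)ˣ)) : Function.Injective (qToH U) := by
  rw [injective_iff_map_eq_one]
  intro x hx
  obtain ⟨x, rfl⟩ := QuotientGroup.mk_surjective x
  exact (QuotientGroup.eq_one_iff _).2
    (mem_closure_globalUnitsAt hU ((QuotientGroup.eq_one_iff _).1 hx))

end IdeleTopology

/-! ### Ideles and ideal classes -/

section ClassNumber

open scoped nonZeroDivisors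

variable {K : Type*} [Field K] [NumberField K]

/-- The valuation at `v` is the exponent of `v` in the principal fractional ideal. -/
theorem valuation_eq_exp_neg_count (v : HeightOneSpectrum (𝓞 K)) {k : K} (hk : k ≠ 0) :
    v.valuation K k =
      WithZero.exp (-FractionalIdeal.count K v (FractionalIdeal.spanSingleton (𝓞 K)⁰ k)) := by
  have h : ∀ r : 𝓞 K, r ≠ 0 → v.valuation K (algebraMap (𝓞 K) K r) = WithZero.exp
      (-FractionalIdeal.count K v
        (FractionalIdeal.spanSingleton (𝓞 K)⁰ (algebraMap (𝓞 K) K r))) := fun r hr => by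
    rw [HeightOneSpectrum.valuation_of_algebraMap, HeightOneSpectrum.intValuation_if_neg _ hr,
      ← FractionalIdeal.coeIdeal_span_singleton, FractionalIdeal.count_coe K v
        (by rwa [Ne, Ideal.zero_eq_bot, Ideal.span_singleton_eq_bot])]
  obtain ⟨a, b, hb, rfl⟩ := IsFractionRing.div_surjective (A := 𝓞 K) k
  have hb0 : b ≠ 0 := nonZeroDivisors.ne_zero hb
  have hb1 : algebraMap (𝓞 K) K b ≠ 0 := by simpa using hb0
  have ha0 : a ≠ 0 := by
    rintro rfl
    simp at hk
  have hmul := FractionalIdeal.count_mul K v (FractionalIdeal.spanSingleton_ne_zero_iff.2 hk)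
    (FractionalIdeal.spanSingleton_ne_zero_iff.2 hb1)
  rw [FractionalIdeal.spanSingleton_mul_spanSingleton, div_mul_cancel₀ _ hb1] at hmul
  rw [map_div₀, h a ha0, h b hb0, hmul, ← WithZero.exp_sub]
  congr 1
  ring

/-- The exponent at `v` of the fractional ideal generated by an idele. -/
def ideleExponent (x : (AdeleRing (𝓞 K) K)ˣ) (v : HeightOneSpectrum (𝓞 K)) : ℤ :=
  -WithZero.log (Valued.v (adeleEval K v x))

theorem exp_neg_ideleExponent (x : (AdeleRing (𝓞 K) K)ˣ) (v : HeightOneSpectrum (𝓞 K)) :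
    WithZero.exp (-ideleExponent x v) = Valued.v (adeleEval K v x) := by
  rw [ideleExponent, neg_neg, WithZero.exp_log]
  exact (Valuation.ne_zero_iff _).2 (x.isUnit.map (adeleEval K v)).ne_zero

theorem eventually_ideleExponent_eq_zero (x : (AdeleRing (𝓞 K) K)ˣ) :
    ∀ᶠ v in Filter.cofinite, ideleExponent x v = 0 := by
  have hx : IsUnit (x.1.2 : FiniteAdeleRing (𝓞 K) K) :=
    x.isUnit.map (RingHom.snd (InfiniteAdeleRing K) (FiniteAdeleRing (𝓞 K) K))
  filter_upwards [(FiniteAdeleRing.isUnit_iff.1 hx).2] with v hv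
  have hv' : Valued.v (adeleEval K v x.1) = 1 := hv
  rw [ideleExponent, hv', WithZero.log_one, neg_zero]

/-- The fractional ideal generated by an idele. -/
def ideleIdeal (x : (AdeleRing (𝓞 K) K)ˣ) : FractionalIdeal (𝓞 K)⁰ K :=
  ∏ᶠ v : HeightOneSpectrum (𝓞 K), (v.asIdeal : FractionalIdeal (𝓞 K)⁰ K) ^ ideleExponent x v

theorem count_ideleIdeal (x : (AdeleRing (𝓞 K) K)ˣ) (v : HeightOneSpectrum (𝓞 K)) :
    FractionalIdeal.count K v (ideleIdeal x) = ideleExponent x v :=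
  FractionalIdeal.count_finprod K v _ (eventually_ideleExponent_eq_zero x)

theorem ideleIdeal_ne_zero (x : (AdeleRing (𝓞 K) K)ˣ) : ideleIdeal x ≠ 0 :=
  finprod_induction (p := fun I : FractionalIdeal (𝓞 K)⁰ K => I ≠ 0) one_ne_zero
    (fun _ _ => mul_ne_zero)
    fun v => zpow_ne_zero _ (FractionalIdeal.coeIdeal_ne_zero.2 v.ne_bot)

/-- The class of the fractional ideal generated by an idele. -/
def ideleClass (x : (AdeleRing (𝓞 K) K)ˣ) : ClassGroup (𝓞 K) :=
  ClassGroup.mk K (Units.mk0 _ (ideleIdeal_ne_zero x))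

variable (K) in
/-- The ideles that are units at all finite places. -/
def unitIdeles : Subgroup (AdeleRing (𝓞 K) K)ˣ where
  carrier := {x | ∀ v, Valued.v (adeleEval K v x) = 1}
  one_mem' v := by rw [Units.val_one, map_one, map_one]
  mul_mem' {x y} hx hy v := by rw [Units.val_mul, map_mul, map_mul, hx v, hy v, one_mul]
  inv_mem' {x} hx v := by
    have h : Valued.v (adeleEval K v (x * x⁻¹ : (AdeleRing (𝓞 K) K)ˣ).1) = 1 := by
      rw [mul_inv_cancel, Units.val_one, map_one, map_one]
    rwa [Units.val_mul, map_mul, map_mul, hx v, one_mul] at h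

/-- Two ideles with the same ideal class differ by a principal idele and an idele that is a unit at
all finite places. -/
theorem inv_mul_mem_of_ideleClass_eq {x y : (AdeleRing (𝓞 K) K)ˣ}
    (h : ideleClass x = ideleClass y) :
    x⁻¹ * y ∈ (principalIdele K).range ⊔ unitIdeles K := by
  have h1 : ClassGroup.mk K (Units.mk0 _ (ideleIdeal_ne_zero y) *
      (Units.mk0 _ (ideleIdeal_ne_zero x))⁻¹) = 1 := by
    rw [map_mul, map_inv]
    exact mul_inv_eq_one.2 h.symm
  rw [ClassGroup.mk_eq_one_iff] at h1
  obtain ⟨k, hk⟩ := (FractionalIdeal.isPrincipal_iff _).1 h1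
  have hk' : ideleIdeal y = FractionalIdeal.spanSingleton (𝓞 K)⁰ k * ideleIdeal x := by
    rw [← hk, Units.val_mul, Units.val_inv_eq_inv_val, Units.val_mk0, Units.val_mk0,
      inv_mul_cancel_right₀ (ideleIdeal_ne_zero x)]
  have hk0 : k ≠ 0 := by
    rintro rfl
    rw [FractionalIdeal.spanSingleton_zero, zero_mul] at hk'
    exact ideleIdeal_ne_zero y hk'
  have hval : ∀ v : HeightOneSpectrum (𝓞 K), Valued.v (adeleEval K v y.1) =
      Valued.v (adeleEval K v (principalIdele K (Units.mk0 k hk0)).1) *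
        Valued.v (adeleEval K v x.1) := fun v => by
    have h2 := FractionalIdeal.count_mul K v (FractionalIdeal.spanSingleton_ne_zero_iff.2 hk0)
      (ideleIdeal_ne_zero x)
    rw [← hk', count_ideleIdeal, count_ideleIdeal] at h2
    have h3 : Valued.v (adeleEval K v (principalIdele K (Units.mk0 k hk0)).1) = v.valuation K k :=
      HeightOneSpectrum.valuedAdicCompletion_eq_valuation' v k
    rw [h3, valuation_eq_exp_neg_count v hk0, ← exp_neg_ideleExponent, ← exp_neg_ideleExponent, h2,
      ← WithZero.exp_add, neg_add]
  have hz : x⁻¹ * y * (principalIdele K (Units.mk0 k hk0))⁻¹ ∈ unitIdeles K := fun v => by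
    have h0 : ∀ z : (AdeleRing (𝓞 K) K)ˣ, Valued.v (adeleEval K v z.1) ≠ 0 := fun z =>
      (Valuation.ne_zero_iff _).2 (z.isUnit.map (adeleEval K v)).ne_zero
    have hinv : ∀ z : (AdeleRing (𝓞 K) K)ˣ, Valued.v (adeleEval K v (z⁻¹).1) =
        (Valued.v (adeleEval K v z.1))⁻¹ := fun z => by
      refine eq_inv_of_mul_eq_one_left ?_
      rw [← map_mul, ← map_mul, ← Units.val_mul, inv_mul_cancel, Units.val_one, map_one, map_one]
    rw [Units.val_mul, Units.val_mul, map_mul, map_mul, map_mul, map_mul, hinv, hinv, hval,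
      mul_comm, mul_left_comm _ _ (Valued.v (adeleEval K v x.1)), inv_mul_cancel_left₀ (h0 _)]
    exact inv_mul_cancel₀ (h0 _)
  have h5 : x⁻¹ * y = principalIdele K (Units.mk0 k hk0) *
      (x⁻¹ * y * (principalIdele K (Units.mk0 k hk0))⁻¹) := by
    rw [mul_comm (principalIdele K _), inv_mul_cancel_right]
  rw [h5]
  exact Subgroup.mul_mem_sup ⟨_, rfl⟩ hz

/-- Finiteness of the class number, for ideles. -/
theorem index_principalIdele_sup_unitIdeles_ne_zero :
    ((principalIdele K).range ⊔ unitIdeles K).index ≠ 0 := by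
  have : Finite ((AdeleRing (𝓞 K) K)ˣ ⧸ ((principalIdele K).range ⊔ unitIdeles K)) := by
    refine Finite.of_injective (fun q => ideleClass (Quotient.out q)) fun q q' h => ?_
    rw [← QuotientGroup.out_eq' q, ← QuotientGroup.out_eq' q']
    exact QuotientGroup.eq.2 (inv_mul_mem_of_ideleClass_eq h)
  exact Subgroup.index_ne_zero_of_finite

end ClassNumber

/-! ### The index of `Q(U)` in `H(U)` -/

section FiniteIndex

theorem relIndex_ne_zero_of_isOpen_of_isCompact {G : Type*} [Group G] [TopologicalSpace G]
    [IsTopologicalGroup G] {V C : Subgroup G} (hV : IsOpen (V : Set G))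
    (hC : IsCompact (C : Set G)) : V.relIndex C ≠ 0 := by
  have : CompactSpace C := isCompact_iff_compactSpace.1 hC
  have := (V.subgroupOf C).quotient_finite_of_isOpen (hV.preimage continuous_subtype_val)
  exact Subgroup.index_ne_zero_of_finite

variable {p : ℕ} {K : Type*} [Field K] [NumberField K] {U : Subgroup (TameAdeleRing p K)ˣ}

instance : IsTopologicalRing (TameAdeleRing p K) :=
  haveI : Fact (∀ v : PlacesAway p K,
      IsOpen (v.1.adicCompletionIntegers K : Set (v.1.adicCompletion K))) :=
    ⟨fun _ => Valued.isOpen_valuationSubring _⟩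
  RestrictedProduct.isTopologicalRing _

variable (p K) in
/-- The units of `∏_{v ∤ p} 𝓞_v`, inside `(𝔸_K^{p,∞})ˣ`. -/
def tameIntegralUnits : ((v : PlacesAway p K) → v.1.adicCompletionIntegers K)ˣ →*
    (TameAdeleRing p K)ˣ :=
  Units.map
    { toFun := fun x => RestrictedProduct.structureMap
        (fun v : PlacesAway p K => v.1.adicCompletion K)
        (fun v => (v.1.adicCompletionIntegers K : Set (v.1.adicCompletion K))) _ x
      map_one' := rfl
      map_mul' := fun _ _ => rfl }

theorem continuous_tameIntegralUnits : Continuous (tameIntegralUnits p K) :=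
  Continuous.units_map _ RestrictedProduct.isEmbedding_structureMap.continuous

theorem isCompact_range_tameIntegralUnits :
    IsCompact ((tameIntegralUnits p K).range : Set (TameAdeleRing p K)ˣ) := by
  rw [MonoidHom.coe_range]
  exact isCompact_range continuous_tameIntegralUnits

theorem exists_unit_of_valued_eq_one {v : HeightOneSpectrum (𝓞 K)} {x : v.adicCompletion K}
    (hx : Valued.v x = 1) : ∃ u : (v.adicCompletionIntegers K)ˣ, u.1.1 = x := by
  have hx' : x ∈ v.adicCompletionIntegers K := hx.le
  obtain ⟨u, hu⟩ := HeightOneSpectrum.adicCompletionIntegers.isUnit_iff_valued_eq_one.2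
    (show Valued.v (⟨x, hx'⟩ : v.adicCompletionIntegers K).1 = 1 from hx)
  exact ⟨u, congrArg Subtype.val hu⟩

theorem unitIdeles_le_unitsAbove : unitIdeles K ≤ unitsAbove p := fun _ hx v =>
  ⟨(hx v.1).le, (inv_mem hx v.1).le⟩

theorem map_unitIdeles_le_range :
    (unitIdeles K).map (Units.map (adeleToTame p K : AdeleRing (𝓞 K) K →* TameAdeleRing p K)) ≤
      (tameIntegralUnits p K).range := by
  rintro _ ⟨x, hx, rfl⟩
  choose u hu using fun v : PlacesAway p K => exists_unit_of_valued_eq_one (hx v.1)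
  exact ⟨MulEquiv.piUnits.symm u, Units.ext (RestrictedProduct.ext _ _ fun v => hu v)⟩

/-- `U · 𝓞_{K,p}ˣ · K_∞°` contains a subgroup of finite index of `∏_v 𝓞_vˣ × (K ⊗ ℝ)ˣ`. -/
theorem relIndex_levelUnits_unitIdeles_ne_zero (hU : IsOpen (U : Set (TameAdeleRing p K)ˣ)) :
    (levelUnits U).relIndex (unitIdeles K) ≠ 0 := by
  let T : (AdeleRing (𝓞 K) K)ˣ →* (TameAdeleRing p K)ˣ :=
    Units.map (adeleToTame p K : AdeleRing (𝓞 K) K →* TameAdeleRing p K)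
  let I : (AdeleRing (𝓞 K) K)ˣ →* (InfiniteAdeleRing K)ˣ :=
    Units.map (adeleToInfinite K : AdeleRing (𝓞 K) K →* InfiniteAdeleRing K)
  have h : levelUnits U = U.comap T ⊓
      ((Subgroup.connectedComponentOfOne (InfiniteAdeleRing K)ˣ).comap I ⊓ unitsAbove p) := by
    ext x
    exact mem_levelUnits_iff
  rw [h]
  refine Subgroup.relIndex_inf_ne_zero ?_ (Subgroup.relIndex_inf_ne_zero ?_ ?_)
  · rw [Subgroup.relIndex_comap]
    exact mt (Subgroup.relIndex_eq_zero_of_le_right map_unitIdeles_le_range)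
      (relIndex_ne_zero_of_isOpen_of_isCompact hU isCompact_range_tameIntegralUnits)
  · rw [Subgroup.relIndex_comap]
    have : (Subgroup.connectedComponentOfOne (InfiniteAdeleRing K)ˣ).FiniteIndex :=
      ⟨index_connectedComponentOfOne_infinite_ne_zero K⟩
    exact Subgroup.isFiniteRelIndex_of_finiteIndex.relIndex_ne_zero
  · rw [Subgroup.relIndex_eq_one.2 unitIdeles_le_unitsAbove]
    exact one_ne_zero

/-- The group `Kˣ · U · 𝓞_{K,p}ˣ · K_∞°` has finite index in the ideles. -/
theorem index_principalIdele_sup_levelUnits_ne_zero (hU : IsOpen (U : Set (TameAdeleRing p K)ˣ)) :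
    ((principalIdele K).range ⊔ levelUnits U).index ≠ 0 := by
  let N : Subgroup (AdeleRing (𝓞 K) K)ˣ := (principalIdele K).range ⊔ levelUnits U
  have h1 : N.relIndex (unitIdeles K) ≠ 0 := mt
    (Subgroup.relIndex_eq_zero_of_le_left (show levelUnits U ≤ N from le_sup_right))
    (relIndex_levelUnits_unitIdeles_ne_zero hU)
  have h2 : (unitIdeles K ⊔ N).index ≠ 0 := fun h =>
    index_principalIdele_sup_unitIdeles_ne_zero (Nat.eq_zero_of_zero_dvd
      (h ▸ Subgroup.index_dvd_of_le (sup_le (le_sup_of_le_right le_sup_left) le_sup_left)))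
  rw [← Subgroup.relIndex_sup_right] at h1
  rw [← Subgroup.relIndex_mul_index (le_sup_right : N ≤ unitIdeles K ⊔ N)]
  exact mul_ne_zero h1 h2

/-- The subgroup `Q(U)` of `H(U)` has finite index. -/
theorem index_range_qToH_ne_zero (hU : IsOpen (U : Set (TameAdeleRing p K)ˣ)) :
    (qToH U).range.index ≠ 0 := by
  have h : (principalIdele K).range ⊔ levelUnits U ≤
      (qToH U).range.comap (QuotientGroup.mk' (levelSubgroup U).topologicalClosure) := by
    have h0 : ∀ x ∈ levelSubgroup U, x ∈
        (qToH U).range.comap (QuotientGroup.mk' (levelSubgroup U).topologicalClosure) := by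
      intro x hx
      rw [Subgroup.mem_comap, QuotientGroup.mk'_apply,
        (QuotientGroup.eq_one_iff x).2 (Subgroup.le_topologicalClosure _ hx)]
      exact one_mem _
    refine sup_le ?_ (sup_le (sup_le ?_ ?_) ?_)
    · exact fun x hx => h0 x (Subgroup.mem_sup_left (Subgroup.mem_sup_left hx))
    · exact fun x hx => h0 x (Subgroup.mem_sup_left (Subgroup.mem_sup_right hx))
    · rintro _ ⟨y, rfl⟩
      exact ⟨QuotientGroup.mk y, rfl⟩
    · exact fun x hx => h0 x (Subgroup.mem_sup_right hx)
  rw [← Subgroup.index_comap_of_surjective _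
    (QuotientGroup.mk'_surjective (levelSubgroup U).topologicalClosure)]
  exact fun h' => index_principalIdele_sup_levelUnits_ne_zero hU
    (Nat.eq_zero_of_zero_dvd (h' ▸ Subgroup.index_dvd_of_le h))

end FiniteIndex

/-! ### The group `Γ(U)` and the units of `𝓞_K` -/

section GlobalUnits

variable {p : ℕ} {K : Type*} [Field K] [NumberField K] {U : Subgroup (TameAdeleRing p K)ˣ}

/-- The projection of the tame adeles to the completion at a place. -/
def tameEval (v : PlacesAway p K) : TameAdeleRing p K →+* v.1.adicCompletion K where
  toFun x := x v
  map_one' := rfl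
  map_mul' _ _ := rfl
  map_zero' := rfl
  map_add' _ _ := rfl

theorem continuous_tameEval (v : PlacesAway p K) : Continuous (tameEval v) :=
  RestrictedProduct.continuous_eval v

/-- A compact subgroup of `K_vˣ` consists of units, because some power of each of its elements is a
unit. -/
theorem valued_tameEval_eq_one (hU : IsCompact (U : Set (TameAdeleRing p K)ˣ))
    {x : (TameAdeleRing p K)ˣ} (hx : x ∈ U) (v : PlacesAway p K) :
    Valued.v (tameEval v x.1) = 1 := by
  let f : (TameAdeleRing p K)ˣ →* (v.1.adicCompletion K)ˣ :=
    Units.map (tameEval v : TameAdeleRing p K →* v.1.adicCompletion K)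
  have hf : Continuous f := (continuous_tameEval v).units_map _
  let O : Subgroup (v.1.adicCompletion K)ˣ := (v.1.adicCompletionIntegers K).units
  have hO : IsOpen (O : Set (v.1.adicCompletion K)ˣ) :=
    Submonoid.isOpen_units (Valued.isOpen_valuationSubring (v.1.adicCompletion K))
  have hopen : IsOpen (O.comap f : Set (TameAdeleRing p K)ˣ) := hO.preimage hf
  obtain ⟨m, hm0, -, hm⟩ := Subgroup.exists_pow_mem_of_relIndex_ne_zero
    (relIndex_ne_zero_of_isOpen_of_isCompact hopen hU) hx
  have h4 : Valued.v (f (x ^ m)).1 = 1 :=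
    HeightOneSpectrum.adicCompletionIntegers.mem_units_iff_valued_eq_one.1 hm.1
  rw [map_pow, Units.val_pow_eq_pow_val, map_pow] at h4
  exact pow_eq_one_iff.1 h4 |>.resolve_right hm0.ne'

/-- Compactness of `U` makes `U · 𝓞_{K,p}ˣ · K_∞°` consist of ideles that are units at all finite
places. -/
theorem levelUnits_le_unitIdeles (hU : IsCompact (U : Set (TameAdeleRing p K)ˣ)) :
    levelUnits U ≤ unitIdeles K := by
  intro x hx v
  obtain ⟨h1, -, h3⟩ := mem_levelUnits_iff.1 hx
  by_cases hv : (p : 𝓞 K) ∈ v.asIdeal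
  · have ha : Valued.v (adeleEval K v x.1) ≤ 1 := (h3 ⟨v, hv⟩).1
    have hb : Valued.v (adeleEval K v (x⁻¹).1) ≤ 1 := (h3 ⟨v, hv⟩).2
    refine le_antisymm ha ?_
    have h : Valued.v (adeleEval K v (x * x⁻¹ : (AdeleRing (𝓞 K) K)ˣ).1) = 1 := by
      rw [mul_inv_cancel, Units.val_one, map_one, map_one]
    rw [Units.val_mul, map_mul, map_mul] at h
    rw [← h]
    exact mul_le_of_le_one_right' hb
  · exact valued_tameEval_eq_one hU h1 ⟨v, hv⟩

theorem exists_unit_of_principalIdele_mem {k : Kˣ} (hk : principalIdele K k ∈ unitIdeles K) :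
    ∃ u : (𝓞 K)ˣ, algebraMap (𝓞 K) K u = k := by
  have hval : ∀ l : Kˣ, principalIdele K l ∈ unitIdeles K →
      ∃ a : 𝓞 K, algebraMap (𝓞 K) K a = l := fun l hl =>
    HeightOneSpectrum.mem_integers_of_valuation_le_one K (l : K) fun v =>
      ((HeightOneSpectrum.valuedAdicCompletion_eq_valuation' v (l : K)).symm.trans (hl v)).le
  obtain ⟨a, ha⟩ := hval k hk
  obtain ⟨b, hb⟩ := hval k⁻¹ (by rw [map_inv]; exact inv_mem hk)
  have hab : a * b = 1 := FaithfulSMul.algebraMap_injective (𝓞 K) K (by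
    rw [map_mul, ha, hb, Units.mul_inv, map_one])
  exact ⟨⟨a, b, hab, (mul_comm b a).trans hab⟩, ha⟩

variable (K) in
/-- The unit of `K` underlying a unit of `𝓞 K`. -/
def unitsToField : (𝓞 K)ˣ →* Kˣ := Units.map (algebraMap (𝓞 K) K : 𝓞 K →* K)

theorem principalIdele_unitsToField_mem (u : (𝓞 K)ˣ) :
    principalIdele K (unitsToField K u) ∈ unitIdeles K := fun v =>
  (HeightOneSpectrum.valuedAdicCompletion_eq_valuation' v (algebraMap (𝓞 K) K u)).trans
    (v.valuation_eq_one_iff_notMem.2 fun h =>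
      v.isPrime.ne_top (Ideal.eq_top_of_isUnit_mem _ h u.isUnit))

/-- The group `Γ(U)` consists of units of `𝓞 K`. -/
theorem globalUnitsAt_le_range (hU : IsCompact (U : Set (TameAdeleRing p K)ˣ)) :
    globalUnitsAt U ≤ (globalToUnitsAt p K).range := by
  rintro x ⟨k, hk, hkx⟩
  obtain ⟨u, hu⟩ := exists_unit_of_principalIdele_mem (levelUnits_le_unitIdeles hU hk)
  refine ⟨u, Units.ext (funext fun v => Subtype.ext ?_)⟩
  rw [hkx, ← hu]
  rfl

/-- A power of every unit of `𝓞 K` lies in `Γ(U)`. -/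
theorem exists_pow_globalToUnitsAt_mem (hU : IsOpen (U : Set (TameAdeleRing p K)ˣ)) :
    ∃ m : ℕ, m ≠ 0 ∧ ∀ u : (𝓞 K)ˣ, globalToUnitsAt p K u ^ m ∈ globalUnitsAt U := by
  refine ⟨_, relIndex_levelUnits_unitIdeles_ne_zero hU, fun u => ?_⟩
  refine ⟨unitsToField K u ^ (levelUnits U).relIndex (unitIdeles K), ?_, fun v => ?_⟩
  · change principalIdele K _ ∈ levelUnits U
    rw [map_pow]
    exact Subgroup.mem_subgroupOf.1 (((levelUnits U).subgroupOf (unitIdeles K)).pow_index_mem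
      ⟨_, principalIdele_unitsToField_mem u⟩)
  · rw [← map_pow, ← map_pow]
    rfl

theorem closure_globalUnitsAt_le (hU : IsCompact (U : Set (TameAdeleRing p K)ˣ)) :
    (globalUnitsAt U).topologicalClosure ≤ (globalToUnitsAt p K).range.topologicalClosure :=
  Subgroup.topologicalClosure_mono (globalUnitsAt_le_range hU)

theorem exists_pow_mem_closure_globalUnitsAt (hU : IsOpen (U : Set (TameAdeleRing p K)ˣ)) :
    ∃ m : ℕ, m ≠ 0 ∧ ∀ z ∈ (globalToUnitsAt p K).range.topologicalClosure,
      z ^ m ∈ (globalUnitsAt U).topologicalClosure := by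
  obtain ⟨m, hm, h⟩ := exists_pow_globalToUnitsAt_mem hU
  refine ⟨m, hm, fun z hz => ?_⟩
  have h1 : (globalToUnitsAt p K).range.topologicalClosure ≤
      (globalUnitsAt U).topologicalClosure.comap (powMonoidHom m) := by
    refine Subgroup.topologicalClosure_minimal _ ?_ ?_
    · rintro _ ⟨u, rfl⟩
      exact Subgroup.le_topologicalClosure _ (h u)
    · exact (Subgroup.isClosed_topologicalClosure _).preimage (continuous_pow m)
  exact h1 hz

/-- Dirichlet's unit theorem, with the roots of unity removed by raising to the power of their
number. -/
theorem exists_pow_eq_prod_fundSystem (K : Type*) [Field K] [NumberField K] (u : (𝓞 K)ˣ) :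
    ∃ a : Fin (Units.rank K) → ℤ,
      u ^ Units.torsionOrder K = ∏ i, Units.fundSystem K i ^ a i := by
  obtain ⟨⟨ζ, e⟩, h, -⟩ := Units.exist_unique_eq_mul_prod K u
  refine ⟨fun i => e i * Units.torsionOrder K, ?_⟩
  have hζ : (ζ : (𝓞 K)ˣ) ^ Units.torsionOrder K = 1 := by
    rw [← Subgroup.coe_pow, Units.torsionOrder, pow_card_eq_one', Subgroup.coe_one]
  rw [h, mul_pow, hζ, one_mul, ← Finset.prod_pow]
  refine Finset.prod_congr rfl fun i _ => ?_
  rw [zpow_mul, zpow_natCast]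

end GlobalUnits

/-! ### The groups `H(U)` and `Q(U)` as `p`-adic analytic groups -/

section Level

theorem compactSpace_of_isCompact_subgroup {G : Type*} [Group G] [TopologicalSpace G]
    [IsTopologicalGroup G] {C : Subgroup G} (hC : IsCompact (C : Set G)) (hidx : C.index ≠ 0) :
    CompactSpace G := by
  have : C.FiniteIndex := ⟨hidx⟩
  have : Finite (G ⧸ C) := C.finite_quotient_of_finiteIndex
  refine ⟨?_⟩
  have h : (Set.univ : Set G) = ⋃ q : G ⧸ C, (fun x => q.out * x) '' C := by
    symm
    refine Set.eq_univ_of_forall fun x : G => Set.mem_iUnion.2 ⟨(x : G ⧸ C), ?_⟩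
    exact ⟨_, QuotientGroup.eq.1 (QuotientGroup.out_eq' (x : G ⧸ C)), mul_inv_cancel_left _ x⟩
  rw [h]
  exact isCompact_iUnion fun q => hC.image (continuous_const_mul _)

variable {p : ℕ} {K : Type*} [Field K] [NumberField K]
  {U : Subgroup (TameAdeleRing p K)ˣ}

instance : IsClosed ((levelSubgroup U).topologicalClosure : Set (AdeleRing (𝓞 K) K)ˣ) :=
  Subgroup.isClosed_topologicalClosure _

/-- The group `H(U)` is a finite union of translates of the compact group `Q(U)`. -/
theorem compactSpace_HGroup (hU : IsOpen (U : Set (TameAdeleRing p K)ˣ)) :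
    CompactSpace (HGroup U) := by
  refine compactSpace_of_isCompact_subgroup (C := (qToH U).range) ?_ (index_range_qToH_ne_zero hU)
  rw [MonoidHom.coe_range]
  exact isCompact_range (continuous_qToH U)

variable [Fact p.Prime]

theorem isOpenMap_qToH (hU : IsOpen (U : Set (TameAdeleRing p K)ˣ)) : IsOpenMap (qToH U) :=
  isOpenMap_of_finite_index _ (continuous_qToH U) (injective_qToH hU) (index_range_qToH_ne_zero hU)

/-- The group `Q(U)` contains `ℤ_p^{1 + r₂ + δ}` as an open subgroup. -/
theorem exists_padic_to_QGroup (hUopen : IsOpen (U : Set (TameAdeleRing p K)ˣ))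
    (hUcompact : IsCompact (U : Set (TameAdeleRing p K)ˣ)) :
    ∃ g : Multiplicative (Fin (1 + InfinitePlace.nrComplexPlaces K + leopoldtDefect p K) → ℤ_[p]) →*
      QGroup U, Continuous g ∧ Function.Injective g ∧ IsOpenMap g := by
  obtain ⟨V, ⟨e⟩⟩ := exists_chart_units_integersAt p K
  obtain ⟨m, hm, hpow⟩ := exists_pow_mem_closure_globalUnitsAt hUopen
  have h1 := chartRank_eq_of_pow_mem e (hC := Subgroup.isClosed_topologicalClosure _)
    (hC' := Subgroup.isClosed_topologicalClosure _) (closure_globalUnitsAt_le hUcompact) hm hpow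
  have h2 := chartRank_closure_range_le e (globalToUnitsAt p K) (Units.fundSystem K)
    (Units.torsionOrder_ne_zero K) (exists_pow_eq_prod_fundSystem K)
  have h3 := padicAnalyticDim_eq_chartRank e (globalToUnitsAt p K).range.topologicalClosure
    (Subgroup.isClosed_topologicalClosure _)
  have h4 := InfinitePlace.card_add_two_mul_card_eq_rank K
  have h5 := InfinitePlace.card_eq_nrRealPlaces_add_nrComplexPlaces K
  have h6 : 0 < Fintype.card (InfinitePlace K) := Fintype.card_pos
  have h7 : Units.rank K = Fintype.card (InfinitePlace K) - 1 := rfl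
  -- `[K : ℚ] = r₁ + 2 r₂`, and the rank of the closure of the units is `r₁ + r₂ - 1 - δ`, where the
  -- bound `h2` makes the truncated subtraction defining `δ` exact.
  have hd : Module.finrank ℚ K - chartRank e (globalUnitsAt U).topologicalClosure
      (Subgroup.isClosed_topologicalClosure _) =
      1 + InfinitePlace.nrComplexPlaces K + leopoldtDefect p K := by
    rw [leopoldtDefect, h3, h1]
    omega
  rw [← hd]
  obtain ⟨g, hg, hinj, hidx⟩ := exists_padic_to_quotient e (globalUnitsAt U).topologicalClosure
    (Subgroup.isClosed_topologicalClosure _)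
  have : IsClosed ((globalUnitsAt U).topologicalClosure : Set (IntegersAt p K)ˣ) :=
    Subgroup.isClosed_topologicalClosure _
  exact ⟨g, hg, hinj, isOpenMap_of_finite_index g hg hinj hidx⟩

end Level

/-! ### Morphisms of formal schemes attached to open subgroups -/

section FiniteIndexInclusion

variable {p : ℕ} [Fact p.Prime]
  {G : Type*} [CommGroup G] [TopologicalSpace G] [IsTopologicalGroup G] [CompactSpace G]
  {G' : Type*} [CommGroup G'] [TopologicalSpace G'] [IsTopologicalGroup G'] [CompactSpace G']

omit [IsTopologicalGroup G] [CompactSpace G] in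
theorem finite_quotient_range_of_isOpenMap (f : G →* G') (hopen : IsOpenMap f) :
    Finite (G' ⧸ f.range) :=
  Subgroup.quotient_finite_of_isOpen _ (by rw [MonoidHom.coe_range]; exact hopen.isOpen_range)

theorem mapsOnto_comap_iwasawaMap (f : G →* G') (hf : Continuous f) (hinj : Function.Injective f)
    (hopen : IsOpenMap f) (I : Ideal (IwasawaAlgebra p G')) :
    MapsOnto p (iwasawaMap p f hf) I (I.comap (iwasawaMap p f hf)) :=
  have := finite_quotient_range_of_isOpenMap f hopen
  mapsOnto_comap_of_isIntegral p (IwasawaAlgebra.finite_iwasawaMap f hf hinj hopen).to_isIntegral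
    (IwasawaAlgebra.continuous_iwasawaMap f hf)
    (IwasawaAlgebra.isOpen_map_ideal f hf hinj hopen) I

theorem isFiniteFlatSurjective_iwasawaMap (f : G →* G') (hf : Continuous f)
    (hinj : Function.Injective f) (hopen : IsOpenMap f) :
    IsFiniteFlatSurjective p (iwasawaMap p f hf) :=
  have := finite_quotient_range_of_isOpenMap f hopen
  { continuous := IwasawaAlgebra.continuous_iwasawaMap f hf
    finite := IwasawaAlgebra.finite_iwasawaMap f hf hinj hopen
    flat := IwasawaAlgebra.flat_iwasawaMap f hf hinj hopen
    surjective := by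
      have h := mapsOnto_comap_iwasawaMap (p := p) f hf hinj hopen ⊥
      rwa [Ideal.comap_bot_of_injective _
        (IwasawaAlgebra.injective_iwasawaMap f hf hinj hopen)] at h }

theorem comap_iwasawaMap_mem_minimalPrimes (f : G →* G') (hf : Continuous f)
    (hinj : Function.Injective f) (hopen : IsOpenMap f)
    {P : Ideal (IwasawaAlgebra p G')} (hP : P ∈ minimalPrimes (IwasawaAlgebra p G')) :
    P.comap (iwasawaMap p f hf) ∈ minimalPrimes (IwasawaAlgebra p G) :=
  have := finite_quotient_range_of_isOpenMap f hopen
  comap_mem_minimalPrimes_of_flat (IwasawaAlgebra.flat_iwasawaMap f hf hinj hopen) hP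

/-- If `G'` contains `ℤ_p^d` as an open subgroup, `ℤ_p⟦G'⟧` is finite flat over
`ℤ_p⟦ℤ_p^d⟧ ≅ ℤ_p⟦T₁, …, T_d⟧`, which gives the dimension of its components. -/
theorem dim_iwasawaAlgebra_quotient_minimalPrime {d : ℕ}
    (f : Multiplicative (Fin d → ℤ_[p]) →* G') (hf : Continuous f) (hinj : Function.Injective f)
    (hopen : IsOpenMap f) {P : Ideal (IwasawaAlgebra p G')}
    (hP : P ∈ minimalPrimes (IwasawaAlgebra p G')) :
    formalDim p (IwasawaAlgebra p G' ⧸ P) = d ∧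
      ringKrullDim (IwasawaAlgebra p G' ⧸ P) = (d + 1 : ℕ) :=
  have := finite_quotient_range_of_isOpenMap f hopen
  (isFormallySmoothLike_iwasawaAlgebra p d).dim_quotient_minimalPrime
    (IwasawaAlgebra.finite_iwasawaMap f hf hinj hopen)
    (IwasawaAlgebra.flat_iwasawaMap f hf hinj hopen) hP

end FiniteIndexInclusion

/-! ### The eigenvariety -/

section Eigenvariety

variable {p : ℕ} {K : Type*} [Field K] [NumberField K]
  {U : Subgroup (TameAdeleRing p K)ˣ}

theorem unitsToH_eq_comp : unitsToH U = (qToH U).comp (unitsToQ U) := MonoidHom.ext fun _ => rfl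

variable [Fact p.Prime]

/-- The subgroup `ℤ_p^{1 + r₂ + δ}` of `Q(U)` is open in `H(U)` too. -/
theorem dim_HGroup_quotient_minimalPrime (hUopen : IsOpen (U : Set (TameAdeleRing p K)ˣ))
    (hUcompact : IsCompact (U : Set (TameAdeleRing p K)ˣ))
    {P : Ideal (IwasawaAlgebra p (HGroup U))}
    (hP : P ∈ minimalPrimes (IwasawaAlgebra p (HGroup U))) :
    formalDim p (IwasawaAlgebra p (HGroup U) ⧸ P) =
        ((1 + InfinitePlace.nrComplexPlaces K + leopoldtDefect p K : ℕ) : WithBot ℕ∞) ∧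
      ringKrullDim (IwasawaAlgebra p (HGroup U) ⧸ P) =
        ((1 + InfinitePlace.nrComplexPlaces K + leopoldtDefect p K + 1 : ℕ) : WithBot ℕ∞) := by
  have hH : CompactSpace (HGroup U) := compactSpace_HGroup hUopen
  obtain ⟨g, hg, hginj, hgopen⟩ := exists_padic_to_QGroup hUopen hUcompact
  exact dim_iwasawaAlgebra_quotient_minimalPrime (G' := HGroup U) ((qToH U).comp g)
    ((continuous_qToH U).comp hg) ((injective_qToH hUopen).comp hginj)
    ((isOpenMap_qToH hUopen).comp hgopen) hP

theorem weightMap_eq_comp : weightMap U = (weightMapOnto U).comp (weightInclusion U) := by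
  unfold weightMap weightMapOnto weightInclusion
  rw [← IwasawaAlgebra.iwasawaMap_comp (G := (IntegersAt p K)ˣ) (G' := QGroup U) (G'' := HGroup U)
    (unitsToQ U) (continuous_unitsToQ U) (qToH U) (continuous_qToH U)]
  exact IwasawaAlgebra.iwasawaMap_congr (G := (IntegersAt p K)ˣ) (G' := HGroup U) unitsToH_eq_comp
    _ _

/-- The group `𝓞_{K,p}ˣ` surjects onto `Q(U)`, so its Iwasawa algebra surjects onto that of `Q(U)`,
with the quotient topology by compactness. -/
theorem isFormalClosedImmersion_weightInclusion :
    IsFormalClosedImmersion (weightInclusion U) := by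
  have hsurj : Function.Surjective (unitsToQ U) := QuotientGroup.mk'_surjective _
  have h := IwasawaAlgebra.isOpenQuotientMap_iwasawaMap (p := p) (G := (IntegersAt p K)ˣ)
    (G' := QGroup U) (unitsToQ U) (continuous_unitsToQ U) hsurj
  exact h

end Eigenvariety

end

theorem mainTheorem4 (p : ℕ) [Fact p.Prime] (K : Type*) [Field K] [NumberField K]
    (U : Subgroup (TameAdeleRing p K)ˣ) (hUopen : IsOpen (U : Set (TameAdeleRing p K)ˣ))
    (hUcompact : IsCompact (U : Set (TameAdeleRing p K)ˣ)) :
    -- every irreducible component of `ℰ(U)` has dimension `1 + r₂ + δ`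
    -- and maps onto an irreducible component of `𝒲(U)`
    (∀ 𝔓 ∈ minimalPrimes (IwasawaAlgebra p (HGroup U)),
      formalDim p (IwasawaAlgebra p (HGroup U) ⧸ 𝔓) =
        ((1 + InfinitePlace.nrComplexPlaces K + leopoldtDefect p K : ℕ) : WithBot ℕ∞) ∧
      ringKrullDim (IwasawaAlgebra p (HGroup U) ⧸ 𝔓) =
        ((1 + InfinitePlace.nrComplexPlaces K + leopoldtDefect p K + 1 : ℕ) : WithBot ℕ∞) ∧
      𝔓.comap (weightMapOnto U) ∈ minimalPrimes (IwasawaAlgebra p (QGroup U)) ∧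
      MapsOnto p (weightMapOnto U) 𝔓 (𝔓.comap (weightMapOnto U))) ∧
    -- the morphism `ℰ(U) → 𝒲` is a finite flat surjective morphism `ℰ(U) → 𝒲(U)`
    -- followed by a closed immersion `𝒲(U) → 𝒲`
    weightMap U = (weightMapOnto U).comp (weightInclusion U) ∧
    IsFiniteFlatSurjective p (weightMapOnto U) ∧
    IsFormalClosedImmersion (weightInclusion U) := by
  have hH : CompactSpace (HGroup U) := compactSpace_HGroup hUopen
  have hinj := injective_qToH hUopen
  have hopen := isOpenMap_qToH hUopen
  have hffs := isFiniteFlatSurjective_iwasawaMap (p := p) (G := QGroup U) (G' := HGroup U)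
    (qToH U) (continuous_qToH U) hinj hopen
  refine ⟨fun 𝔓 h𝔓 => ?_, weightMap_eq_comp, hffs, isFormalClosedImmersion_weightInclusion⟩
  have h1 := dim_HGroup_quotient_minimalPrime hUopen hUcompact h𝔓
  have h2 := comap_iwasawaMap_mem_minimalPrimes (G := QGroup U) (G' := HGroup U) (qToH U)
    (continuous_qToH U) hinj hopen h𝔓
  have h3 := mapsOnto_comap_iwasawaMap (G := QGroup U) (G' := HGroup U) (qToH U)
    (continuous_qToH U) hinj hopen 𝔓
  exact ⟨h1.1, h1.2, h2, h3⟩
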